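/- **Setting.** A (1-critical) bi-filtration $F=(K,\phi)$ is a finite simplicial complex $K$ with a map $\phi:K\to\mathbb R^2$ (the critical values), monotone with respect to faces and the componentwise order; it is given as a list of its simplices, each annotated with its critical value. Let $F^1,F^2$ be bi-filtrations all of whose critical values lie in $[0,\infty)^2$, let $n\ge 1$ be their total number of simplices, $X$ and $Y$ the maximal $x$- and $y$-coordinate of a critical value of $F^1$ or $F^2$, and $C=\max\{X,Y\}$. Fix a homological dimension $p$ and let $d_B$ denote the bottleneck distance, in $[0,\infty]$, between the $p$-dimensional persistence diagrams (with $\mathbb Z/2$-coefficients) of two mono-filtrations. *Slices.* For $(\lambda,\mu)\in[0,1]\times[0,\infty)$ and a type in $\{y\text{-steep},y\text{-flat},x\text{-steep},x\text{-flat}\}$, the slice $L$ is the line through $(0,\mu)$ (for $y$-types) or $(\mu,0)$ (for $x$-types) whose slope (for flat types) or inverse slope (for steep types) is $\lambda$. The weighted push of $q=(q_x,q_y)$ to $L$ is $$\mathrm{wpush}_q(L)=\begin{cases}\max\{\lambda(q_y-\mu),\,q_x\}& y\text{-steep}\\ \max\{q_y-\mu,\,\lambda q_x\}& y\text{-flat}\\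 \max\{\lambda q_y,\,q_x-\mu\}& x\text{-steep}\\ \max\{q_y,\,\lambda(q_x-\mu)\}& x\text{-flat}\end{cases}$$ (for $\lambda>0$: the signed distance from the origin $(0,\mu)$ resp. $(\mu,0)$ of $L$ to the smallest point $\ge q$ on $L$, times $\sin\gamma$ if $L$ is flat and $\cos\gamma$ if $L$ is steep, $\gamma$ being the angle between $L$ and the $x$-axis). $F_L$ is the mono-filtration $\sigma\mapsto\mathrm{wpush}_{\phi(\sigma)}(L)$ of $K$. *Bounds.* Let $B=[\lambda_{\min},\lambda_{\max}]\times[\mu_{\min},\mu_{\max}]$ be a box of parameters of slices of a fixed type, with side lengths $\Delta\lambda,\Delta\mu$ and with center $(\lambda_c,\mu_c)$ parameterizing the slice $L_c$. Put $v(F,B)=\max_{q}\max_{L\in B}|\mathrm{wpush}_q(L)-\mathrm{wpush}_q(L_c)|$, where $q$ runs over the critical values of $F$. The local linear bound for $B$ is $d_B(F^1_{L_c},F^2_{L_c})+v(F^1,B)+v(F^2,B)$. The local constant bound is $d_B(F^1_{L_c},F^2_{L_c})+2\bar v(B)$, where $\bar v(B)$ is $\frac12(\lambda_c\Delta\mu+(Y-\mu_{\min})\Delta\lambda)$,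 $\frac12(\Delta\mu+X\Delta\lambda)$, $\frac12(\Delta\mu+Y\Delta\lambda)$, $\frac12(\lambda_c\Delta\mu+(X-\mu_{\min})\Delta\lambda)$ for $y$-steep, $y$-flat, $x$-steep, $x$-flat slices, respectively. *The absolute $\varepsilon$-approximation algorithm* ($\varepsilon>0$). Put $[0,1]\times[0,Y]$ ($y$-steep), $[0,1]\times[0,Y]$ ($y$-flat), $[0,1]\times[0,X]$ ($x$-steep), $[0,1]\times[0,X]$ ($x$-flat) into a FIFO-queue and set $\rho=0$. While the queue is non-empty, pop a box $B$, replace $\rho$ by $\max\{\rho,d_B(F^1_{L_c},F^2_{L_c})\}$, and, if the chosen bound for $B$ exceeds $\rho+\varepsilon$, enqueue the four equal sub-boxes into which the center of $B$ splits $B$. When the queue is empty, return $\rho$. **Theorem.** With either the local linear or the local constant bound, the algorithm terminates for every input, and it runs in $$O\!\left(n^3\,\max\{1,C/\varepsilon\}^2\right)$$ steps, i.e. in $O(n^3(C/\varepsilon)^2)$ steps if $\varepsilon\le C$. Precisely, for either bound there are a real RAM program and an absolute constant $c$ such that for all $F^1,F^2,p,\varepsilon$ as above the program, given $(F^1,F^2,p,\varepsilon)$,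 halts after at most $c\,n^3\max\{1,C/\varepsilon\}^2$ steps and has written to its memory the complete run of the algorithm: the sequence of the boxes popped, the value of $\rho$ after each iteration, the number of iterations, and the returned value. Here a real RAM performs exact arithmetic operations and comparisons of real numbers, additions, truncated subtractions and comparisons of natural numbers, and memory accesses at unit cost. -/

import Mathlib

open scoped ENNReal

noncomputable section

namespace MatchDist

/-! ## Bi-filtered simplicial complexes -/

/-- A finite abstract simplicial complex (vertices are natural numbers) given as a list of its
`n` simplices without repetition, each simplex being annotated with its critical value in the
plane; critical values are monotone under the face relation, for the componentwise order.
The complex may be empty. -/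
structure BiFiltration where
  n : ℕ
  simplex : Fin n → Finset ℕ
  simplex_injective : Function.Injective simplex
  simplex_nonempty : ∀ i, (simplex i).Nonempty
  face_mem : ∀ i, ∀ τ ⊆ simplex i, τ.Nonempty → ∃ j, simplex j = τ
  val : Fin n → ℝ × ℝ
  val_mono : ∀ i j, simplex i ⊆ simplex j → val i ≤ val j

/-- All critical values lie in the closed upper-right quadrant. -/
def BiFiltration.InQuadrant (F : BiFiltration) : Prop := ∀ i, 0 ≤ F.val i

/-- The maximal `x`-coordinate of the critical values of `F₁` and `F₂`, for bi-filtrations in the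
upper-right quadrant with at least one simplex in total (an empty family contributes `0`). -/
def maxX (F₁ F₂ : BiFiltration) : ℝ := max (⨆ i, (F₁.val i).1) (⨆ i, (F₂.val i).1)

/-- The maximal `y`-coordinate of the critical values, with the same convention. -/
def maxY (F₁ F₂ : BiFiltration) : ℝ := max (⨆ i, (F₁.val i).2) (⨆ i, (F₂.val i).2)

/-! ## Persistent homology with coefficients in `ℤ/2` -/

section Homology

variable {n : ℕ} (σ : Fin n → Finset ℕ)

/-- The boundary operator on simplicial chains with `ℤ/2` coefficients: a simplex is sent to the
sum of its facets (a vertex is sent to `0`, the empty set not being a simplex). -/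
def boundary : (Fin n → ZMod 2) →ₗ[ZMod 2] (Fin n → ZMod 2) :=
  Matrix.mulVecLin (Matrix.of fun i j =>
    if σ i ⊆ σ j ∧ (σ i).card + 1 = (σ j).card then 1 else 0)

/-- The `p`-chains supported on the simplices with indices in `A`. -/
def chains (p : ℕ) (A : Set (Fin n)) : Submodule (ZMod 2) (Fin n → ZMod 2) where
  carrier := {c | ∀ i, c i ≠ 0 → i ∈ A ∧ (σ i).card = p + 1}
  zero_mem' := fun i h => absurd rfl h
  add_mem' := by
    intro a b ha hb i h
    by_cases h0 : a i = 0
    · refine hb i fun h1 => h ?_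
      simp [h0, h1]
    · exact ha i h0
  smul_mem' := by
    intro c a ha i h
    refine ha i fun h0 => h ?_
    simp [h0]

/-- The `p`-cycles of the subcomplex `A`. -/
def cycles (p : ℕ) (A : Set (Fin n)) : Submodule (ZMod 2) (Fin n → ZMod 2) :=
  chains σ p A ⊓ LinearMap.ker (boundary σ)

/-- The `p`-boundaries of the subcomplex `A`. -/
def boundaries (p : ℕ) (A : Set (Fin n)) : Submodule (ZMod 2) (Fin n → ZMod 2) :=
  (chains σ (p + 1) A).map (boundary σ)

/-- The persistent Betti number of subcomplexes `A ⊆ A'`: the rank of the map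
`H_p(A) → H_p(A')`, that is, the dimension of the space of classes of `p`-cycles of `A`
modulo the `p`-boundaries of `A'`. -/
def persistentBetti (p : ℕ) (A A' : Set (Fin n)) : ℕ :=
  Module.finrank (ZMod 2) ((cycles σ p A).map (boundaries σ p A').mkQ)

variable (f : Fin n → ℝ)

/-- The sublevel complex `{f ≤ v}`. -/
def subLE (v : ℝ) : Set (Fin n) := {i | f i ≤ v}

/-- The open sublevel complex `{f < v}`, i.e. the sublevel complex just before `v`. -/
def subLT (v : ℝ) : Set (Fin n) := {i | f i < v}

/-- The pairMultiplicity of the point `(b, d)`, `b < d ≤ ∞`, in the `p`-th persistence diagram of the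
mono-filtration `f`: the number of independent classes born at `b` and dying at `d` (for `d = ∞`:
born at `b` and never dying), by inclusion-exclusion of ranks. -/
def pairMultiplicity (p : ℕ) (b : ℝ) : WithTop ℝ → ℕ
  | ⊤ => persistentBetti σ p (subLE f b) Set.univ - persistentBetti σ p (subLT f b) Set.univ
  | (d : ℝ) =>
    (persistentBetti σ p (subLE f b) (subLT f d) + persistentBetti σ p (subLT f b) (subLE f d)) -
    (persistentBetti σ p (subLT f b) (subLT f d) + persistentBetti σ p (subLE f b) (subLE f d))

/-- The persistence diagram in homological dimension `p` of the mono-filtration `f` of the complex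
`σ`. Births, and deaths other than `∞`, are critical values. -/
def diagram (p : ℕ) : Multiset (ℝ × WithTop ℝ) :=
  ∑ b ∈ Finset.univ.image f,
    (Multiset.replicate (pairMultiplicity σ f p b ⊤) (b, ⊤) +
      ∑ d ∈ (Finset.univ.image f).filter (fun d => b < d),
        Multiset.replicate (pairMultiplicity σ f p b (d : WithTop ℝ)) (b, (d : WithTop ℝ)))

end Homology

/-! ## Bottleneck distance -/

/-- `|y - y'|` for death values, with `∞ - ∞ = 0`. -/
def deathDist : WithTop ℝ → WithTop ℝ → ℝ≥0∞
  | ⊤, ⊤ => 0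
  | (y : ℝ), (y' : ℝ) => ENNReal.ofReal |y - y'|
  | ⊤, (_ : ℝ) => ⊤
  | (_ : ℝ), ⊤ => ⊤

/-- The `L_∞`-cost of matching two diagram points. -/
def matchCost (a b : ℝ × WithTop ℝ) : ℝ≥0∞ :=
  max (ENNReal.ofReal |a.1 - b.1|) (deathDist a.2 b.2)

/-- The cost of an unmatched diagram point, its `L_∞`-distance to the diagonal. -/
def diagonalCost : ℝ × WithTop ℝ → ℝ≥0∞
  | (_, ⊤) => ⊤
  | (x, (y : ℝ)) => ENNReal.ofReal ((y - x) / 2)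

/-- `M`, a multiset of pairs, is a partial matching of the multisets `D₁` and `D₂`. -/
def IsPartialMatching (D₁ D₂ : Multiset (ℝ × WithTop ℝ))
    (M : Multiset ((ℝ × WithTop ℝ) × (ℝ × WithTop ℝ))) : Prop :=
  M.map Prod.fst ≤ D₁ ∧ M.map Prod.snd ≤ D₂

/-- The cost of a partial matching: the maximum over all matched pairs and unmatched points. -/
def matchingCost (D₁ D₂ : Multiset (ℝ × WithTop ℝ))
    (M : Multiset ((ℝ × WithTop ℝ) × (ℝ × WithTop ℝ))) : ℝ≥0∞ :=
  max (M.map fun e => matchCost e.1 e.2).sup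
    (max ((D₁ - M.map Prod.fst).map diagonalCost).sup
      ((D₂ - M.map Prod.snd).map diagonalCost).sup)

/-- The bottleneck distance of two persistence diagrams, a value in `[0, ∞]`. -/
def bottleneck (D₁ D₂ : Multiset (ℝ × WithTop ℝ)) : ℝ≥0∞ :=
  ⨅ (M : Multiset ((ℝ × WithTop ℝ) × (ℝ × WithTop ℝ))) (_ : IsPartialMatching D₁ D₂ M),
    matchingCost D₁ D₂ M

/-! ## Slices and weighted pushes -/

/-- The four types of slices. -/
inductive SliceType
  | ySteep
  | yFlat
  | xSteep
  | xFlat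

/-- The origin of the slice of type `t` with parameters `(l, m)`. -/
def sliceOrigin (t : SliceType) (m : ℝ) : ℝ × ℝ :=
  match t with
  | .ySteep | .yFlat => (0, m)
  | .xSteep | .xFlat => (m, 0)

/-- The angle with the `x`-axis of the slice of type `t` with parameter `l`: `l` is its tangent for
flat slices and its cotangent for steep slices. -/
def sliceAngle (t : SliceType) (l : ℝ) : ℝ :=
  match t with
  | .yFlat | .xFlat => Real.arctan l
  | .ySteep | .xSteep => Real.pi / 2 - Real.arctan l

/-- The weight of a slice. -/
def sliceWeight (t : SliceType) (l : ℝ) : ℝ :=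
  match t with
  | .yFlat | .xFlat => Real.sin (sliceAngle t l)
  | .ySteep | .xSteep => Real.cos (sliceAngle t l)

/-- The weighted push of the point `q` to the slice of type `t` with parameters `(l, m)`, where
`0 ≤ l ≤ 1` and `l = 0` is the limit case of horizontal (flat) and vertical (steep) lines.
The first entry of each maximum is the value for `q` above the slice, the second one the value for
`q` below; `q` is above the slice iff the first entry is the larger one. For `0 < l` this is the
weight of the slice times the signed distance from the origin of the slice to the smallest point
`≥ q` of the slice, see `isLeast_push`. -/
def wpush (t : SliceType) (l m : ℝ) (q : ℝ × ℝ) : ℝ :=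
  match t with
  | .ySteep => max (l * (q.2 - m)) q.1
  | .yFlat => max (q.2 - m) (l * q.1)
  | .xSteep => max (l * q.2) (q.1 - m)
  | .xFlat => max q.2 (l * (q.1 - m))

/-- The weighted push is the weight times the push: among all `r` for which the point at signed
distance `r` from the origin along the slice dominates `q`, the least one is
`wpush t l m q / sliceWeight t l`. -/
theorem isLeast_push (t : SliceType) (l m : ℝ) (hl : 0 < l) (q : ℝ × ℝ) :
    0 < sliceWeight t l ∧
    IsLeast {r : ℝ | q ≤ sliceOrigin t m +
        r • (Real.cos (sliceAngle t l), Real.sin (sliceAngle t l))}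
      (wpush t l m q / sliceWeight t l) := by
  have hs : 0 < √(1 + l ^ 2) := Real.sqrt_pos.mpr (by positivity)
  have key : ∀ (c s w a b A B : ℝ), 0 < w → 0 < c → 0 < s →
      A = w * (a / c) → B = w * (b / s) →
      IsLeast {r : ℝ | a ≤ r * c ∧ b ≤ r * s} (max A B / w) := by
    intro c s w a b A B hw hc hs hA hB
    have h : max A B / w = max (a / c) (b / s) := by
      rw [hA, hB, ← mul_max_of_nonneg _ _ hw.le, mul_div_cancel_left₀ _ hw.ne']
    rw [h]
    refine ⟨⟨?_, ?_⟩, ?_⟩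
    · rw [← div_le_iff₀ hc]; exact le_max_left _ _
    · rw [← div_le_iff₀ hs]; exact le_max_right _ _
    · rintro r ⟨h1, h2⟩
      exact max_le ((div_le_iff₀ hc).mpr h1) ((div_le_iff₀ hs).mpr h2)
  cases t <;>
    simp only [sliceWeight, sliceAngle, sliceOrigin, wpush, Real.cos_pi_div_two_sub,
      Real.sin_pi_div_two_sub, Real.sin_arctan, Real.cos_arctan, Prod.le_def, Prod.fst_add,
      Prod.snd_add, Prod.smul_fst, Prod.smul_snd, smul_eq_mul, zero_add] <;>
    refine ⟨by positivity, ?_⟩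
  · have := key (l / √(1 + l ^ 2)) (1 / √(1 + l ^ 2)) (l / √(1 + l ^ 2)) q.1 (q.2 - m)
      q.1 (l * (q.2 - m)) (by positivity) (by positivity) (by positivity)
      (by field_simp) (by field_simp)
    rw [max_comm] at this
    simpa only [sub_le_iff_le_add'] using this
  · have := key (1 / √(1 + l ^ 2)) (l / √(1 + l ^ 2)) (l / √(1 + l ^ 2)) q.1 (q.2 - m)
      (l * q.1) (q.2 - m) (by positivity) (by positivity) (by positivity)
      (by field_simp) (by field_simp)
    rw [max_comm] at this
    simpa only [sub_le_iff_le_add'] using this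
  · have := key (l / √(1 + l ^ 2)) (1 / √(1 + l ^ 2)) (l / √(1 + l ^ 2)) (q.1 - m) q.2
      (q.1 - m) (l * q.2) (by positivity) (by positivity) (by positivity)
      (by field_simp) (by field_simp)
    rw [max_comm] at this
    simpa only [sub_le_iff_le_add'] using this
  · have := key (1 / √(1 + l ^ 2)) (l / √(1 + l ^ 2)) (l / √(1 + l ^ 2)) (q.1 - m) q.2
      (l * (q.1 - m)) q.2 (by positivity) (by positivity) (by positivity)
      (by field_simp) (by field_simp)
    rw [max_comm] at this
    simpa only [sub_le_iff_le_add'] using this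

/-- The critical values of the weighted restriction of `F` to a slice. -/
def restriction (F : BiFiltration) (t : SliceType) (l m : ℝ) : Fin F.n → ℝ :=
  fun i => wpush t l m (F.val i)

/-- `Eval`: the bottleneck distance, in homological dimension `p`, of the weighted restrictions of
two bi-filtrations to a slice. -/
def evalDist (F₁ F₂ : BiFiltration) (p : ℕ) (t : SliceType) (l m : ℝ) : ℝ≥0∞ :=
  bottleneck (diagram F₁.simplex (restriction F₁ t l m) p)
    (diagram F₂.simplex (restriction F₂ t l m) p)

/-! ## Boxes and the two bounds -/

/-- A box in parameter space, with the type of the slices that it parameterizes. -/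
structure Box where
  type : SliceType
  lmin : ℝ
  lmax : ℝ
  mmin : ℝ
  mmax : ℝ

namespace Box

def lmid (B : Box) : ℝ := (B.lmin + B.lmax) / 2

def mmid (B : Box) : ℝ := (B.mmin + B.mmax) / 2

/-- The four sub-boxes of equal dimensions. -/
def split (B : Box) : List Box :=
  [⟨B.type, B.lmin, B.lmid, B.mmin, B.mmid⟩, ⟨B.type, B.lmid, B.lmax, B.mmin, B.mmid⟩,
    ⟨B.type, B.lmin, B.lmid, B.mmid, B.mmax⟩, ⟨B.type, B.lmid, B.lmax, B.mmid, B.mmax⟩]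

end Box

/-- The variation of a point within a box. -/
def pointVariation (B : Box) (q : ℝ × ℝ) : ℝ :=
  sSup ((fun L : ℝ × ℝ => |wpush B.type L.1 L.2 q - wpush B.type B.lmid B.mmid q|) ''
    (Set.Icc B.lmin B.lmax ×ˢ Set.Icc B.mmin B.mmax))

/-- The variation of a bi-filtration within a box: the maximal variation of its critical values. -/
def variation (F : BiFiltration) (B : Box) : ℝ := ⨆ i, pointVariation B (F.val i)

/-- The upper bound for the variation within a box of all points of `[0, X] × [0, Y]` that depends
only on the box, on `X` and on `Y`. -/
def constantVariation (X Y : ℝ) (B : Box) : ℝ :=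
  match B.type with
  | .yFlat => ((B.mmax - B.mmin) + X * (B.lmax - B.lmin)) / 2
  | .ySteep => (B.lmid * (B.mmax - B.mmin) + (Y - B.mmin) * (B.lmax - B.lmin)) / 2
  | .xFlat => (B.lmid * (B.mmax - B.mmin) + (X - B.mmin) * (B.lmax - B.lmin)) / 2
  | .xSteep => ((B.mmax - B.mmin) + Y * (B.lmax - B.lmin)) / 2

/-- The two realizations of the `Bound` primitive. -/
inductive BoundKind
  | linear
  | constant

/-- `Bound`: the distance at the center slice plus the variations (local linear bound) or their
constant-time estimates (local constant bound) for both bi-filtrations. -/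
def upperBound (kind : BoundKind) (F₁ F₂ : BiFiltration) (p : ℕ) (B : Box) : ℝ≥0∞ :=
  evalDist F₁ F₂ p B.type B.lmid B.mmid +
    match kind with
    | .linear => ENNReal.ofReal (variation F₁ B + variation F₂ B)
    | .constant => ENNReal.ofReal (2 * constantVariation (maxX F₁ F₂) (maxY F₁ F₂) B)

/-! ## The absolute approximation algorithm -/

/-- A state of the algorithm: the FIFO-queue and the largest distance encountered so far. -/
structure AlgState where
  queue : List Box
  rho : ℝ≥0∞

def initialState (F₁ F₂ : BiFiltration) : AlgState where
  queue := [⟨.ySteep, 0, 1, 0, maxY F₁ F₂⟩, ⟨.yFlat, 0, 1, 0, maxY F₁ F₂⟩,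
    ⟨.xSteep, 0, 1, 0, maxX F₁ F₂⟩, ⟨.xFlat, 0, 1, 0, maxX F₁ F₂⟩]
  rho := 0

open scoped Classical in
/-- One iteration: pop a box, update `rho` by the value at the center slice, and enqueue the four
sub-boxes if the bound exceeds the updated `rho` by more than `ε`. Nothing happens if the queue is
empty. -/
def iterate (kind : BoundKind) (F₁ F₂ : BiFiltration) (p : ℕ) (ε : ℝ) (S : AlgState) : AlgState :=
  match S.queue with
  | [] => S
  | B :: rest =>
    let rho' := max S.rho (evalDist F₁ F₂ p B.type B.lmid B.mmid)
    if rho' + ENNReal.ofReal ε < upperBound kind F₁ F₂ p B then ⟨rest ++ B.split, rho'⟩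
    else ⟨rest, rho'⟩

/-- The state of the algorithm after `k` iterations. -/
def stateAfter (kind : BoundKind) (F₁ F₂ : BiFiltration) (p : ℕ) (ε : ℝ) (k : ℕ) : AlgState :=
  (iterate kind F₁ F₂ p ε)^[k] (initialState F₁ F₂)

/-! ## The machine model: a real RAM

A random access machine over the reals, programmed in a structured imperative language. The memory
consists of two-dimensional arrays of natural numbers and of real numbers, each array having a name
in `ℕ`. A program is a finite text, so it uses a fixed number of array names, and its only literals
are natural numbers. There is no conversion between real and natural numbers, no rounding,
and no multiplication or division of natural numbers. Each memory access, literal, arithmetic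
operation, comparison, and assignment costs one step. -/

/-- The memory: array name, row, column. -/
structure Store where
  nat : ℕ → ℕ → ℕ → ℕ
  real : ℕ → ℕ → ℕ → ℝ

def Store.setNat (s : Store) (a i j v : ℕ) : Store where
  nat := fun a' i' j' => if a' = a ∧ i' = i ∧ j' = j then v else s.nat a' i' j'
  real := s.real

def Store.setReal (s : Store) (a i j : ℕ) (v : ℝ) : Store where
  nat := s.nat
  real := fun a' i' j' => if a' = a ∧ i' = i ∧ j' = j then v else s.real a' i' j'

/-- Expressions for natural numbers. Subtraction is truncated at `0`. -/
inductive NatExpr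
  | lit (k : ℕ)
  | get (a : ℕ) (i j : NatExpr)
  | add (e e' : NatExpr)
  | sub (e e' : NatExpr)

/-- Expressions for real numbers. Division by `0` yields `0`. -/
inductive RealExpr
  | lit (k : ℕ)
  | get (a : ℕ) (i j : NatExpr)
  | add (e e' : RealExpr)
  | sub (e e' : RealExpr)
  | mul (e e' : RealExpr)
  | div (e e' : RealExpr)

/-- Tests. -/
inductive Test
  | natEq (e e' : NatExpr)
  | natLt (e e' : NatExpr)
  | realEq (e e' : RealExpr)
  | realLt (e e' : RealExpr)
  | not (b : Test)
  | and (b b' : Test)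

/-- Programs. -/
inductive Program
  | skip
  | setNat (a : ℕ) (i j e : NatExpr)
  | setReal (a : ℕ) (i j : NatExpr) (e : RealExpr)
  | seq (P Q : Program)
  | cond (b : Test) (P Q : Program)
  | loop (b : Test) (P : Program)

def NatExpr.eval (s : Store) : NatExpr → ℕ
  | .lit k => k
  | .get a i j => s.nat a (i.eval s) (j.eval s)
  | .add e e' => e.eval s + e'.eval s
  | .sub e e' => e.eval s - e'.eval s

def NatExpr.cost : NatExpr → ℕ
  | .lit _ => 1
  | .get _ i j => i.cost + j.cost + 1
  | .add e e' => e.cost + e'.cost + 1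
  | .sub e e' => e.cost + e'.cost + 1

def RealExpr.eval (s : Store) : RealExpr → ℝ
  | .lit k => k
  | .get a i j => s.real a (i.eval s) (j.eval s)
  | .add e e' => e.eval s + e'.eval s
  | .sub e e' => e.eval s - e'.eval s
  | .mul e e' => e.eval s * e'.eval s
  | .div e e' => e.eval s / e'.eval s

def RealExpr.cost : RealExpr → ℕ
  | .lit _ => 1
  | .get _ i j => i.cost + j.cost + 1
  | .add e e' => e.cost + e'.cost + 1
  | .sub e e' => e.cost + e'.cost + 1
  | .mul e e' => e.cost + e'.cost + 1
  | .div e e' => e.cost + e'.cost + 1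

def Test.Holds (s : Store) : Test → Prop
  | .natEq e e' => e.eval s = e'.eval s
  | .natLt e e' => e.eval s < e'.eval s
  | .realEq e e' => e.eval s = e'.eval s
  | .realLt e e' => e.eval s < e'.eval s
  | .not b => ¬ b.Holds s
  | .and b b' => b.Holds s ∧ b'.Holds s

def Test.cost : Test → ℕ
  | .natEq e e' => e.cost + e'.cost + 1
  | .natLt e e' => e.cost + e'.cost + 1
  | .realEq e e' => e.cost + e'.cost + 1
  | .realLt e e' => e.cost + e'.cost + 1
  | .not b => b.cost + 1
  | .and b b' => b.cost + b'.cost + 1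

/-- `Exec P s s' T`: started in the memory `s`, the program `P` halts in the memory `s'` after
exactly `T` steps. -/
inductive Exec : Program → Store → Store → ℕ → Prop
  | skip (s : Store) : Exec .skip s s 1
  | setNat (s : Store) (a : ℕ) (i j e : NatExpr) :
      Exec (.setNat a i j e) s (s.setNat a (i.eval s) (j.eval s) (e.eval s))
        (i.cost + j.cost + e.cost + 1)
  | setReal (s : Store) (a : ℕ) (i j : NatExpr) (e : RealExpr) :
      Exec (.setReal a i j e) s (s.setReal a (i.eval s) (j.eval s) (e.eval s))
        (i.cost + j.cost + e.cost + 1)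
  | seq {P Q : Program} {s s' s'' : Store} {T T' : ℕ} (hP : Exec P s s' T)
      (hQ : Exec Q s' s'' T') : Exec (.seq P Q) s s'' (T + T')
  | cond_true {b : Test} {P Q : Program} {s s' : Store} {T : ℕ} (hb : b.Holds s)
      (hP : Exec P s s' T) : Exec (.cond b P Q) s s' (b.cost + T)
  | cond_false {b : Test} {P Q : Program} {s s' : Store} {T : ℕ} (hb : ¬ b.Holds s)
      (hQ : Exec Q s s' T) : Exec (.cond b P Q) s s' (b.cost + T)
  | loop_true {b : Test} {P : Program} {s s' s'' : Store} {T T' : ℕ} (hb : b.Holds s)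
      (hP : Exec P s s' T) (hL : Exec (.loop b P) s' s'' T') :
      Exec (.loop b P) s s'' (b.cost + T + T')
  | loop_false {b : Test} {P : Program} {s : Store} (hb : ¬ b.Holds s) :
      Exec (.loop b P) s s b.cost

/-- The machine is deterministic: the final memory and the number of steps are unique. -/
theorem Exec.unique {P : Program} {s s₁ s₂ : Store} {T₁ T₂ : ℕ} (h₁ : Exec P s s₁ T₁)
    (h₂ : Exec P s s₂ T₂) : s₁ = s₂ ∧ T₁ = T₂ := by
  induction h₁ generalizing s₂ T₂ with
  | skip | setNat | setReal => cases h₂; exact ⟨rfl, rfl⟩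
  | seq hP hQ ihP ihQ =>
    cases h₂ with
    | seq hP' hQ' =>
      obtain ⟨rfl, rfl⟩ := ihP hP'
      obtain ⟨rfl, rfl⟩ := ihQ hQ'
      exact ⟨rfl, rfl⟩
  | cond_true hb hP ih =>
    cases h₂ with
    | cond_true _ h => obtain ⟨rfl, rfl⟩ := ih h; exact ⟨rfl, rfl⟩
    | cond_false h => exact absurd hb h
  | cond_false hb hP ih =>
    cases h₂ with
    | cond_true h => exact absurd h hb
    | cond_false _ h => obtain ⟨rfl, rfl⟩ := ih h; exact ⟨rfl, rfl⟩
  | loop_true hb hP hL ihP ihL =>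
    cases h₂ with
    | loop_true _ hP' hL' =>
      obtain ⟨rfl, rfl⟩ := ihP hP'
      obtain ⟨rfl, rfl⟩ := ihL hL'
      exact ⟨rfl, rfl⟩
    | loop_false h => exact absurd hb h
  | loop_false hb =>
    cases h₂ with
    | loop_true h => exact absurd h hb
    | loop_false => exact ⟨rfl, rfl⟩

/-! ## Input and output of the approximation program -/

/-- The input in memory. Natural array `0` holds in row `0` the numbers of simplices of both
bi-filtrations and the homological dimension `p`. For `a = 1, 2`, row `i` of natural array `a` holds
the number of vertices of the `i`-th simplex of `F_a` followed by its vertices in increasing order,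
and row `i` of real array `a` holds its critical value. Real array `0` holds `ε` in row `0`.
Everything else is `0`. -/
def inputStore (F₁ F₂ : BiFiltration) (p : ℕ) (ε : ℝ) : Store where
  nat := fun a i j =>
    match a with
    | 0 => if i = 0 then [F₁.n, F₂.n, p].getD j 0 else 0
    | 1 => if h : i < F₁.n then
        ((F₁.simplex ⟨i, h⟩).card :: (F₁.simplex ⟨i, h⟩).sort (· ≤ ·)).getD j 0 else 0
    | 2 => if h : i < F₂.n then
        ((F₂.simplex ⟨i, h⟩).card :: (F₂.simplex ⟨i, h⟩).sort (· ≤ ·)).getD j 0 else 0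
    | _ => 0
  real := fun a i j =>
    match a with
    | 0 => if i = 0 ∧ j = 0 then ε else 0
    | 1 => if h : i < F₁.n then [(F₁.val ⟨i, h⟩).1, (F₁.val ⟨i, h⟩).2].getD j 0 else 0
    | 2 => if h : i < F₂.n then [(F₂.val ⟨i, h⟩).1, (F₂.val ⟨i, h⟩).2].getD j 0 else 0
    | _ => 0

/-- The code of a slice type. -/
def SliceType.code : SliceType → ℕ
  | .ySteep => 0
  | .yFlat => 1
  | .xSteep => 2
  | .xFlat => 3

/-- A natural number `b` and a real number `r` represent `v ∈ [0, ∞]`: either `b = 1` and `v = ∞`,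
or `b = 0` and `v = r`. -/
def RepresentsValue (b : ℕ) (r : ℝ) (v : ℝ≥0∞) : Prop :=
  (b = 1 ∧ v = ⊤) ∨ (b = 0 ∧ 0 ≤ r ∧ v = ENNReal.ofReal r)

/-- The memory `s` records the run of the algorithm with `N` iterations: the `k`-th row of arrays `3`
holds the box `B` popped in the `k`-th iteration and the value of `rho` after this
iteration; arrays `4` hold `N` and the result. -/
def RecordsRun (s : Store) (kind : BoundKind) (F₁ F₂ : BiFiltration) (p : ℕ) (ε : ℝ)
    (N : ℕ) : Prop :=
  (∀ k < N, ∃ B rest, (stateAfter kind F₁ F₂ p ε k).queue = B :: rest ∧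
    s.nat 3 k 0 = B.type.code ∧
    s.real 3 k 0 = B.lmin ∧ s.real 3 k 1 = B.lmax ∧
    s.real 3 k 2 = B.mmin ∧ s.real 3 k 3 = B.mmax ∧
    RepresentsValue (s.nat 3 k 1) (s.real 3 k 4) (stateAfter kind F₁ F₂ p ε (k + 1)).rho) ∧
  s.nat 4 0 0 = N ∧
  RepresentsValue (s.nat 4 0 1) (s.real 4 0 0) (stateAfter kind F₁ F₂ p ε N).rho

end MatchDist

end

noncomputable section

namespace MatchDist

/-! ## Programs with counting loops only -/

/-! The bound is a product: there are `O(max(1, C/ε)²)` iterations, and each costs `O(n³)` steps.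

Number of iterations. A box that arises by `d` subdivisions has `λ`-width at most `2⁻ᵈ` and
`μ`-width at most `C·2⁻ᵈ`, so a weighted push inside it deviates from its value at the center by at
most `C/2ᵈ` (`abs_wpush_sub_le`). Hence either bound exceeds the distance at the center by at most
`2C/2ᵈ` (`boundTerm_le`). Since `ρ` has just been raised to at least the distance at the center, a
split requires this excess to be larger than `ε` (`lt_boundTerm`). Boxes of depth `D` with `2C ≤
ε·2ᴰ` are therefore never split, and the boxes popped form four quaternary trees of height at most
`D`. A potential that sums the sizes of the trees still possible below the queued boxes gives
termination and the count (`QueueBound.step`, `exists_iterations`).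

Cost of one iteration. Put `N = F₁.n + F₂.n`. The simplices are sorted by their pushes, and the
boundary matrix over `ℤ/2` is reduced from left to right. The lowest entries of the reduced columns
form a pairing, and counting pairs computes every persistent Betti number
(`IsReduction.persistentBetti_add`); so the pairing yields the diagram that is defined by
inclusion-exclusion of ranks (`IsReduction.diagram_eq`). After padding with copies of the diagonal,
the bottleneck distance becomes a bottleneck assignment problem on an `N × N` cost matrix
(`bottleneck_le`, `le_bottleneck`). It is solved exactly by augmenting one row at a time along an
alternating tree grown in Prim's manner. The threshold is raised only when a counting argument in
the style of Hall shows that every assignment needs it (`IsSearch.lowerBound`); each row takes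
`O(N²)` steps. The linear bound is computable because a push is monotone or antitone in each
parameter separately, so that its deviation is extremal at a corner of the box
(`pointVariation_eq`).

Cost on the machine. Everything inside an iteration is an `FProg`, whose loops all have exactly `N`
iterations. Its running time is thus bounded by a constant times `N` to the nesting depth
(`exec_compile`), which is three. The queue is an array with a head and a tail index from which
nothing is erased, so that at the end it is the record of the run. -/

instance (k : ℕ) : OfNat NatExpr k := ⟨.lit k⟩
instance : Add NatExpr := ⟨.add⟩
instance : Sub NatExpr := ⟨.sub⟩
instance (k : ℕ) : OfNat RealExpr k := ⟨.lit k⟩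
instance : Add RealExpr := ⟨.add⟩
instance : Sub RealExpr := ⟨.sub⟩
instance : Mul RealExpr := ⟨.mul⟩
instance : Div RealExpr := ⟨.div⟩

@[simp] theorem NatExpr.eval_ofNat (s : Store) (k : ℕ) :
    NatExpr.eval s ofNat(k) = OfNat.ofNat k := rfl
@[simp] theorem NatExpr.eval_add (s : Store) (e e' : NatExpr) :
    (e + e').eval s = e.eval s + e'.eval s := rfl
@[simp] theorem NatExpr.eval_sub (s : Store) (e e' : NatExpr) :
    (e - e').eval s = e.eval s - e'.eval s := rfl
@[simp] theorem NatExpr.eval_get (s : Store) (a : ℕ) (i j : NatExpr) :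
    (NatExpr.get a i j).eval s = s.nat a (i.eval s) (j.eval s) := rfl
@[simp] theorem NatExpr.eval_lit (s : Store) (k : ℕ) : (NatExpr.lit k).eval s = k := rfl
@[simp] theorem RealExpr.eval_ofNat (s : Store) (k : ℕ) :
    RealExpr.eval s ofNat(k) = ((OfNat.ofNat k : ℕ) : ℝ) := rfl
@[simp] theorem RealExpr.eval_add (s : Store) (e e' : RealExpr) :
    (e + e').eval s = e.eval s + e'.eval s := rfl
@[simp] theorem RealExpr.eval_sub (s : Store) (e e' : RealExpr) :
    (e - e').eval s = e.eval s - e'.eval s := rfl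
@[simp] theorem RealExpr.eval_mul (s : Store) (e e' : RealExpr) :
    (e * e').eval s = e.eval s * e'.eval s := rfl
@[simp] theorem RealExpr.eval_div (s : Store) (e e' : RealExpr) :
    (e / e').eval s = e.eval s / e'.eval s := rfl
@[simp] theorem RealExpr.eval_get (s : Store) (a : ℕ) (i j : NatExpr) :
    (RealExpr.get a i j).eval s = s.real a (i.eval s) (j.eval s) := rfl
@[simp] theorem RealExpr.eval_lit (s : Store) (k : ℕ) : (RealExpr.lit k).eval s = k := rfl

@[simp] theorem Test.holds_natEq (s : Store) (e e' : NatExpr) :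
    (Test.natEq e e').Holds s ↔ e.eval s = e'.eval s := Iff.rfl
@[simp] theorem Test.holds_natLt (s : Store) (e e' : NatExpr) :
    (Test.natLt e e').Holds s ↔ e.eval s < e'.eval s := Iff.rfl
@[simp] theorem Test.holds_realEq (s : Store) (e e' : RealExpr) :
    (Test.realEq e e').Holds s ↔ e.eval s = e'.eval s := Iff.rfl
@[simp] theorem Test.holds_realLt (s : Store) (e e' : RealExpr) :
    (Test.realLt e e').Holds s ↔ e.eval s < e'.eval s := Iff.rfl
@[simp] theorem Test.holds_not (s : Store) (b : Test) : (Test.not b).Holds s ↔ ¬ b.Holds s :=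
  Iff.rfl
@[simp] theorem Test.holds_and (s : Store) (b b' : Test) :
    (Test.and b b').Holds s ↔ b.Holds s ∧ b'.Holds s := Iff.rfl

namespace Store

variable (s : Store) (a i j : ℕ)

@[simp] theorem setNat_real (v : ℕ) : (s.setNat a i j v).real = s.real := rfl
@[simp] theorem setReal_nat (v : ℝ) : (s.setReal a i j v).nat = s.nat := rfl

variable {s a i j}

@[simp] theorem setNat_nat_ne {v a' : ℕ} (h : a' ≠ a) : (s.setNat a i j v).nat a' = s.nat a' := by
  funext i' j'; simp [setNat, h]
@[simp] theorem setReal_real_ne {v : ℝ} {a' : ℕ} (h : a' ≠ a) :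
    (s.setReal a i j v).real a' = s.real a' := by
  funext i' j'; simp [setReal, h]
@[simp] theorem setNat_nat_self {v i' j' : ℕ} :
    (s.setNat a i j v).nat a i' j' = if i' = i ∧ j' = j then v else s.nat a i' j' := by
  simp [setNat]
@[simp] theorem setReal_real_self {v : ℝ} {i' j' : ℕ} :
    (s.setReal a i j v).real a i' j' = if i' = i ∧ j' = j then v else s.real a i' j' := by
  simp [setReal]

end Store

/-- Programs whose only loops are `rep v P`: execute `P` for `v = 0, …, N - 1`, where the counter
`v` is entry `(0, 0)` of the natural array `v` and `N` is entry `(0, 0)` of the natural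
array `5`. -/
inductive FProg
  | skip
  | setN (a : ℕ) (i j e : NatExpr)
  | setR (a : ℕ) (i j : NatExpr) (e : RealExpr)
  | seq (P Q : FProg)
  | cond (b : Test) (P Q : FProg)
  | rep (v : ℕ) (P : FProg)

/-- Entry `(0, 0)` of a natural array, used as a register. -/
@[reducible] def reg (v : ℕ) : NatExpr := .get v 0 0

namespace FProg

infixr:61 " ;; " => FProg.seq

/-- The real RAM program. -/
def compile : FProg → Program
  | skip => .skip
  | setN a i j e => .setNat a i j e
  | setR a i j e => .setReal a i j e
  | seq P Q => .seq P.compile Q.compile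
  | cond b P Q => .cond b P.compile Q.compile
  | rep v P => .seq (.setNat v 0 0 0)
      (.loop (.natLt (reg v) (reg 5)) (.seq P.compile (.setNat v 0 0 (reg v + 1))))

open scoped Classical in
/-- The memory after execution. -/
def run : FProg → Store → Store
  | skip, s => s
  | setN a i j e, s => s.setNat a (i.eval s) (j.eval s) (e.eval s)
  | setR a i j e, s => s.setReal a (i.eval s) (j.eval s) (e.eval s)
  | seq P Q, s => Q.run (P.run s)
  | cond b P Q, s => if b.Holds s then P.run s else Q.run s
  -- The counter is overwritten by `k + 1`, and the number of iterations is read once before the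
  -- loop. This agrees with `compile` because `wf` forbids the body to write to `v` or to array `5`.
  | rep v P, s => Nat.rec (s.setNat v 0 0 0) (fun k s' => (P.run s').setNat v 0 0 (k + 1))
      (s.nat 5 0 0)

/-- Does the program write to the natural array `a`? -/
def wN (a : ℕ) : FProg → Bool
  | skip => false
  | setN a' _ _ _ => a == a'
  | setR _ _ _ _ => false
  | seq P Q => P.wN a || Q.wN a
  | cond _ P Q => P.wN a || Q.wN a
  | rep v P => a == v || P.wN a

/-- Does the program write to the real array `a`? -/
def wR (a : ℕ) : FProg → Bool
  | skip => false
  | setN _ _ _ _ => false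
  | setR a' _ _ _ => a == a'
  | seq P Q => P.wR a || Q.wR a
  | cond _ P Q => P.wR a || Q.wR a
  | rep _ P => P.wR a

/-- Loop counters and the number of loop iterations are not modified by the loop bodies. -/
def wf : FProg → Bool
  | skip => true
  | setN _ _ _ _ => true
  | setR _ _ _ _ => true
  | seq P Q => P.wf && !(P.wN 5) && Q.wf
  | cond _ P Q => P.wf && Q.wf
  | rep v P => (v != 5) && !(P.wN v) && !(P.wN 5) && P.wf

/-- The nesting depth of loops. -/
def depth : FProg → ℕ
  | skip => 0
  | setN _ _ _ _ => 0
  | setR _ _ _ _ => 0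
  | seq P Q => max P.depth Q.depth
  | cond _ P Q => max P.depth Q.depth
  | rep _ P => P.depth + 1

/-- The coefficient of the time bound. -/
def coef : FProg → ℕ
  | skip => 1
  | setN _ i j e => i.cost + j.cost + e.cost + 1
  | setR _ i j e => i.cost + j.cost + e.cost + 1
  | seq P Q => P.coef + Q.coef
  | cond b P Q => b.cost + P.coef + Q.coef
  -- The test and the increment cost 15 steps per iteration; the initialization and the last test
  -- cost 11 more. Since `N ≥ 1`, the number 30 covers both.
  | rep _ P => P.coef + 30

/-- The arrays that `P` does not write to are the same in two memories. -/
structure Frame (P : FProg) (s s' : Store) : Prop where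
  nat : ∀ a, P.wN a = false → s'.nat a = s.nat a
  real : ∀ a, P.wR a = false → s'.real a = s.real a

theorem Frame.refl (P : FProg) (s : Store) : Frame P s s := ⟨fun _ _ => rfl, fun _ _ => rfl⟩

/-- The written arrays are over-approximated syntactically by computable Booleans. For a concrete
program, the claim that an array is left alone is thereby reduced to `rfl`. -/
theorem run_frame (P : FProg) (s : Store) : Frame P s (P.run s) := by
  induction P generalizing s with
  | skip => exact .refl _ _
  | setN a i j e =>
    refine ⟨fun b hb => ?_, fun b hb => rfl⟩
    simp only [wN, beq_eq_false_iff_ne, ne_eq] at hb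
    simp [run, hb]
  | setR a i j e =>
    refine ⟨fun b hb => rfl, fun b hb => ?_⟩
    simp only [wR, beq_eq_false_iff_ne, ne_eq] at hb
    simp [run, hb]
  | seq P Q hP hQ =>
    refine ⟨fun b hb => ?_, fun b hb => ?_⟩
    · simp only [wN, Bool.or_eq_false_iff] at hb
      rw [run, (hQ _).nat _ hb.2, (hP _).nat _ hb.1]
    · simp only [wR, Bool.or_eq_false_iff] at hb
      rw [run, (hQ _).real _ hb.2, (hP _).real _ hb.1]
  | cond t P Q hP hQ =>
    refine ⟨fun b hb => ?_, fun b hb => ?_⟩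
    · simp only [wN, Bool.or_eq_false_iff] at hb
      rw [run]; split_ifs
      · exact (hP _).nat _ hb.1
      · exact (hQ _).nat _ hb.2
    · simp only [wR, Bool.or_eq_false_iff] at hb
      rw [run]; split_ifs
      · exact (hP _).real _ hb.1
      · exact (hQ _).real _ hb.2
  | rep v P hP =>
    rw [run]
    refine ⟨fun b hb => ?_, fun b hb => ?_⟩
    · simp only [wN, Bool.or_eq_false_iff, beq_eq_false_iff_ne, ne_eq] at hb
      induction s.nat 5 0 0 with
      | zero => simp [hb.1]
      | succ k ih => simp [hb.1, (hP _).nat _ hb.2, ih]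
    · simp only [wR] at hb
      induction s.nat 5 0 0 with
      | zero => simp
      | succ k ih => simp [(hP _).real _ hb, ih]

section

open scoped Classical

variable (s : Store)

@[simp] theorem run_skip : skip.run s = s := rfl
@[simp] theorem run_setN (a : ℕ) (i j e : NatExpr) :
    (setN a i j e).run s = s.setNat a (i.eval s) (j.eval s) (e.eval s) := rfl
@[simp] theorem run_setR (a : ℕ) (i j : NatExpr) (e : RealExpr) :
    (setR a i j e).run s = s.setReal a (i.eval s) (j.eval s) (e.eval s) := rfl
@[simp] theorem run_seq (P Q : FProg) : (P ;; Q).run s = Q.run (P.run s) := rfl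
@[simp] theorem run_cond (b : Test) (P Q : FProg) :
    (FProg.cond b P Q).run s = if b.Holds s then P.run s else Q.run s := rfl

end

theorem run_nat {P : FProg} {s : Store} (a : ℕ) (h : P.wN a = false) :
    (P.run s).nat a = s.nat a := (run_frame P s).nat a h

theorem run_real {P : FProg} {s : Store} (a : ℕ) (h : P.wR a = false) :
    (P.run s).real a = s.real a := (run_frame P s).real a h

/-- Induction over the iterations of a loop, for an invariant that does not depend on the value
of the loop counter. -/
theorem run_rep_induct (R : FProg) {v : ℕ} {P : FProg} (hR : R = rep v P) (s : Store)
    (Inv : ℕ → Store → Prop)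
    (hv : ∀ k s' x, Inv k s' → Inv k (s'.setNat v 0 0 x)) (h0 : Inv 0 s)
    (hs : ∀ k < s.nat 5 0 0, ∀ s', Inv k s' → s'.nat v 0 0 = k → Frame R s s' →
      Inv (k + 1) (P.run s')) : Inv (s.nat 5 0 0) (R.run s) := by
  subst hR
  have fr : ∀ s' x, Frame (rep v P) s s' → Frame (rep v P) s (s'.setNat v 0 0 x) := by
    intro s' x h
    refine ⟨fun b hb => ?_, fun b hb => h.real b hb⟩
    rw [← h.nat b hb]
    simp only [wN, Bool.or_eq_false_iff, beq_eq_false_iff_ne, ne_eq] at hb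
    simp [hb.1]
  have key : ∀ k ≤ s.nat 5 0 0, ∀ L, L = (Nat.rec (s.setNat v 0 0 0)
      (fun k s' => (P.run s').setNat v 0 0 (k + 1)) k : Store) →
      Inv k L ∧ L.nat v 0 0 = k ∧ Frame (rep v P) s L := by
    intro k
    induction k with
    | zero => rintro - L rfl; exact ⟨hv _ _ _ h0, by simp, fr _ _ (.refl _ _)⟩
    | succ k ih =>
      rintro hk L rfl
      obtain ⟨h1, h2, h3⟩ := ih (by omega) _ rfl
      refine ⟨hv _ _ _ (hs k hk _ h1 h2 h3), by simp, fr _ _ ?_⟩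
      have h4 := run_frame P (Nat.rec (s.setNat v 0 0 0)
        (fun k s' => (P.run s').setNat v 0 0 (k + 1)) k : Store)
      refine ⟨fun b hb => ?_, fun b hb => ?_⟩
      · rw [← h3.nat b hb, h4.nat b]
        simp only [wN, Bool.or_eq_false_iff] at hb
        exact hb.2
      · rw [← h3.real b hb, h4.real b hb]
  exact (key _ le_rfl _ rfl).1

/-- A loop body changes neither its counter nor register `5`, so every loop runs exactly `N` times
and each nesting level contributes one factor `N`. Lower powers of `N` are absorbed by means of `1 ≤
N`. -/
theorem exec_compile (P : FProg) (hP : P.wf = true) {N : ℕ} (hN : 1 ≤ N) (s : Store)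
    (hs : s.nat 5 0 0 = N) :
    ∃ T, Exec P.compile s (P.run s) T ∧ T ≤ P.coef * N ^ P.depth := by
  induction P generalizing s with
  | skip => exact ⟨1, .skip s, by simp [coef, depth]⟩
  | setN a i j e => exact ⟨_, .setNat s a i j e, by simp [coef, depth]⟩
  | setR a i j e => exact ⟨_, .setReal s a i j e, by simp [coef, depth]⟩
  | seq P Q ihP ihQ =>
    simp only [wf, Bool.and_eq_true, Bool.not_eq_true'] at hP
    obtain ⟨T, h1, h2⟩ := ihP hP.1.1 s hs
    obtain ⟨T', h3, h4⟩ := ihQ hP.2 (P.run s) (by rw [run_nat 5 hP.1.2, hs])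
    refine ⟨T + T', .seq h1 h3, ?_⟩
    simp only [coef, depth, add_mul]
    exact add_le_add
      (h2.trans (Nat.mul_le_mul_left _ (Nat.pow_le_pow_right hN (le_max_left _ _))))
      (h4.trans (Nat.mul_le_mul_left _ (Nat.pow_le_pow_right hN (le_max_right _ _))))
  | cond b P Q ihP ihQ =>
    simp only [wf, Bool.and_eq_true] at hP
    have h1 : b.cost ≤ b.cost * N ^ max P.depth Q.depth :=
      Nat.le_mul_of_pos_right _ (by positivity)
    have h2 := Nat.mul_le_mul_left P.coef
      (Nat.pow_le_pow_right hN (le_max_left P.depth Q.depth))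
    have h3 := Nat.mul_le_mul_left Q.coef
      (Nat.pow_le_pow_right hN (le_max_right P.depth Q.depth))
    simp only [coef, depth, run, add_mul]
    by_cases hb : b.Holds s
    · obtain ⟨T, h4, h5⟩ := ihP hP.1 s hs
      refine ⟨_, .cond_true hb (by simpa [hb] using h4), by omega⟩
    · obtain ⟨T, h4, h5⟩ := ihQ hP.2 s hs
      refine ⟨_, .cond_false hb (by simpa [hb] using h4), by omega⟩
  | rep v P ih =>
    simp only [wf, Bool.and_eq_true, bne_iff_ne, ne_eq, Bool.not_eq_true'] at hP
    obtain ⟨⟨⟨hv, hPv⟩, hP5⟩, hPw⟩ := hP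
    -- The loop is considered from counter value `k` on, with `d` iterations left. Here 15 is the
    -- test (7) plus the increment (8), and the final 7 is the failing test.
    have key : ∀ d k, k + d = N → ∀ L L', L.nat 5 0 0 = N → L.nat v 0 0 = k →
        L' = (Nat.rec L (fun i s' => (P.run s').setNat v 0 0 (k + i + 1)) d : Store) →
        ∃ T, Exec (.loop (.natLt (reg v) (reg 5))
          (.seq P.compile (.setNat v 0 0 (reg v + 1)))) L L' T ∧
          T ≤ d * (P.coef * N ^ P.depth + 15) + 7 := by
      intro d
      induction d with
      | zero =>
        rintro k hk L L' h5 hLv rfl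
        exact ⟨_, .loop_false (by simp; omega), by
          simp only [Test.cost, NatExpr.cost]; exact le_add_self⟩
      | succ d ihd =>
        rintro k hk L L' h5 hLv rfl
        obtain ⟨T, h1, h2⟩ := ih hPw L h5
        have h3 : Exec (.setNat v 0 0 (reg v + 1)) (P.run L) ((P.run L).setNat v 0 0 (k + 1)) 8 := by
          have := Exec.setNat (P.run L) v 0 0 (reg v + 1)
          have h4 : (reg v + 1).eval (P.run L) = k + 1 := by
            simp [run_nat v hPv, hLv]
          rw [h4] at this
          exact this
        obtain ⟨T', h4, h6⟩ := ihd (k + 1) (by omega) ((P.run L).setNat v 0 0 (k + 1)) _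
          (by simp [Ne.symm hv, run_nat 5 hP5, h5]) (by simp) rfl
        refine ⟨_, .loop_true (by simp; omega) (.seq h1 h3) (?_ : Exec _ _ _ T'), ?_⟩
        -- `Exec` peels off the first iteration of a loop but `Nat.rec` the last one; the two are
        -- reconciled by shifting the index.
        · convert h4 using 1
          clear h4 h6 ihd hk
          induction d with
          | zero => rfl
          | succ d ihd =>
            have e : k + 1 + d + 1 = k + (d + 1) + 1 := by omega
            simp only [e]
            rw [← ihd]
        · have : (Test.natLt (reg v) (reg 5)).cost = 7 := rfl
          rw [this, add_mul]
          omega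
    obtain ⟨T, h1, h2⟩ := key N 0 (by omega) (s.setNat v 0 0 0) _ (by simp [Ne.symm hv, hs])
      (by simp) rfl
    refine ⟨4 + T, .seq (Exec.setNat s v 0 0 0) ?_, ?_⟩
    · rw [run, hs]; simpa using h1
    · simp only [coef, depth, pow_succ]
      have : 1 ≤ N ^ P.depth * N := Nat.mul_pos (by positivity) hN
      have h4 : N ≤ N ^ P.depth * N := Nat.le_mul_of_pos_left _ (by positivity)
      calc 4 + T ≤ 4 + (N * (P.coef * N ^ P.depth + 15) + 7) := by omega
        _ = P.coef * (N ^ P.depth * N) + 15 * N + 11 := by ring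
        _ ≤ P.coef * (N ^ P.depth * N) + 15 * (N ^ P.depth * N) + 11 * (N ^ P.depth * N) := by
          omega
        _ ≤ _ := by nlinarith

end FProg

open FProg

/-! ## Sorting the simplices -/

/-- The `j`-th simplex comes before the `i`-th simplex if it has a smaller value, or the same value
and a smaller index. -/
def Before (f : ℕ → ℝ) (j i : ℕ) : Prop := f j < f i ∨ (f j = f i ∧ j < i)

instance (f : ℕ → ℝ) : DecidableRel (Before f) := Classical.decRel _

/-- The number of indices below `n` that come before `i`. -/
def rankOf (f : ℕ → ℝ) (n i : ℕ) : ℕ := ((Finset.range n).filter fun j => Before f j i).card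

theorem before_irrefl (f : ℕ → ℝ) (i : ℕ) : ¬ Before f i i := by simp [Before]

theorem Before.trans {f : ℕ → ℝ} {i j k : ℕ} (h : Before f i j) (h' : Before f j k) :
    Before f i k := by
  rcases h with h | ⟨h, h1⟩ <;> rcases h' with h' | ⟨h', h1'⟩
  · exact .inl (h.trans h')
  · exact .inl (h' ▸ h)
  · exact .inl (h ▸ h')
  · exact .inr ⟨h.trans h', h1.trans h1'⟩

theorem rankOf_lt_rankOf {f : ℕ → ℝ} {n i j : ℕ} (hi : i < n) (h : Before f i j) :
    rankOf f n i < rankOf f n j := by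
  refine Finset.card_lt_card ⟨fun k hk => ?_, fun h' => ?_⟩
  · simp only [Finset.mem_filter] at hk ⊢
    exact ⟨hk.1, hk.2.trans h⟩
  · exact before_irrefl f i (Finset.mem_filter.1
      (h' (Finset.mem_filter.2 ⟨Finset.mem_range.2 hi, h⟩))).2

theorem before_or {f : ℕ → ℝ} {i j : ℕ} (h : i ≠ j) : Before f i j ∨ Before f j i := by
  rcases lt_trichotomy (f i) (f j) with h1 | h1 | h1
  · exact .inl (.inl h1)
  · rcases lt_or_gt_of_ne h with h2 | h2
    · exact .inl (.inr ⟨h1, h2⟩)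
    · exact .inr (.inr ⟨h1.symm, h2⟩)
  · exact .inr (.inl h1)

/-- Ties are broken by the index, so `Before f` is a strict total order even if `f` is not
injective, and the ranks enumerate the indices without repetition. -/
theorem rankOf_injOn {f : ℕ → ℝ} {n i j : ℕ} (hi : i < n) (hj : j < n)
    (h : rankOf f n i = rankOf f n j) : i = j := by
  by_contra hne
  rcases before_or (f := f) hne with h1 | h1
  · exact (rankOf_lt_rankOf hi h1).ne h
  · exact (rankOf_lt_rankOf hj h1).ne h.symm

theorem le_of_rankOf_le {f : ℕ → ℝ} {n i j : ℕ} (hj : j < n)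
    (h : rankOf f n i ≤ rankOf f n j) : f i ≤ f j := by
  by_contra! hlt
  exact absurd (rankOf_lt_rankOf hj (.inl hlt)) h.not_gt

theorem rankOf_lt {f : ℕ → ℝ} {n i : ℕ} (hi : i < n) : rankOf f n i < n := by
  conv_rhs => rw [← Finset.card_range n]
  refine Finset.card_lt_card ⟨Finset.filter_subset _ _, fun h => ?_⟩
  exact before_irrefl f i (Finset.mem_filter.1 (h (Finset.mem_range.2 hi))).2

/-- Natural array `10` holds the number `n` of simplices, real array `11` their values; register `50`
receives the rank of the simplex with the index in register `40`. -/
def rankProg : FProg :=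
  .rep 41 (.cond (.and (.natLt (reg 41) (reg 10))
      (.and (.not (.realLt (.get 11 0 (reg 40)) (.get 11 0 (reg 41))))
        (.not (.and (.realEq (.get 11 0 (reg 40)) (.get 11 0 (reg 41)))
          (.not (.natLt (reg 41) (reg 40)))))))
    (.setN 50 0 0 (reg 50 + 1)) .skip)

/-- Natural array `13` receives the indices of the simplices in sorted order. -/
def orderProg : FProg :=
  .rep 40 (.cond (.natLt (reg 40) (reg 10))
    (.setN 50 0 0 0 ;; rankProg ;; .setN 13 0 (reg 50) (reg 40)) .skip)

/-- The loop runs to `N ≥ n`, and its guard discards the surplus indices. The rest of the test is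
`Before`, expressed by negation and conjunction only. -/
theorem rankProg_run (s : Store) (n k : ℕ) (hn : s.nat 10 0 0 = n) (hN : n ≤ s.nat 5 0 0)
    (hk : s.nat 40 0 0 = k) (h0 : s.nat 50 0 0 = 0) :
    (rankProg.run s).nat 50 0 0 = rankOf (s.real 11 0) n k := by
  have key := run_rep_induct rankProg rfl s (fun k' t => t.nat 50 0 0 =
    ((Finset.range k').filter fun j => j < n ∧ Before (s.real 11 0) j k).card)
    (fun _ _ _ h => h) (by simp [h0]) ?_
  · rw [key, rankOf]
    congr 1
    ext j
    simp only [Finset.mem_filter, Finset.mem_range]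
    exact ⟨fun h => h.2, fun h => ⟨by omega, h⟩⟩
  · intro j hj t ht hv hf
    simp only [run_cond, Test.holds_and, Test.holds_natLt, NatExpr.eval_get, NatExpr.eval_ofNat, hv,
      hf.nat 10 rfl, hn, Test.holds_not, Test.holds_realLt, RealExpr.eval_get, hf.nat 40 rfl, hk,
      hf.real 11 rfl, Test.holds_realEq, run_setN, NatExpr.eval_add, ht, run_skip,
      Finset.range_add_one, Finset.filter_insert]
    split_ifs with h1 h2 h2
    · simp
    · refine absurd ⟨h1.1, ?_⟩ h2
      rcases (not_lt.1 h1.2.1).lt_or_eq with h | h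
      · exact .inl h
      · exact .inr ⟨h, by simpa [h] using h1.2.2⟩
    · refine absurd ⟨h2.1, ?_⟩ h1
      rcases h2.2 with h | h
      · exact ⟨h.le.not_gt, fun h' => h.ne' h'.1⟩
      · exact ⟨h.1.le.not_gt, fun h' => h'.2 h.2⟩
    · exact ht

theorem orderProg_run (s : Store) (n : ℕ) (hn : s.nat 10 0 0 = n) (hN : n ≤ s.nat 5 0 0) :
    ∀ i < n, (orderProg.run s).nat 13 0 (rankOf (s.real 11 0) n i) = i := by
  -- The redundant bound turns the claim into the loop invariant at the last value of the counter.
  suffices h : ∀ i < n, i < s.nat 5 0 0 →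
      (orderProg.run s).nat 13 0 (rankOf (s.real 11 0) n i) = i from
    fun i hi => h i hi (by omega)
  refine run_rep_induct orderProg rfl s (fun k s' => ∀ i < n, i < k →
    s'.nat 13 0 (rankOf (s.real 11 0) n i) = i) (fun _ _ _ h => h) (by simp) ?_
  intro k hk s' ih hv hf i hi hik
  have h1 := rankProg_run (s'.setNat 50 0 0 0) n k (by simp [hf.nat 10 rfl, hn])
    (by simp [hf.nat 5 rfl, hN]) (by simp [hv]) (by simp)
  by_cases hkn : k < n
  · simp (disch := first | rfl | decide) [hv, hf.nat 10 rfl, hn, hkn, run_nat, h1, hf.real 11 rfl]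
    by_cases hne : i = k
    · simp [hne]
    · rw [if_neg fun h => hne (rankOf_injOn hi hkn h)]
      exact ih i hi (by omega)
  · simp [hv, hf.nat 10 rfl, hn, hkn, ih i hi (by omega : i < k)]

/-! ## Linear algebra of reduced matrices -/

section Echelon

variable {K ι κ : Type*} [Field K]

/-- The vectors supported on `A`. -/
def supportedOn (K : Type*) [Field K] (A : Set ι) : Submodule K (ι → K) where
  carrier := {x | ∀ i ∉ A, x i = 0}
  zero_mem' := fun _ _ => rfl
  add_mem' := fun ha hb i hi => by simp [ha i hi, hb i hi]
  smul_mem' := fun c _ ha i hi => by simp [ha i hi]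

/-- The vectors `u k` have distinct lowest entries `lo k`, where `rk` orders the entries. -/
structure IsEchelon (rk : ι → ℕ) (u : κ → ι → K) (lo : κ → ι) : Prop where
  rk_injective : Function.Injective rk
  lo_injective : Function.Injective lo
  ne_zero : ∀ k, u k (lo k) ≠ 0
  eq_zero : ∀ k i, rk (lo k) < rk i → u k i = 0

variable {rk : ι → ℕ} {u : κ → ι → K} {lo : κ → ι}

/-- Among the vectors that occur with nonzero coefficient and have their lowest entry outside `A`,
take the one whose lowest entry is last. Nothing cancels this entry: vectors with an earlier lowest
entry vanish there, and a vector with a later one would also have it outside the down-set `A`,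
against maximality. -/
theorem IsEchelon.lo_mem [Fintype κ] (h : IsEchelon rk u lo) {A : Set ι}
    (hA : ∀ i j, rk i < rk j → j ∈ A → i ∈ A) {c : κ → K}
    (hx : (∑ k, c k • u k) ∈ supportedOn K A) (k : κ) (hk : c k ≠ 0) : lo k ∈ A := by
  classical
  by_contra hkA
  obtain ⟨m, hm, hmax⟩ := (Finset.univ.filter fun k => c k ≠ 0 ∧ lo k ∉ A).exists_max_image
    (fun k => rk (lo k)) ⟨k, by simp [hk, hkA]⟩
  simp only [Finset.mem_filter, Finset.mem_univ, true_and] at hm hmax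
  have h0 := hx _ hm.2
  rw [Finset.sum_apply, Finset.sum_eq_single m] at h0
  · rw [Pi.smul_apply, smul_eq_mul, mul_eq_zero] at h0
    exact h0.elim hm.1 (h.ne_zero m)
  · intro l _ hlm
    by_cases hl : c l = 0
    · simp [hl]
    rcases lt_trichotomy (rk (lo l)) (rk (lo m)) with h1 | h1 | h1
    · simp [h.eq_zero l _ h1]
    · exact absurd (h.lo_injective (h.rk_injective h1)) hlm
    · exact absurd (hmax l ⟨hl, fun h2 => hm.2 (hA _ _ h1 h2)⟩) h1.not_ge
  · simp

theorem IsEchelon.linearIndependent [Fintype κ] (h : IsEchelon rk u lo) :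
    LinearIndependent K u := by
  rw [Fintype.linearIndependent_iff]
  intro c hc k
  by_contra hk
  exact h.lo_mem (A := ∅) (by simp) (by rw [hc]; exact Submodule.zero_mem _) k hk

/-- By `lo_mem`, a combination supported on the down-set `A` only involves vectors with lowest entry
in `A`, and these vectors are themselves supported on `A`. They form a basis of the intersection. -/
theorem IsEchelon.finrank_inf [Finite κ] (h : IsEchelon rk u lo) {A : Set ι}
    (hA : ∀ i j, rk i < rk j → j ∈ A → i ∈ A) :
    Module.finrank K (Submodule.span K (Set.range u) ⊓ supportedOn K A : Submodule K (ι → K)) =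
      Nat.card {k // lo k ∈ A} := by
  classical
  have := Fintype.ofFinite κ
  have h1 : Submodule.span K (Set.range u) ⊓ supportedOn K A =
      Submodule.span K (Set.range fun k : {k // lo k ∈ A} => u k) := by
    apply le_antisymm
    · rintro x ⟨hx, hxA⟩
      obtain ⟨c, rfl⟩ := (Submodule.mem_span_range_iff_exists_fun K).1 hx
      refine Submodule.sum_mem _ fun k _ => ?_
      by_cases hk : c k = 0
      · simp [hk]
      · exact Submodule.smul_mem _ _ (Submodule.subset_span ⟨⟨k, h.lo_mem hA hxA k hk⟩, rfl⟩)
    · rw [Submodule.span_le]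
      rintro _ ⟨⟨k, hk⟩, rfl⟩
      refine ⟨Submodule.subset_span ⟨k, rfl⟩, fun i hi => ?_⟩
      rcases lt_trichotomy (rk i) (rk (lo k)) with h1 | h1 | h1
      · exact absurd (hA _ _ h1 hk) hi
      · exact absurd (h.rk_injective h1 ▸ hk) hi
      · exact h.eq_zero k i h1
  rw [h1, Nat.card_eq_fintype_card]
  exact finrank_span_eq_card (h.linearIndependent.comp _ Subtype.val_injective)

/-- Rank-nullity for the restriction of `f` to `S`, written as a sum so that no truncated
subtraction arises. -/
theorem finrank_map_add {V W : Type*} [AddCommGroup V] [Module K V] [AddCommGroup W] [Module K W]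
    [FiniteDimensional K V] (f : V →ₗ[K] W) (S : Submodule K V) :
    Module.finrank K (S.map f) + Module.finrank K (S ⊓ LinearMap.ker f : Submodule K V) =
      Module.finrank K S := by
  have h := LinearMap.finrank_range_add_finrank_ker (f.domRestrict S)
  rw [LinearMap.range_domRestrict] at h
  rw [← h]
  congr 1
  have h2 : LinearMap.ker (f.domRestrict S) = (S ⊓ LinearMap.ker f).comap S.subtype := by
    ext x; simp
  rw [h2]
  exact ((Submodule.comapSubtypeEquivOfLe inf_le_left).finrank_eq).symm

end Echelon

/-! ## Persistence diagrams from reduced boundary matrices -/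

section Reduction

variable {n : ℕ} {σ : Fin n → Finset ℕ}

/-- A column of the boundary matrix. -/
def boundaryCol (σ : Fin n → Finset ℕ) (j : Fin n) : Fin n → ZMod 2 :=
  fun i => if σ i ⊆ σ j ∧ (σ i).card + 1 = (σ j).card then 1 else 0

theorem boundary_apply (c : Fin n → ZMod 2) :
    boundary σ c = ∑ j, c j • boundaryCol σ j := by
  ext i
  simp [boundary, boundaryCol, Matrix.mulVec, dotProduct, mul_comm, Finset.sum_apply]

theorem boundary_single (j : Fin n) : boundary σ (Pi.single j 1) = boundaryCol σ j := by
  rw [boundary_apply, Finset.sum_eq_single j] <;> simp +contextual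

/-- If `σ i` is a face of `σ k` of codimension two, exactly two simplices lie strictly between them,
one for each of the two missing vertices; for other `i` there are none. So every coefficient is
even. -/
theorem boundary_boundaryCol (hσ : Function.Injective σ)
    (hface : ∀ i, ∀ τ ⊆ σ i, τ.Nonempty → ∃ j, σ j = τ) (k : Fin n) :
    boundary σ (boundaryCol σ k) = 0 := by
  classical
  ext i
  have h1 : boundary σ (boundaryCol σ k) i = ((Finset.univ.filter fun j =>
      (σ j ⊆ σ k ∧ (σ j).card + 1 = (σ k).card) ∧ σ i ⊆ σ j ∧ (σ i).card + 1 = (σ j).card).card :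
        ZMod 2) := by
    rw [boundary_apply, Finset.sum_apply, Finset.card_filter, Nat.cast_sum]
    refine Finset.sum_congr rfl fun j _ => ?_
    by_cases h1 : σ j ⊆ σ k ∧ (σ j).card + 1 = (σ k).card <;>
    by_cases h2 : σ i ⊆ σ j ∧ (σ i).card + 1 = (σ j).card <;>
      simp [boundaryCol, h1, h2]
  rw [h1]
  by_cases h : σ i ⊆ σ k ∧ (σ i).card + 2 = (σ k).card
  · have h2 : (Finset.univ.filter fun j => (σ j ⊆ σ k ∧ (σ j).card + 1 = (σ k).card) ∧
        σ i ⊆ σ j ∧ (σ i).card + 1 = (σ j).card).image σ =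
        (σ k \ σ i).image fun v => insert v (σ i) := by
      ext τ
      simp only [Finset.mem_image, Finset.mem_filter, Finset.mem_univ, true_and, Finset.mem_sdiff]
      constructor
      · rintro ⟨j, ⟨⟨h1, h2⟩, h3, h4⟩, rfl⟩
        have h5 : (σ j \ σ i).card = 1 := by
          rw [Finset.card_sdiff_of_subset h3]; omega
        obtain ⟨v, hv⟩ := Finset.card_eq_one.1 h5
        have hv' : v ∈ σ j \ σ i := by simp [hv]
        rw [Finset.mem_sdiff] at hv'
        refine ⟨v, ⟨h1 hv'.1, hv'.2⟩, ?_⟩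
        rw [Finset.insert_eq, ← hv, Finset.sdiff_union_of_subset h3]
      · rintro ⟨v, ⟨h1, h2⟩, rfl⟩
        obtain ⟨j, hj⟩ := hface k (insert v (σ i)) (Finset.insert_subset h1 h.1)
          (Finset.insert_nonempty _ _)
        have hc : (σ j).card = (σ i).card + 1 := by rw [hj, Finset.card_insert_of_notMem h2]
        exact ⟨j, ⟨⟨hj ▸ Finset.insert_subset h1 h.1, by omega⟩,
          hj ▸ Finset.subset_insert _ _, by omega⟩, hj⟩
    rw [← Finset.card_image_of_injective _ hσ, h2, Finset.card_image_of_injOn,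
      Finset.card_sdiff_of_subset h.1, ← h.2]
    -- The count is `2`, which is zero in `ZMod 2`.
    · simp only [Nat.add_sub_cancel_left]; rfl
    · intro v hv w hw hvw
      simp only [Finset.coe_sdiff, Set.mem_sdiff, Finset.mem_coe] at hv hw
      have : v ∈ insert w (σ i) := by
        rw [← show insert v (σ i) = insert w (σ i) from hvw]
        exact Finset.mem_insert_self v (σ i)
      exact (Finset.mem_insert.1 this).resolve_right hv.2
  · rw [Finset.filter_false_of_mem, Finset.card_empty]
    · simp
    · rintro j - ⟨⟨h1, h2⟩, h3, h4⟩
      exact h ⟨h3.trans h1, by omega⟩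

theorem boundary_boundary (hσ : Function.Injective σ)
    (hface : ∀ i, ∀ τ ⊆ σ i, τ.Nonempty → ∃ j, σ j = τ) (c : Fin n → ZMod 2) :
    boundary σ (boundary σ c) = 0 := by
  rw [boundary_apply c, map_sum]
  refine Finset.sum_eq_zero fun j _ => ?_
  rw [map_smul, boundary_boundaryCol hσ hface, smul_zero]

/-- The columns `R j` arise from the boundary matrix by left-to-right column additions, with
respect to the order given by `rk`, and the lowest entries `low j` of the nonzero columns are
distinct. -/
structure IsReduction (σ : Fin n → Finset ℕ) (rk : Fin n → ℕ) (R : Fin n → Fin n → ZMod 2)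
    (low : Fin n → Option (Fin n)) : Prop where
  rk_injective : Function.Injective rk
  dim : ∀ j i, R j i ≠ 0 → (σ i).card + 1 = (σ j).card
  span : ∀ j, R j - boundaryCol σ j ∈ Submodule.span (ZMod 2)
    (boundaryCol σ '' {k | rk k < rk j ∧ (σ k).card = (σ j).card})
  ne_zero : ∀ j i, low j = some i → R j i ≠ 0
  eq_zero : ∀ j i i', low j = some i → rk i < rk i' → R j i' = 0
  eq_zero' : ∀ j, low j = none → R j = 0
  inj : ∀ j j' i, low j = some i → low j' = some i → j = j'

variable {rk : Fin n → ℕ} {R : Fin n → Fin n → ZMod 2} {low : Fin n → Option (Fin n)}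

namespace IsReduction

/-- Left-to-right column additions are unitriangular and can be undone by induction on the rank.
Together with `mem_span`, the original and the reduced columns of one dimension span the same space
up to every rank. -/
theorem boundaryCol_mem (h : IsReduction σ rk R low) (j : Fin n) :
    boundaryCol σ j ∈ Submodule.span (ZMod 2)
      (R '' {k | rk k ≤ rk j ∧ (σ k).card = (σ j).card}) := by
  induction hj : rk j using Nat.strong_induction_on generalizing j with
  | _ m ih =>
    subst hj
    rw [← sub_sub_cancel (R j) (boundaryCol σ j)]
    refine Submodule.sub_mem _ (Submodule.subset_span ⟨j, ⟨le_rfl, rfl⟩, rfl⟩) ?_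
    refine Submodule.span_le.2 ?_ (h.span j)
    rintro _ ⟨k, ⟨hk, hkj⟩, rfl⟩
    refine Submodule.span_mono (Set.image_mono ?_) (ih _ hk k rfl)
    rintro l ⟨h1, h2⟩
    exact ⟨h1.trans hk.le, h2.trans hkj⟩

theorem mem_span (h : IsReduction σ rk R low) (j : Fin n) :
    R j ∈ Submodule.span (ZMod 2)
      (boundaryCol σ '' {k | rk k ≤ rk j ∧ (σ k).card = (σ j).card}) := by
  rw [← sub_add_cancel (R j) (boundaryCol σ j)]
  refine Submodule.add_mem _ (Submodule.span_mono (Set.image_mono ?_) (h.span j))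
    (Submodule.subset_span ⟨j, ⟨le_rfl, rfl⟩, rfl⟩)
  rintro k ⟨h1, h2⟩
  exact ⟨h1.le, h2⟩

theorem isEchelon (h : IsReduction σ rk R low) (q : Fin n → Prop) :
    IsEchelon rk (fun k : {j : Fin n // q j ∧ (low j).isSome} => R k)
      (fun k => (low k).get k.2.2) where
  rk_injective := h.rk_injective
  lo_injective := fun k l hkl => Subtype.ext
    (h.inj k l _ (Option.some_get k.2.2).symm ((Option.some_get l.2.2).symm.trans
      (congrArg some hkl.symm)))
  ne_zero := fun k => h.ne_zero _ _ (Option.some_get k.2.2).symm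
  eq_zero := fun k _ hi => h.eq_zero _ _ _ (Option.some_get k.2.2).symm hi

theorem chains_eq_span (p : ℕ) (A : Set (Fin n)) : chains σ p A =
    Submodule.span (ZMod 2) (Set.range fun k : {i // i ∈ A ∧ (σ i).card = p + 1} =>
      (Pi.single k.1 1 : Fin n → ZMod 2)) := by
  apply le_antisymm
  · intro c hc
    rw [← Finset.univ_sum_single c]
    refine Submodule.sum_mem _ fun i _ => ?_
    by_cases hi : c i = 0
    · simp [hi]
    · have : Pi.single i (c i) = c i • (Pi.single i 1 : Fin n → ZMod 2) := by
        rw [← Pi.single_smul, smul_eq_mul, mul_one]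
      rw [this]
      exact Submodule.smul_mem _ _ (Submodule.subset_span ⟨⟨i, hc i hi⟩, rfl⟩)
  · rw [Submodule.span_le]
    rintro _ ⟨⟨k, hk⟩, rfl⟩ i hi
    by_cases hik : i = k
    · exact hik ▸ hk
    · simp [hik] at hi

theorem finrank_chains (p : ℕ) (A : Set (Fin n)) :
    Module.finrank (ZMod 2) (chains σ p A) = Nat.card {i // i ∈ A ∧ (σ i).card = p + 1} := by
  classical
  rw [chains_eq_span, finrank_span_eq_card, Nat.card_eq_fintype_card]
  exact (Pi.linearIndependent_single_one (Fin n) (ZMod 2)).comp _ Subtype.val_injective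

/-- The column operations stay inside `A` because `A` is an initial segment. Zero columns are left
out so that the spanning family is in echelon form and its members can be counted. -/
theorem map_chains (h : IsReduction σ rk R low) (p : ℕ) {A : Set (Fin n)}
    (hA : ∀ i j, rk i ≤ rk j → j ∈ A → i ∈ A) : (chains σ p A).map (boundary σ) =
    Submodule.span (ZMod 2) (Set.range
      fun k : {j // (j ∈ A ∧ (σ j).card = p + 1) ∧ (low j).isSome} => R k) := by
  rw [chains_eq_span, Submodule.map_span]
  apply le_antisymm <;> rw [Submodule.span_le]
  · rintro _ ⟨_, ⟨⟨j, hj⟩, rfl⟩, rfl⟩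
    rw [boundary_single]
    refine Submodule.span_le.2 ?_ (h.boundaryCol_mem j)
    rintro _ ⟨k, ⟨h1, h2⟩, rfl⟩
    cases hk : low k with
    | none => rw [h.eq_zero' k hk]; exact Submodule.zero_mem _
    | some i =>
      exact Submodule.subset_span ⟨⟨k, ⟨hA _ _ h1 hj.1, h2.trans hj.2⟩, by simp [hk]⟩, rfl⟩
  · rintro _ ⟨⟨j, hj, -⟩, rfl⟩
    refine Submodule.span_mono ?_ (h.mem_span j)
    rintro _ ⟨k, ⟨h1, h2⟩, rfl⟩
    exact ⟨_, ⟨⟨k, hA _ _ h1 hj.1, h2.trans hj.2⟩, rfl⟩, boundary_single k⟩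

/-- A boundary is a cycle and lives in the right dimension, so only the condition on the support
remains. This brings the space into the form required by `IsEchelon.finrank_inf`. -/
theorem cycles_inf_boundaries (hσ : Function.Injective σ)
    (hface : ∀ i, ∀ τ ⊆ σ i, τ.Nonempty → ∃ j, σ j = τ) (p : ℕ) (A A' : Set (Fin n)) :
    cycles σ p A ⊓ boundaries σ p A' = boundaries σ p A' ⊓ supportedOn (ZMod 2) A := by
  ext x
  constructor
  · rintro ⟨⟨h1, -⟩, h2⟩
    exact ⟨h2, fun i hi => by_contra fun h => hi (h1 i h).1⟩
  · rintro ⟨⟨c, hc, rfl⟩, h2⟩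
    refine ⟨⟨fun i hi => ⟨by_contra fun h => hi (h2 i h), ?_⟩, boundary_boundary hσ hface c⟩,
      ⟨c, hc, rfl⟩⟩
    by_contra hcard
    refine hi ?_
    rw [boundary_apply, Finset.sum_apply]
    refine Finset.sum_eq_zero fun j _ => ?_
    by_cases hj : c j = 0
    · simp [hj]
    · have := (hc j hj).2
      simp only [Pi.smul_apply, boundaryCol]
      rw [if_neg, smul_zero]
      rintro ⟨-, h4⟩
      omega

/-- The zero columns in `A` count the dimension of the cycles, by rank-nullity on chains. The
columns of `A'` with lowest entry in `A` count the cycles of `A` that bound in `A'`. The additive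
form lets later subtractions be settled by `omega`. -/
theorem persistentBetti_add (h : IsReduction σ rk R low) (hσ : Function.Injective σ)
    (hface : ∀ i, ∀ τ ⊆ σ i, τ.Nonempty → ∃ j, σ j = τ) (p : ℕ) {A A' : Set (Fin n)}
    (hA : ∀ i j, rk i ≤ rk j → j ∈ A → i ∈ A) (hA' : ∀ i j, rk i ≤ rk j → j ∈ A' → i ∈ A') :
    persistentBetti σ p A A' +
        Nat.card {j // j ∈ A' ∧ (σ j).card = p + 2 ∧ ∃ i ∈ A, low j = some i} =
      Nat.card {j // j ∈ A ∧ (σ j).card = p + 1 ∧ low j = none} := by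
  classical
  have h1 : persistentBetti σ p A A' + _ = Module.finrank (ZMod 2) (cycles σ p A) :=
    finrank_map_add (boundaries σ p A').mkQ (cycles σ p A)
  have h0 : Module.finrank (ZMod 2)
      (boundaries σ p A' ⊓ supportedOn (ZMod 2) A : Submodule (ZMod 2) (Fin n → ZMod 2)) =
      Nat.card {k : {j // (j ∈ A' ∧ (σ j).card = p + 1 + 1) ∧ (low j).isSome} //
        (low k).get k.2.2 ∈ A} := by
    rw [boundaries, h.map_chains _ hA']
    exact (h.isEchelon _).finrank_inf (fun i j hij => hA i j hij.le)
  rw [Submodule.ker_mkQ, cycles_inf_boundaries hσ hface, h0] at h1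
  have h2 : _ + Module.finrank (ZMod 2) (cycles σ p A) = _ :=
    finrank_map_add (boundary σ) (chains σ p A)
  have h3 := (h.isEchelon fun j => j ∈ A ∧ (σ j).card = p + 1).finrank_inf (A := Set.univ)
    (fun _ _ _ _ => trivial)
  have h4 : supportedOn (ZMod 2) (Set.univ : Set (Fin n)) = ⊤ := by
    ext x; simp [supportedOn]
  rw [h4, inf_top_eq] at h3
  rw [h.map_chains _ hA, finrank_chains, h3] at h2
  have e1 : Nat.card {k : {j // (j ∈ A' ∧ (σ j).card = p + 1 + 1) ∧ (low j).isSome} //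
      (low k).get k.2.2 ∈ A} =
      Nat.card {j // j ∈ A' ∧ (σ j).card = p + 2 ∧ ∃ i ∈ A, low j = some i} := by
    refine Nat.card_congr ⟨fun k => ⟨k.1, k.1.2.1.1, k.1.2.1.2, _, k.2,
      (Option.some_get k.1.2.2).symm⟩, fun j => ⟨⟨j, ⟨j.2.1, j.2.2.1⟩, ?_⟩, ?_⟩, fun _ => rfl,
      fun _ => rfl⟩
    · obtain ⟨i, -, hi⟩ := j.2.2.2; simp [hi]
    · obtain ⟨i, hi, hi'⟩ := j.2.2.2; simpa [hi'] using hi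
  have e2 : Nat.card {k : {j // (j ∈ A ∧ (σ j).card = p + 1) ∧ (low j).isSome} //
      (low k).get k.2.2 ∈ Set.univ} =
      Nat.card {j // (j ∈ A ∧ (σ j).card = p + 1) ∧ (low j).isSome} :=
    Nat.card_congr (Equiv.subtypeUnivEquiv fun _ => trivial)
  have e3 : Nat.card {j // (j ∈ A ∧ (σ j).card = p + 1) ∧ (low j).isSome} +
      Nat.card {j // j ∈ A ∧ (σ j).card = p + 1 ∧ low j = none} =
      Nat.card {i // i ∈ A ∧ (σ i).card = p + 1} := by
    simp only [Nat.card_eq_fintype_card, Fintype.card_subtype]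
    rw [← Finset.card_filter_add_card_filter_not (s := Finset.univ.filter
      fun j => j ∈ A ∧ (σ j).card = p + 1) (fun j => (low j).isSome), Finset.filter_filter,
      Finset.filter_filter]
    simp [and_assoc]
  omega

/-- A simplex that is the lowest entry of a reduced column has a zero column. -/
theorem low_eq_none (h : IsReduction σ rk R low) (hσ : Function.Injective σ)
    (hface : ∀ i, ∀ τ ⊆ σ i, τ.Nonempty → ∃ j, σ j = τ) {i j : Fin n} (hj : low j = some i) :
    low i = none := by
  classical
  by_contra hi
  obtain ⟨l, hl⟩ := Option.ne_none_iff_exists'.1 hi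
  -- Since the cycle `R j` has its last entry at `i`, the boundary column of `i` is a combination of
  -- earlier boundary columns. Then `R i` lies in the span of the earlier nonzero reduced columns,
  -- which contradicts the independence of an echelon family if `R i` is nonzero.
  have h1 : boundary σ (R j) = 0 := by
    have h2 := h.mem_span j
    refine (Submodule.span_le.2 ?_ h2 : R j ∈ LinearMap.ker (boundary σ))
    rintro _ ⟨k, -, rfl⟩
    exact boundary_boundaryCol hσ hface k
  have hlt : ∀ k, rk k < rk i → boundaryCol σ k ∈
      Submodule.span (ZMod 2) (Set.range fun k : {j // rk j < rk i ∧ (low j).isSome} => R k) := by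
    intro k hk
    refine Submodule.span_le.2 ?_ (h.boundaryCol_mem k)
    rintro _ ⟨m, ⟨hm, -⟩, rfl⟩
    cases hlow : low m with
    | none => rw [h.eq_zero' m hlow]; exact Submodule.zero_mem _
    | some i' => exact Submodule.subset_span ⟨⟨m, hm.trans_lt hk, by simp [hlow]⟩, rfl⟩
  have h3 : boundaryCol σ i ∈
      Submodule.span (ZMod 2) (Set.range fun k : {j // rk j < rk i ∧ (low j).isSome} => R k) := by
    rw [boundary_apply, ← Finset.add_sum_erase _ _ (Finset.mem_univ i)] at h1
    have h4 : R j i = 1 := by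
      have := h.ne_zero j i hj
      generalize R j i = x at this
      revert x; decide
    rw [h4, one_smul, add_eq_zero_iff_eq_neg] at h1
    rw [h1]
    refine Submodule.neg_mem _ (Submodule.sum_mem _ fun k hk => ?_)
    rcases lt_trichotomy (rk k) (rk i) with h5 | h5 | h5
    · exact Submodule.smul_mem _ _ (hlt k h5)
    · exact absurd (h.rk_injective h5) (Finset.ne_of_mem_erase hk)
    · rw [h.eq_zero j i k hj h5, zero_smul]; exact Submodule.zero_mem _
  have h5 : R i ∈
      Submodule.span (ZMod 2) (Set.range fun k : {j // rk j < rk i ∧ (low j).isSome} => R k) := by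
    rw [← sub_add_cancel (R i) (boundaryCol σ i)]
    refine Submodule.add_mem _ (Submodule.span_le.2 ?_ (h.span i)) h3
    rintro _ ⟨k, ⟨hk, -⟩, rfl⟩
    exact hlt k hk
  have hind := (h.isEchelon fun _ => True).linearIndependent
  have h6 := hind.notMem_span_image (x := ⟨i, trivial, by simp [hl]⟩)
    (s := {k | rk k < rk i}) (by simp)
  refine h6 (Submodule.span_mono ?_ h5)
  rintro _ ⟨⟨k, hk, hk'⟩, rfl⟩
  exact ⟨⟨k, trivial, hk'⟩, hk, rfl⟩

/-- The partial map `low` is injective, so pairs may be counted by births or by deaths. -/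
theorem card_pairs (h : IsReduction σ rk R low) (Q S : Fin n → Prop) :
    Nat.card {i // Q i ∧ ∃ j, S j ∧ low j = some i} =
      Nat.card {j // S j ∧ ∃ i, Q i ∧ low j = some i} := by
  symm
  refine Nat.card_congr (Equiv.ofBijective (fun j => ⟨(low j).get ?_, ?_, j, j.2.1, ?_⟩) ⟨?_, ?_⟩)
  · obtain ⟨i, -, hi⟩ := j.2.2; simp [hi]
  · obtain ⟨i, hi, hi'⟩ := j.2.2; simpa [hi'] using hi
  · simp
  · rintro ⟨j, hj, i, hi, hij⟩ ⟨j', hj', i', hi', hij'⟩ hjj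
    simp only [hij, hij', Option.get_some, Subtype.mk.injEq] at hjj
    subst hjj
    exact Subtype.ext (h.inj _ _ _ hij hij')
  · rintro ⟨i, hi, j, hj, hij⟩
    exact ⟨⟨j, hj, i, hi, hij⟩, by simp [hij]⟩

end IsReduction

theorem card_eq_add {p q r : Fin n → Prop} (h : ∀ j, p j ↔ q j ∨ r j) (h' : ∀ j, q j → ¬ r j) :
    Nat.card {j // p j} = Nat.card {j // q j} + Nat.card {j // r j} := by
  classical
  simp only [Nat.card_eq_fintype_card, Fintype.card_subtype]
  rw [← Finset.card_union_of_disjoint]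
  · congr 1; ext j; simp [h]
  · rw [Finset.disjoint_left]; intro j hq hr
    simp only [Finset.mem_filter, Finset.mem_univ, true_and] at hq hr
    exact h' j hq hr

variable {f : Fin n → ℝ}

/-- `lab i` is the point of the persistence diagram whose birth is the simplex `i`, if any. -/
structure IsLabeling (σ : Fin n → Finset ℕ) (low : Fin n → Option (Fin n)) (f : Fin n → ℝ) (p : ℕ)
    (lab : Fin n → Option (ℝ × WithTop ℝ)) : Prop where
  fin_iff : ∀ i b (d : ℝ), lab i = some (b, (d : WithTop ℝ)) ↔
    ((σ i).card = p + 1 ∧ f i = b) ∧ ∃ j, (f j = d ∧ b < d) ∧ low j = some i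
  top_iff : ∀ i b, lab i = some (b, ⊤) ↔
    (σ i).card = p + 1 ∧ f i = b ∧ low i = none ∧ ∀ j, low j ≠ some i

variable {p : ℕ} {lab : Fin n → Option (ℝ × WithTop ℝ)}

namespace IsReduction

/-- In terms of `persistentBetti_add`, the difference of the two ranks is the number of zero columns
with value `b` minus the number of those that are lowest entries. By `low_eq_none`, every lowest
entry is among the zero columns, so what remains are the unpaired ones. -/
theorem pairMultiplicity_top (h : IsReduction σ rk R low) (hσ : Function.Injective σ)
    (hface : ∀ i, ∀ τ ⊆ σ i, τ.Nonempty → ∃ j, σ j = τ) (hf : ∀ i j, rk i ≤ rk j → f i ≤ f j)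
    (hlab : IsLabeling σ low f p lab) (b : ℝ) :
    pairMultiplicity σ f p b ⊤ = Nat.card {i // lab i = some (b, ⊤)} := by
  have hU : ∀ i j : Fin n, rk i ≤ rk j → j ∈ Set.univ → i ∈ Set.univ := fun _ _ _ _ => trivial
  have h1 := h.persistentBetti_add hσ hface p (A := subLE f b)
    (fun i j hij hj => (hf i j hij).trans hj) hU
  have h2 := h.persistentBetti_add hσ hface p (A := subLT f b)
    (fun i j hij hj => (hf i j hij).trans_lt hj) hU
  have h3 := card_eq_add (p := fun j => j ∈ subLE f b ∧ (σ j).card = p + 1 ∧ low j = none)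
    (q := fun j => j ∈ subLT f b ∧ (σ j).card = p + 1 ∧ low j = none)
    (r := fun j => f j = b ∧ (σ j).card = p + 1 ∧ low j = none)
    (fun j => by simp only [subLE, subLT, Set.mem_ofPred_eq, le_iff_lt_or_eq]; tauto)
    (fun j hj hj' => hj.1.ne hj'.1)
  have h4 := card_eq_add
    (p := fun j => j ∈ Set.univ ∧ (σ j).card = p + 2 ∧ ∃ i ∈ subLE f b, low j = some i)
    (q := fun j => j ∈ Set.univ ∧ (σ j).card = p + 2 ∧ ∃ i ∈ subLT f b, low j = some i)
    (r := fun j => (σ j).card = p + 2 ∧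
      ∃ i, (f i = b ∧ (σ i).card = p + 1 ∧ low i = none) ∧ low j = some i)
    (fun j => by
      simp only [subLE, subLT, Set.mem_ofPred_eq, le_iff_lt_or_eq, Set.mem_univ, true_and]
      constructor
      · rintro ⟨h1, i, h2 | h2, h3⟩
        · exact .inl ⟨h1, i, h2, h3⟩
        · exact .inr ⟨h1, i, ⟨h2, by have := h.dim j i (h.ne_zero _ _ h3); omega,
            h.low_eq_none hσ hface h3⟩, h3⟩
      · rintro (⟨h1, i, h2, h3⟩ | ⟨h1, i, h2, h3⟩)
        · exact ⟨h1, i, .inl h2, h3⟩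
        · exact ⟨h1, i, .inr h2.1, h3⟩)
    (fun j hj hj' => by
      obtain ⟨-, -, i, h5, h6⟩ := hj
      obtain ⟨-, i', h7, h8⟩ := hj'
      rw [h6, Option.some.injEq] at h8
      exact h5.ne (h8 ▸ h7.1))
  have h5 := card_eq_add (p := fun j => f j = b ∧ (σ j).card = p + 1 ∧ low j = none)
    (q := fun j => lab j = some (b, ⊤))
    (r := fun i => (f i = b ∧ (σ i).card = p + 1 ∧ low i = none) ∧
      ∃ j, (σ j).card = p + 2 ∧ low j = some i)
    (fun i => by
      rw [hlab.top_iff]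
      constructor
      · rintro ⟨h1, h2, h3⟩
        by_cases hj : ∃ j, low j = some i
        · obtain ⟨j, hj⟩ := hj
          exact .inr ⟨⟨h1, h2, h3⟩, j, by have := h.dim j i (h.ne_zero _ _ hj); omega, hj⟩
        · exact .inl ⟨h2, h1, h3, fun j hj' => hj ⟨j, hj'⟩⟩
      · rintro (⟨h1, h2, h3, -⟩ | ⟨h1, -⟩)
        · exact ⟨h2, h1, h3⟩
        · exact h1)
    (fun i hi => by
      rintro ⟨-, j, -, hj⟩
      exact ((hlab.top_iff i b).1 hi).2.2.2 j hj)
  have h6 := h.card_pairs (fun i => f i = b ∧ (σ i).card = p + 1 ∧ low i = none)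
    (fun j => (σ j).card = p + 2)
  change persistentBetti σ p (subLE f b) Set.univ - persistentBetti σ p (subLT f b) Set.univ = _
  omega

/-- In the inclusion-exclusion of the four ranks the numbers of cycles cancel. The numbers of paired
columns leave exactly the pairs with birth value `b` and death value `d`. -/
theorem pairMultiplicity_coe (h : IsReduction σ rk R low) (hσ : Function.Injective σ)
    (hface : ∀ i, ∀ τ ⊆ σ i, τ.Nonempty → ∃ j, σ j = τ) (hf : ∀ i j, rk i ≤ rk j → f i ≤ f j)
    (hlab : IsLabeling σ low f p lab) {b d : ℝ} (hbd : b < d) :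
    pairMultiplicity σ f p b d = Nat.card {i // lab i = some (b, (d : WithTop ℝ))} := by
  have hLE : ∀ (b : ℝ) (i j : Fin n), rk i ≤ rk j → j ∈ subLE f b → i ∈ subLE f b :=
    fun b i j hij hj => (hf i j hij).trans hj
  have hLT : ∀ (b : ℝ) (i j : Fin n), rk i ≤ rk j → j ∈ subLT f b → i ∈ subLT f b :=
    fun b i j hij hj => (hf i j hij).trans_lt hj
  have h1 := h.persistentBetti_add hσ hface p (hLE b) (hLT d)
  have h2 := h.persistentBetti_add hσ hface p (hLT b) (hLE d)
  have h3 := h.persistentBetti_add hσ hface p (hLT b) (hLT d)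
  have h4 := h.persistentBetti_add hσ hface p (hLE b) (hLE d)
  have split1 : ∀ A' : Set (Fin n), _ := fun A' => card_eq_add
    (p := fun j => j ∈ A' ∧ (σ j).card = p + 2 ∧ ∃ i ∈ subLE f b, low j = some i)
    (q := fun j => j ∈ A' ∧ (σ j).card = p + 2 ∧ ∃ i ∈ subLT f b, low j = some i)
    (r := fun j => j ∈ A' ∧ (σ j).card = p + 2 ∧ ∃ i, f i = b ∧ low j = some i)
    (fun j => by
      simp only [subLE, subLT, Set.mem_ofPred_eq, le_iff_lt_or_eq, or_and_right, exists_or,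
        and_or_left])
    (fun j hj hj' => by
      obtain ⟨-, -, i, h5, h6⟩ := hj
      obtain ⟨-, -, i', h7, h8⟩ := hj'
      rw [h6, Option.some.injEq] at h8
      exact h5.ne (h8 ▸ h7))
  have h5 := split1 (subLT f d)
  have h6 := split1 (subLE f d)
  have h7 := card_eq_add
    (p := fun j => j ∈ subLE f d ∧ (σ j).card = p + 2 ∧ ∃ i, f i = b ∧ low j = some i)
    (q := fun j => j ∈ subLT f d ∧ (σ j).card = p + 2 ∧ ∃ i, f i = b ∧ low j = some i)
    (r := fun j => (f j = d ∧ b < d) ∧ ∃ i, ((σ i).card = p + 1 ∧ f i = b) ∧ low j = some i)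
    (fun j => by
      simp only [subLE, subLT, Set.mem_ofPred_eq, le_iff_lt_or_eq, or_and_right]
      refine or_congr_right ⟨?_, ?_⟩
      · rintro ⟨h1, h2, i, h3, h4⟩
        exact ⟨⟨h1, hbd⟩, i, ⟨by have := h.dim j i (h.ne_zero _ _ h4); omega, h3⟩, h4⟩
      · rintro ⟨⟨h1, -⟩, i, ⟨h3, h3'⟩, h4⟩
        exact ⟨h1, by have := h.dim j i (h.ne_zero _ _ h4); omega, i, h3', h4⟩)
    (fun j hj hj' => hj.1.ne hj'.1.1)
  have h8 := h.card_pairs (fun i => (σ i).card = p + 1 ∧ f i = b) (fun j => f j = d ∧ b < d)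
  simp only [← hlab.fin_iff] at h8
  simp only [pairMultiplicity]
  omega

/-- The two multisets are compared by multiplicities. The sum in `diagram` ranges over critical
values only, but the labels have no other births and finite deaths. -/
theorem diagram_eq (h : IsReduction σ rk R low) (hσ : Function.Injective σ)
    (hface : ∀ i, ∀ τ ⊆ σ i, τ.Nonempty → ∃ j, σ j = τ) (hf : ∀ i j, rk i ≤ rk j → f i ≤ f j)
    (hlab : IsLabeling σ low f p lab) :
    diagram σ f p = (Finset.univ : Finset (Fin n)).val.filterMap lab := by
  classical
  have hcount : ∀ (a : ℝ × WithTop ℝ) (s : Multiset (Fin n)),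
      (s.filterMap lab).count a = s.countP fun i => lab i = some a := by
    intro a s
    induction s using Multiset.induction_on with
    | empty => rfl
    | cons i s ih =>
      rw [Multiset.countP_cons, ← ih]
      cases hi : lab i with
      | none => simp [hi]
      | some x => simp [Multiset.filterMap_cons_some _ _ _ hi, Multiset.count_cons, eq_comm]
  have hcard : ∀ a, (Finset.univ : Finset (Fin n)).val.countP (fun i => lab i = some a) =
      Nat.card {i // lab i = some a} := by
    intro a
    rw [Multiset.countP_eq_card_filter, Nat.card_eq_fintype_card, Fintype.card_subtype]
    rfl
  ext ⟨b, d⟩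
  rw [hcount, hcard]
  simp only [diagram, Multiset.count_sum', Multiset.count_add, Multiset.count_replicate,
    Prod.mk.injEq]
  cases d with
  | top =>
    simp only [and_true, WithTop.coe_ne_top, and_false, if_false, Finset.sum_const_zero, add_zero,
      Finset.sum_ite_eq']
    split_ifs with hb
    · exact h.pairMultiplicity_top hσ hface hf hlab b
    · symm
      rw [Nat.card_eq_zero]
      refine .inl ⟨fun ⟨i, hi⟩ => hb ?_⟩
      exact Finset.mem_image.2 ⟨i, Finset.mem_univ _, ((hlab.top_iff i b).1 hi).2.1⟩
  | coe d =>
    simp only [WithTop.top_ne_coe, and_false, if_false, zero_add, WithTop.coe_inj]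
    by_cases hbd : (b ∈ Finset.univ.image f ∧ d ∈ Finset.univ.image f) ∧ b < d
    · rw [Finset.sum_eq_single b, Finset.sum_eq_single d]
      · simp [h.pairMultiplicity_coe hσ hface hf hlab hbd.2]
      · intro d' _ hd'; simp [hd']
      · intro hd; exact absurd (Finset.mem_filter.2 ⟨hbd.1.2, hbd.2⟩) hd
      · intro b' _ hb'; simp [hb']
      · intro hb; exact absurd hbd.1.1 hb
    · rw [Finset.sum_eq_zero, eq_comm, Nat.card_eq_zero]
      · refine .inl ⟨fun ⟨i, hi⟩ => hbd ?_⟩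
        obtain ⟨⟨-, hb⟩, j, ⟨hd, hlt⟩, -⟩ := (hlab.fin_iff i b d).1 hi
        exact ⟨⟨Finset.mem_image.2 ⟨i, Finset.mem_univ _, hb⟩,
          Finset.mem_image.2 ⟨j, Finset.mem_univ _, hd⟩⟩, hlt⟩
      · intro b' hb'
        refine Finset.sum_eq_zero fun d' hd' => if_neg ?_
        rintro ⟨rfl, rfl⟩
        exact hbd ⟨⟨hb', (Finset.mem_filter.1 hd').1⟩, (Finset.mem_filter.1 hd').2⟩

end IsReduction

end Reduction

/-! ## Column reduction -/

section PartialReduction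

variable {n : ℕ} {σ : Fin n → Finset ℕ} {rk : Fin n → ℕ} {R : Fin n → Fin n → ZMod 2}
  {low piv : Fin n → Option (Fin n)} {k t : ℕ} {i j : Fin n}

/-- The state of the column reduction: the first `k` columns are reduced, and in the `k`-th
column the last `t` rows are processed. -/
structure PartialReduction (σ : Fin n → Finset ℕ) (rk : Fin n → ℕ) (R : Fin n → Fin n → ZMod 2)
    (low piv : Fin n → Option (Fin n)) (k t : ℕ) : Prop where
  dim : ∀ j i, R j i ≠ 0 → (σ i).card + 1 = (σ j).card
  span : ∀ j, R j - boundaryCol σ j ∈ Submodule.span (ZMod 2)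
    (boundaryCol σ '' {k | rk k < rk j ∧ (σ k).card = (σ j).card})
  ne_zero : ∀ j i, low j = some i → R j i ≠ 0
  eq_zero : ∀ j i i', low j = some i → rk i < rk i' → R j i' = 0
  piv_iff : ∀ i j, piv i = some j ↔ low j = some i
  done : ∀ j, rk j < k → low j = none → R j = 0
  later : ∀ j, k < rk j → low j = none
  current : ∀ j, rk j = k → low j = none → ∀ i, n ≤ rk i + t → R j i = 0

theorem PartialReduction.init (hrk : ∀ i, rk i < n) :
    PartialReduction σ rk (boundaryCol σ) (fun _ => none) (fun _ => none) 0 0 where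
  dim := fun j i h => by
    by_contra h'
    exact h (if_neg fun h'' => h' h''.2)
  span := fun j => by rw [sub_self]; exact Submodule.zero_mem _
  ne_zero := by simp
  eq_zero := by simp
  piv_iff := by simp
  done := by simp
  later := by simp
  current := fun j _ _ i hi => absurd (hrk i) (by omega)

theorem PartialReduction.next (h : PartialReduction σ rk R low piv k n) (hrk : ∀ i, rk i < n) :
    PartialReduction σ rk R low piv (k + 1) 0 where
  __ := h
  done := fun j hj hl => by
    rcases Nat.lt_succ_iff_lt_or_eq.1 hj with h1 | h1
    · exact h.done j h1 hl
    · exact funext fun i => h.current j h1 hl i (by omega)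
  later := fun j hj => h.later j (by omega)
  current := fun j _ _ i hi => absurd (hrk i) (by omega)

theorem PartialReduction.isReduction (h : PartialReduction σ rk R low piv n t)
    (hrk : ∀ i, rk i < n) (hinj : Function.Injective rk) : IsReduction σ rk R low where
  __ := h
  rk_injective := hinj
  eq_zero' := fun j => h.done j (hrk j)
  inj := fun j j' i hj hj' => by
    rw [← h.piv_iff] at hj hj'
    exact Option.some.inj (hj.symm.trans hj')

theorem PartialReduction.step_skip (h : PartialReduction σ rk R low piv k t)
    (hinj : Function.Injective rk) (hi : rk i + t + 1 = n) (hj : rk j = k)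
    (hskip : R j i = 0 ∨ low j ≠ none) : PartialReduction σ rk R low piv k (t + 1) where
  __ := h
  current := fun j' hj' hl i' hi' => by
    obtain rfl := hinj (hj'.trans hj.symm)
    rcases (by omega : n ≤ rk i' + t ∨ rk i' = rk i) with h1 | h1
    · exact h.current j' hj' hl i' h1
    · rw [hinj h1]; exact hskip.resolve_right (not_not.2 hl)

/-- All rows behind `i` are already zero in column `j`, so a nonzero entry in row `i` that no
earlier column can clear is the final lowest entry. -/
theorem PartialReduction.step_set (h : PartialReduction σ rk R low piv k t)
    (hinj : Function.Injective rk) (hi : rk i + t + 1 = n) (hj : rk j = k)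
    (hR : R j i ≠ 0) (hlow : low j = none) (hpiv : piv i = none) :
    PartialReduction σ rk R (Function.update low j (some i)) (Function.update piv i (some j))
      k (t + 1) where
  dim := h.dim
  span := h.span
  ne_zero := fun j' i' hl => by
    by_cases hjj : j' = j
    · subst hjj; simp only [Function.update_self, Option.some.injEq] at hl; exact hl ▸ hR
    · exact h.ne_zero _ _ (by simpa [hjj] using hl)
  eq_zero := fun j' i' i'' hl hlt => by
    by_cases hjj : j' = j
    · subst hjj; simp only [Function.update_self, Option.some.injEq] at hl
      subst hl
      exact h.current j' hj hlow i'' (by omega)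
    · exact h.eq_zero _ _ _ (by simpa [hjj] using hl) hlt
  piv_iff := fun i' j' => by
    have h1 := h.piv_iff i' j'
    by_cases hii : i' = i <;> by_cases hjj : j' = j
    · simp [hii, hjj]
    · subst hii
      simp only [Function.update_self, Option.some.injEq, Function.update_of_ne hjj]
      rw [hpiv] at h1
      simp only [reduceCtorEq, false_iff] at h1
      exact ⟨fun h => absurd h.symm hjj, fun h => absurd h h1⟩
    · subst hjj
      simp only [Function.update_self, Option.some.injEq, Function.update_of_ne hii]
      rw [hlow] at h1
      simp only [reduceCtorEq, iff_false] at h1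
      exact ⟨fun h => absurd h h1, fun h => absurd h.symm hii⟩
    · simpa [hii, hjj] using h1
  done := fun j' hj' hl => by
    have hjj : j' ≠ j := by rintro rfl; omega
    exact h.done j' hj' (by simpa [hjj] using hl)
  later := fun j' hj' => by
    have hjj : j' ≠ j := by rintro rfl; omega
    simpa [hjj] using h.later j' hj'
  current := fun j' hj' hl => by
    obtain rfl := hinj (hj'.trans hj.symm)
    simp at hl

/-- The column `j'` with lowest entry `i` vanishes behind `i`, so adding it clears row `i` modulo 2
without disturbing the rows already cleared; one pass over the rows therefore reduces a column. It
is an earlier column because later ones have no lowest entry assigned yet. -/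
theorem PartialReduction.step_add (h : PartialReduction σ rk R low piv k t) {j' : Fin n}
    (hinj : Function.Injective rk) (hi : rk i + t + 1 = n) (hj : rk j = k)
    (hR : R j i ≠ 0) (hlow : low j = none) (hpiv : piv i = some j') :
    PartialReduction σ rk (Function.update R j (R j + R j')) low piv k (t + 1) := by
  have hl' := (h.piv_iff i j').1 hpiv
  have hne : j' ≠ j := by rintro rfl; simp [hlow] at hl'
  have hlt : rk j' < rk j := by
    rcases lt_trichotomy (rk j') k with h1 | h1 | h1
    · omega
    · exact absurd (hinj (h1.trans hj.symm)) hne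
    · simp [h.later j' h1] at hl'
  have hR' := h.ne_zero j' i hl'
  have hcard : (σ j').card = (σ j).card := by
    have := h.dim _ _ hR
    have := h.dim _ _ hR'
    omega
  refine ⟨fun j'' i' hi' => ?_, fun j'' => ?_, fun j'' i' hl => ?_, fun j'' i' i'' hl hlt => ?_,
    h.piv_iff, fun j'' hj'' hl => ?_, h.later, fun j'' hj'' hl i' hi' => ?_⟩
  · by_cases hjj : j'' = j
    · subst hjj
      rw [Function.update_self, Pi.add_apply] at hi'
      by_cases h0 : R j'' i' = 0
      · rw [h0, zero_add] at hi'
        rw [← hcard]; exact h.dim _ _ hi'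
      · exact h.dim _ _ h0
    · exact h.dim _ _ (by simpa [hjj] using hi')
  · by_cases hjj : j'' = j
    · subst hjj
      rw [Function.update_self]
      have : R j'' + R j' - boundaryCol σ j'' =
          (R j'' - boundaryCol σ j'') + ((R j' - boundaryCol σ j') + boundaryCol σ j') := by abel
      rw [this]
      refine Submodule.add_mem _ (h.span j'') (Submodule.add_mem _
        (Submodule.span_mono (Set.image_mono ?_) (h.span j'))
        (Submodule.subset_span ⟨j', ⟨hlt, hcard⟩, rfl⟩))
      rintro l ⟨h1, h2⟩
      exact ⟨h1.trans hlt, h2.trans hcard⟩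
    · simpa [hjj] using h.span j''
  · have hjj : j'' ≠ j := by rintro rfl; simp [hlow] at hl
    simpa [hjj] using h.ne_zero _ _ hl
  · have hjj : j'' ≠ j := by rintro rfl; simp [hlow] at hl
    simpa [hjj] using h.eq_zero _ _ _ hl hlt
  · have hjj : j'' ≠ j := by rintro rfl; omega
    simpa [hjj] using h.done j'' hj'' hl
  · obtain rfl := hinj (hj''.trans hj.symm)
    rw [Function.update_self, Pi.add_apply]
    rcases (by omega : n ≤ rk i' + t ∨ rk i' = rk i) with h1 | h1
    · rw [h.current j'' hj'' hlow i' h1, h.eq_zero j' i i' hl' (by omega), zero_add]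
    · rw [hinj h1]
      generalize R j'' i = x at hR
      generalize R j' i = y at hR'
      revert x y; decide

end PartialReduction

/-- Memory code of an optional index. -/
def optCode {n : ℕ} : Option (Fin n) → ℕ
  | none => 0
  | some i => i + 1

/-- Add column `52` to column `50` of the matrix in array `12`. -/
def addColProg : FProg :=
  .rep 42 (.cond (.natEq (.get 12 (reg 42) (reg 52)) 1)
    (.setN 12 (reg 42) (reg 50) (1 - .get 12 (reg 42) (reg 50))) .skip)

/-- Process the row number `41`, counted from the last one, in column `50`. -/
def reduceStep : FProg :=
  .cond (.natLt (reg 41) (reg 10))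
    (.setN 51 0 0 (.get 13 0 (reg 10 - 1 - reg 41)) ;;
      .cond (.and (.natEq (.get 12 (reg 51) (reg 50)) 1) (.natEq (.get 15 0 (reg 50)) 0))
        (.cond (.natEq (.get 14 0 (reg 51)) 0)
          (.setN 14 0 (reg 51) (reg 50 + 1) ;; .setN 15 0 (reg 50) (reg 51 + 1))
          (.setN 52 0 0 (.get 14 0 (reg 51) - 1) ;; addColProg))
        .skip)
    .skip

/-- Reduce column `50`. -/
def reduceColProg : FProg := .rep 41 reduceStep

/-- Column reduction of the matrix in array `12`. -/
def reduceProg : FProg :=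
  .rep 40 (.setN 14 0 (reg 40) 0 ;; .setN 15 0 (reg 40) 0) ;;
  .rep 40 (.cond (.natLt (reg 40) (reg 10))
    (.setN 50 0 0 (.get 13 0 (reg 40)) ;; reduceColProg) .skip)

/-- Because `j' ≠ j`, the source column keeps its original entries throughout the loop. -/
theorem addColProg_run (s : Store) (j j' : ℕ) (hj : s.nat 50 0 0 = j) (hj' : s.nat 52 0 0 = j')
    (hne : j' ≠ j) (i l : ℕ) : (addColProg.run s).nat 12 i l =
      if l = j ∧ i < s.nat 5 0 0 ∧ s.nat 12 i j' = 1 then 1 - s.nat 12 i j else s.nat 12 i l := by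
  refine run_rep_induct addColProg rfl s (fun k s' => ∀ i l, s'.nat 12 i l =
    if l = j ∧ i < k ∧ s.nat 12 i j' = 1 then 1 - s.nat 12 i j else s.nat 12 i l)
    (fun _ _ _ h => h) (by simp) ?_ i l
  intro k hk s' ih hv hf i l
  simp only [run_cond, Test.holds_natEq, NatExpr.eval_get, NatExpr.eval_ofNat, hv,
    hf.nat 52 rfl, hj', ih, hne, false_and, if_false, run_setN, hf.nat 50 rfl, hj, run_skip,
    NatExpr.eval_sub, true_and, lt_self_iff_false]
  by_cases h1 : s.nat 12 k j' = 1
  · simp only [h1, if_true, Store.setNat_nat_self, ih]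
    by_cases hik : i = k
    · subst hik
      by_cases hl : l = j <;> simp [hl, h1]
    · simp [hik, (by omega : i < k + 1 ↔ i < k)]
  · rw [if_neg h1, ih]
    by_cases hik : i = k
    · subst hik; simp [h1]
    · simp [(by omega : i < k + 1 ↔ i < k)]

section

variable {n : ℕ} {σ : Fin n → Finset ℕ} {rk : Fin n → ℕ}

/-- The representation of the state of the column reduction. -/
structure ReductionMem (s : Store) (R : Fin n → Fin n → ZMod 2)
    (low piv : Fin n → Option (Fin n)) : Prop where
  mat : ∀ i j : Fin n, s.nat 12 i j = (R j i).val
  low : ∀ j : Fin n, s.nat 15 0 j = optCode (low j)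
  piv : ∀ i : Fin n, s.nat 14 0 i = optCode (piv i)

/-- The row processed is the one of rank `n - 1 - t`, and the branches of the program correspond to
`step_skip`, `step_set` and `step_add`. -/
theorem reduceStep_run (s : Store) {R : Fin n → Fin n → ZMod 2} {low piv : Fin n → Option (Fin n)}
    {t : ℕ} {j : Fin n} (hn : s.nat 10 0 0 = n) (hN : n ≤ s.nat 5 0 0)
    (hinj : Function.Injective rk) (hsurj : ∀ k < n, ∃ i, rk i = k)
    (hord : ∀ i, s.nat 13 0 (rk i) = i) (ht : s.nat 41 0 0 = t) (htn : t < n)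
    (hj : s.nat 50 0 0 = j)
    (hm : ReductionMem s R low piv) (h : PartialReduction σ rk R low piv (rk j) t) :
    ∃ R low piv, ReductionMem (reduceStep.run s) R low piv ∧
      PartialReduction σ rk R low piv (rk j) (t + 1) := by
  obtain ⟨i, hi⟩ := hsurj (n - 1 - t) (by omega)
  have hi' := hord i
  rw [hi] at hi'
  have hval : ∀ x : ZMod 2, x.val = 1 ↔ x ≠ 0 := by decide
  have hopt : ∀ x : Option (Fin n), optCode x = 0 ↔ x = none := by
    rintro (_ | x) <;> simp [optCode]
  simp only [reduceStep, run_cond, run_seq, run_setN, Test.holds_natLt, Test.holds_and,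
    Test.holds_natEq, NatExpr.eval_get, NatExpr.eval_ofNat, NatExpr.eval_sub, NatExpr.eval_add,
    ht, hn, htn, if_true, hi', Store.setNat_nat_self, and_self, hj, run_skip, ne_eq,
    Nat.reduceEqDiff,
    not_false_eq_true, Store.setNat_nat_ne, hm.mat, hm.low,
    hm.piv, hval, hopt]
  by_cases h1 : ¬ R j i = 0 ∧ low j = none
  swap
  · rw [if_neg h1]
    refine ⟨R, low, piv, ⟨fun i j => by simp [hm.mat], fun i => by simp [hm.low],
      fun i => by simp [hm.piv]⟩, h.step_skip (i := i) hinj (by omega) rfl ?_⟩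
    tauto
  rw [if_pos h1]
  by_cases h2 : piv i = none
  · rw [if_pos h2]
    refine ⟨_, _, _, ⟨fun i j => by simp [hm.mat], fun l => ?_, fun l => ?_⟩,
      h.step_set hinj (by omega) rfl h1.1 h1.2 h2⟩
    · by_cases hl : l = j
      · simp [hl, optCode]
      · simp [hl, hm.low, Fin.val_inj]
    · by_cases hl : l = i
      · simp [hl, optCode]
      · simp [hl, hm.piv, Fin.val_inj]
  · rw [if_neg h2]
    obtain ⟨j', hj'⟩ := Option.ne_none_iff_exists'.1 h2
    have hne : j' ≠ j := by
      rintro rfl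
      have := (h.piv_iff i j').1 hj'
      simp [h1.2] at this
    refine ⟨_, _, _, ⟨fun i' l => ?_, fun l => ?_, fun l => ?_⟩,
      h.step_add hinj (by omega) rfl h1.1 h1.2 hj'⟩
    · rw [addColProg_run _ j j' (by simp [hj]) (by simp [hj', optCode])
        (fun h => hne (Fin.ext h))]
      have h5 : (i' : ℕ) < s.nat 5 0 0 := i'.2.trans_le hN
      by_cases hl : l = j
      · subst hl
        simp only [true_and, ne_eq, Nat.reduceEqDiff,
    not_false_eq_true,
          Store.setNat_nat_ne, h5, hm.mat, Function.update_self, Pi.add_apply]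
        generalize R l i' = x
        generalize R j' i' = y
        revert x y; decide
      · simp [hl, hm.mat, Fin.val_inj]
    · rw [run_nat 15 rfl]; simp [hm.low]
    · rw [run_nat 14 rfl]; simp [hm.piv]

/-- The loops run to `N ≥ n` and idle after `n` iterations, so the invariants carry `min k n` and
`min t n`. The table `piv`, inverse to `low`, finds the column to be added in constant time. -/
theorem reduceProg_run (s : Store) (hn : s.nat 10 0 0 = n) (hN : n ≤ s.nat 5 0 0)
    (hinj : Function.Injective rk) (hrk : ∀ i, rk i < n)
    (hord : ∀ i, s.nat 13 0 (rk i) = i)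
    (hmat : ∀ i j : Fin n, s.nat 12 i j = (boundaryCol σ j i).val) :
    ∃ R low piv, ReductionMem (reduceProg.run s) R low piv ∧ IsReduction σ rk R low ∧
      ∀ i j, piv i = some j ↔ low j = some i := by
  have hsurj : ∀ k < n, ∃ i, rk i = k := by
    intro k hk
    have h : Function.Injective fun i : Fin n => (⟨rk i, hrk i⟩ : Fin n) :=
      fun i j hij => hinj (congrArg Fin.val hij)
    obtain ⟨i, hi⟩ := Finite.surjective_of_injective h ⟨k, hk⟩
    exact ⟨i, congrArg Fin.val hi⟩
  rw [reduceProg, run_seq]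
  set P₁ : FProg := .rep 40 (.setN 14 0 (reg 40) 0 ;; .setN 15 0 (reg 40) 0) with hP₁
  set P₂ : FProg := .rep 40 (.cond (.natLt (reg 40) (reg 10))
    (.setN 50 0 0 (.get 13 0 (reg 40)) ;; reduceColProg) .skip) with hP₂
  have hz : ∀ i < s.nat 5 0 0, (P₁.run s).nat 14 0 i = 0 ∧ (P₁.run s).nat 15 0 i = 0 := by
    refine run_rep_induct P₁ rfl s (fun k s' => ∀ i < k, s'.nat 14 0 i = 0 ∧ s'.nat 15 0 i = 0)
      (fun _ _ _ h => h) (by simp) ?_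
    intro k hk s' ih hv hf i hi
    by_cases hik : i = k
    · simp [hik, hv]
    · simp [hik, hv, ih i (by omega)]
  have hN' : (P₁.run s).nat 5 0 0 = s.nat 5 0 0 := by rw [run_nat 5 rfl]
  have hmem : ReductionMem (P₁.run s) (boundaryCol σ) (fun _ => none) (fun _ => none) :=
    ⟨fun i j => by rw [run_nat 12 rfl, hmat], fun j => (hz j (j.2.trans_le hN)).2,
      fun i => (hz i (i.2.trans_le hN)).1⟩
  have hord' : ∀ i, (P₁.run s).nat 13 0 (rk i) = i := by rw [run_nat 13 rfl]; exact hord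
  have hn' : (P₁.run s).nat 10 0 0 = n := by rw [run_nat 10 rfl, hn]
  generalize P₁.run s = s₁ at *
  have key := run_rep_induct P₂ rfl s₁ (fun k s' => ∃ R low piv, ReductionMem s' R low piv ∧
    PartialReduction σ rk R low piv (min k n) 0)
    (fun k s' x ⟨R, low, piv, h1, h2⟩ => ⟨R, low, piv, ⟨h1.1, h1.2, h1.3⟩, h2⟩)
    ⟨_, _, _, hmem, by simpa using PartialReduction.init hrk⟩ ?_
  · obtain ⟨R, low, piv, h1, h2⟩ := key
    rw [min_eq_right (by omega)] at h2
    exact ⟨R, low, piv, h1, h2.isReduction hrk hinj, h2.piv_iff⟩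
  · rintro k hk s' ⟨R, low, piv, h1, h2⟩ hv hf
    by_cases hkn : k < n
    swap
    · refine ⟨R, low, piv, by simpa [hv, hf.nat 10 rfl, hn', hkn] using h1, ?_⟩
      rwa [min_eq_right (by omega)] at h2 ⊢
    obtain ⟨j, hj⟩ := hsurj k hkn
    rw [min_eq_left hkn.le] at h2
    simp only [run_cond, Test.holds_natLt, NatExpr.eval_get, NatExpr.eval_ofNat, hv,
      hf.nat 10 rfl, hn', hkn, if_true, run_seq, run_setN, hf.nat 13 rfl]
    rw [← hj, hord', min_eq_left (by omega)]
    have hs5 : (s'.setNat 50 0 0 j).nat 5 0 0 = s.nat 5 0 0 := by simp [hf.nat 5 rfl, hN']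
    generalize hs₂ : s'.setNat 50 0 0 j = s₂ at *
    have key := run_rep_induct reduceColProg rfl s₂ (fun t s' => ∃ R low piv,
      ReductionMem s' R low piv ∧ PartialReduction σ rk R low piv (rk j) (min t n))
      (fun k s' x ⟨R, low, piv, h1, h2⟩ => ⟨R, low, piv, ⟨h1.1, h1.2, h1.3⟩, h2⟩)
      ⟨R, low, piv, ⟨fun i j => by simp [← hs₂, h1.mat], fun i => by simp [← hs₂, h1.low],
        fun i => by simp [← hs₂, h1.piv]⟩, by simpa [hj] using h2⟩ ?_
    · obtain ⟨R, low, piv, h1, h2⟩ := key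
      rw [min_eq_right (by omega)] at h2
      exact ⟨R, low, piv, h1, h2.next hrk⟩
    · rintro t ht s'' ⟨R, low, piv, h3, h4⟩ hv' hf'
      by_cases htn : t < n
      · rw [min_eq_left htn.le] at h4
        rw [min_eq_left (by omega)]
        refine reduceStep_run s'' ?_ ?_ hinj hsurj ?_ hv' htn ?_ h3 h4
        · rw [hf'.nat 10 rfl, ← hs₂]; simp [hf.nat 10 rfl, hn']
        · rw [hf'.nat 5 rfl, hs5]; exact hN
        · rw [hf'.nat 13 rfl, ← hs₂]; simpa [hf.nat 13 rfl] using hord'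
        · rw [hf'.nat 50 rfl, ← hs₂]; simp
      · refine ⟨R, low, piv, ?_, ?_⟩
        · have : s''.nat 10 0 0 = n := by rw [hf'.nat 10 rfl, ← hs₂]; simp [hf.nat 10 rfl, hn']
          simpa [reduceStep, hv', this, htn] using h3
        · rwa [min_eq_right (by omega)] at h4 ⊢

end

/-! ## The bottleneck distance as an assignment problem -/

/-- The cost of assigning diagram points to each other, where `none` is the diagonal. -/
def optCost : Option (ℝ × WithTop ℝ) → Option (ℝ × WithTop ℝ) → ℝ≥0∞
  | none, none => 0
  | some a, none => diagonalCost a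
  | none, some b => diagonalCost b
  | some a, some b => matchCost a b

/-- A matching is a multiset of pairs whereas an assignment is indexed. This distributes the members
of a multiset among the indices, given that their labels fit. -/
theorem exists_lift {ι α β : Type*} (q₀ : ι → β) (x : ι → α) (g : β → α) (s : Multiset ι) (hs : s.Nodup)
    (Q : Multiset β) (h : s.map x = Q.map g) :
    ∃ q : ι → β, (∀ i ∈ s, g (q i) = x i) ∧ s.map q = Q := by
  classical
  induction s using Multiset.induction_on generalizing Q with
  | empty =>
    exact ⟨q₀, by simp, by simpa [eq_comm] using h⟩
  | cons i s ih =>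
    have hi : x i ∈ Q.map g := by rw [← h]; simp
    obtain ⟨b, hb, hbi⟩ := Multiset.mem_map.1 hi
    obtain ⟨Q', rfl⟩ := Multiset.exists_cons_of_mem hb
    rw [Multiset.map_cons, Multiset.map_cons, hbi, Multiset.cons_inj_right] at h
    rw [Multiset.nodup_cons] at hs
    obtain ⟨q, h1, h2⟩ := ih hs.2 Q' h
    refine ⟨Function.update q i b, fun j hj => ?_, ?_⟩
    · by_cases hji : j = i
      · simp [hji, hbi]
      · simpa [hji] using h1 j ((Multiset.mem_cons.1 hj).resolve_left hji)
    · rw [Multiset.map_cons, Function.update_self, ← h2]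
      congr 1
      refine Multiset.map_congr rfl fun j hj => ?_
      rw [Function.update_of_ne]
      rintro rfl
      exact hs.1 hj

/-- Among the assigned pairs, those of two points form a partial matching, those with one `none`
give its unmatched points, and pairs of two diagonal copies are dropped. -/
theorem bottleneck_le {N : ℕ} (x y : Fin N → Option (ℝ × WithTop ℝ)) (π : Equiv.Perm (Fin N))
    {c : ℝ≥0∞} (h : ∀ i, optCost (x i) (y (π i)) ≤ c) :
    bottleneck ((Finset.univ : Finset (Fin N)).val.filterMap x)
      ((Finset.univ : Finset (Fin N)).val.filterMap y) ≤ c := by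
  set Q : Multiset (Option (ℝ × WithTop ℝ) × Option (ℝ × WithTop ℝ)) :=
    (Finset.univ : Finset (Fin N)).val.map fun i => (x i, y (π i)) with hQ
  have hcost : ∀ q ∈ Q, optCost q.1 q.2 ≤ c := by
    intro q hq
    obtain ⟨i, -, rfl⟩ := Multiset.mem_map.1 hq
    exact h i
  have hx : (Finset.univ : Finset (Fin N)).val.filterMap x = Q.filterMap Prod.fst := by
    rw [hQ, Multiset.filterMap_map]; rfl
  have hy : (Finset.univ : Finset (Fin N)).val.filterMap y = Q.filterMap Prod.snd := by
    rw [hQ, Multiset.filterMap_map]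
    conv_lhs => rw [← Multiset.map_univ_val_equiv π, Multiset.filterMap_map]
    rfl
  rw [hx, hy]
  clear_value Q
  have key : ∃ M : Multiset ((ℝ × WithTop ℝ) × (ℝ × WithTop ℝ)), ∃ L₁ L₂ : Multiset (ℝ × WithTop ℝ),
      Q.filterMap Prod.fst = M.map Prod.fst + L₁ ∧ Q.filterMap Prod.snd = M.map Prod.snd + L₂ ∧
      (∀ e ∈ M, matchCost e.1 e.2 ≤ c) ∧ (∀ a ∈ L₁, diagonalCost a ≤ c) ∧
      ∀ a ∈ L₂, diagonalCost a ≤ c := by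
    clear hx hy hQ
    induction Q using Multiset.induction_on with
    | empty => exact ⟨0, 0, 0, by simp⟩
    | cons q Q ih =>
      obtain ⟨M, L₁, L₂, h1, h2, h3, h4, h5⟩ :=
        ih fun q hq => hcost q (Multiset.mem_cons_of_mem hq)
      have hq := hcost q (Multiset.mem_cons_self _ _)
      obtain ⟨_ | a, _ | b⟩ := q
      · exact ⟨M, L₁, L₂, by simpa, by simpa, h3, h4, h5⟩
      · refine ⟨M, L₁, b ::ₘ L₂, by simpa, ?_, h3, h4, ?_⟩
        · rw [Multiset.filterMap_cons_some (f := Prod.snd) _ _ rfl, h2, Multiset.add_cons]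
        · exact Multiset.forall_mem_cons.2 ⟨hq, h5⟩
      · refine ⟨M, a ::ₘ L₁, L₂, ?_, by simpa, h3, ?_, h5⟩
        · rw [Multiset.filterMap_cons_some (f := Prod.fst) _ _ rfl, h1, Multiset.add_cons]
        · exact Multiset.forall_mem_cons.2 ⟨hq, h4⟩
      · refine ⟨(a, b) ::ₘ M, L₁, L₂, ?_, ?_, ?_, h4, h5⟩
        · rw [Multiset.filterMap_cons_some (f := Prod.fst) _ _ rfl, h1, Multiset.map_cons, Multiset.cons_add]
        · rw [Multiset.filterMap_cons_some (f := Prod.snd) _ _ rfl, h2, Multiset.map_cons, Multiset.cons_add]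
        · rintro e he
          rcases Multiset.mem_cons.1 he with rfl | he
          exacts [hq, h3 e he]
  obtain ⟨M, L₁, L₂, h1, h2, h3, h4, h5⟩ := key
  rw [h1, h2]
  refine (iInf₂_le M ⟨Multiset.le_add_right _ _, Multiset.le_add_right _ _⟩).trans ?_
  rw [matchingCost, add_tsub_cancel_left, add_tsub_cancel_left]
  simp only [max_le_iff, Multiset.sup_le, Multiset.mem_map]
  refine ⟨?_, ?_, ?_⟩
  · rintro _ ⟨e, he, rfl⟩; exact h3 e he
  · rintro _ ⟨e, he, rfl⟩; exact h4 e he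
  · rintro _ ⟨e, he, rfl⟩; exact h5 e he

theorem eq_map_some_add {α : Type*} (S : Multiset (Option α)) :
    S = (S.filterMap id).map some + Multiset.replicate (S.card - (S.filterMap id).card) none := by
  have hle : ∀ S : Multiset (Option α), (S.filterMap id).card ≤ S.card := fun S => by
    induction S using Multiset.induction_on with
    | empty => simp
    | cons a S ih =>
      cases a with
      | none => rw [Multiset.filterMap_cons_none _ _ rfl]; simp; omega
      | some a => rw [Multiset.filterMap_cons_some (f := id) _ _ rfl]; simpa using ih
  induction S using Multiset.induction_on with
  | empty => simp
  | cons a S ih =>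
    have := hle S
    cases a with
    | none =>
      rw [Multiset.filterMap_cons_none _ _ rfl, Multiset.card_cons, Nat.succ_sub this,
        Multiset.replicate_succ, Multiset.add_cons, ← ih]
    | some a =>
      rw [Multiset.filterMap_cons_some (f := id) _ _ rfl]
      simp only [Multiset.card_cons, Multiset.map_cons, Nat.add_sub_add_right, Multiset.cons_add]
      rw [← ih]

/-- Unmatched points are paired with the diagonal, and the remaining places with pairs of diagonal
copies of cost zero. The bound `D₁.card + D₂.card ≤ N` ensures that there are enough diagonal copies
on both sides, even for the empty matching. -/
theorem exists_perm_of_isPartialMatching {N : ℕ} (x y : Fin N → Option (ℝ × WithTop ℝ))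
    {D₁ D₂ : Multiset (ℝ × WithTop ℝ)}
    (hD₁ : D₁ = (Finset.univ : Finset (Fin N)).val.filterMap x)
    (hD₂ : D₂ = (Finset.univ : Finset (Fin N)).val.filterMap y)
    (hN : D₁.card + D₂.card ≤ N) {M : Multiset ((ℝ × WithTop ℝ) × (ℝ × WithTop ℝ))}
    (hM : IsPartialMatching D₁ D₂ M) :
    ∃ π : Equiv.Perm (Fin N), ∀ i, optCost (x i) (y (π i)) ≤ matchingCost D₁ D₂ M := by
  obtain ⟨L₁, hL₁⟩ := Multiset.le_iff_exists_add.1 hM.1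
  obtain ⟨L₂, hL₂⟩ := Multiset.le_iff_exists_add.1 hM.2
  have hX : (Finset.univ : Finset (Fin N)).val.map x =
      D₁.map some + Multiset.replicate (N - D₁.card) none := by
    have := eq_map_some_add ((Finset.univ : Finset (Fin N)).val.map x)
    rw [Multiset.filterMap_map, Function.id_comp, ← hD₁] at this
    simpa using this
  have hY : (Finset.univ : Finset (Fin N)).val.map y =
      D₂.map some + Multiset.replicate (N - D₂.card) none := by
    have := eq_map_some_add ((Finset.univ : Finset (Fin N)).val.map y)
    rw [Multiset.filterMap_map, Function.id_comp, ← hD₂] at this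
    simpa using this
  have hc₁ : D₁.card = M.card + L₁.card := by rw [hL₁]; simp
  have hc₂ : D₂.card = M.card + L₂.card := by rw [hL₂]; simp
  set Q : Multiset (Option (ℝ × WithTop ℝ) × Option (ℝ × WithTop ℝ)) :=
    M.map (fun e => (some e.1, some e.2)) + L₁.map (fun a => (some a, none)) +
      L₂.map (fun b => (none, some b)) +
      Multiset.replicate (N - M.card - L₁.card - L₂.card) (none, none) with hQ
  have hQ₁ : Q.map Prod.fst = (Finset.univ : Finset (Fin N)).val.map x := by
    rw [hX, hL₁, hQ]
    simp only [Multiset.map_add, Multiset.map_map, Function.comp_def, Multiset.map_replicate,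
      Multiset.map_const', Multiset.card_add, Multiset.card_map, add_assoc]
    rw [← Multiset.replicate_add]
    congr 4
    omega
  have hQ₂ : Q.map Prod.snd = (Finset.univ : Finset (Fin N)).val.map y := by
    rw [hY, hL₂, hQ]
    simp only [Multiset.map_add, Multiset.map_map, Function.comp_def, Multiset.map_replicate,
      Multiset.map_const', Multiset.card_add, Multiset.card_map, add_assoc]
    rw [add_left_comm (Multiset.replicate _ _), ← Multiset.replicate_add]
    congr 4
    omega
  have hcost : ∀ q ∈ Q, optCost q.1 q.2 ≤ matchingCost D₁ D₂ M := by
    have e₁ : D₁ - M.map Prod.fst = L₁ := by rw [hL₁, add_tsub_cancel_left]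
    have e₂ : D₂ - M.map Prod.snd = L₂ := by rw [hL₂, add_tsub_cancel_left]
    rw [matchingCost, e₁, e₂]
    intro q hq
    simp only [hQ, Multiset.mem_add, Multiset.mem_map] at hq
    rcases hq with ((⟨e, he, rfl⟩ | ⟨a, ha, rfl⟩) | ⟨a, ha, rfl⟩) | hq
    · exact le_max_of_le_left (Multiset.le_sup (Multiset.mem_map.2 ⟨e, he, rfl⟩))
    · exact le_max_of_le_right (le_max_of_le_left (Multiset.le_sup (Multiset.mem_map.2 ⟨a, ha, rfl⟩)))
    · exact le_max_of_le_right (le_max_of_le_right (Multiset.le_sup (Multiset.mem_map.2 ⟨a, ha, rfl⟩)))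
    · rw [Multiset.eq_of_mem_replicate hq]; exact zero_le
  clear_value Q
  -- The first lift chooses for each index `i` a pair that starts with `x i`; the second one finds
  -- an index that carries the partner.
  obtain ⟨q, hq₁, hq₂⟩ := exists_lift (fun _ => (none, none)) x Prod.fst _ Finset.univ.nodup Q hQ₁.symm
  rw [← hq₂, Multiset.map_map] at hQ₂
  obtain ⟨π, hπ₁, hπ₂⟩ := exists_lift id (fun i => (q i).2) y _ Finset.univ.nodup _ hQ₂
  have hπ : Function.Surjective π := fun j => by
    have : j ∈ (Finset.univ : Finset (Fin N)).val.map π := by rw [hπ₂]; exact Finset.mem_univ j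
    obtain ⟨i, -, hi⟩ := Multiset.mem_map.1 this
    exact ⟨i, hi⟩
  refine ⟨Equiv.ofBijective π (Finite.surjective_iff_bijective.1 hπ), fun i => ?_⟩
  rw [Equiv.ofBijective_apply, hπ₁ i (Finset.mem_univ_val i), ← hq₁ i (Finset.mem_univ_val i)]
  refine hcost _ ?_
  rw [← hq₂]
  exact Multiset.mem_map.2 ⟨i, Finset.mem_univ_val i, rfl⟩

theorem le_bottleneck {N : ℕ} (x y : Fin N → Option (ℝ × WithTop ℝ))
    (hN : ((Finset.univ : Finset (Fin N)).val.filterMap x).card +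
      ((Finset.univ : Finset (Fin N)).val.filterMap y).card ≤ N) {c : ℝ≥0∞}
    (h : ∀ π : Equiv.Perm (Fin N), ∃ i, c ≤ optCost (x i) (y (π i))) :
    c ≤ bottleneck ((Finset.univ : Finset (Fin N)).val.filterMap x)
      ((Finset.univ : Finset (Fin N)).val.filterMap y) := by
  refine le_iInf₂ fun M hM => ?_
  obtain ⟨π, hπ⟩ := exists_perm_of_isPartialMatching x y rfl rfl hN hM
  obtain ⟨i, hi⟩ := h π
  exact hi.trans (hπ i)

/-! ## The bottleneck assignment algorithm -/

/-- Rows below `r` are matched: `mr i = c + 1` and `mc c = i + 1` if row `i` is matched to column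
`c`, and these entries are `0` for unmatched rows and columns. All weights of matched pairs are at
most `b`. If `hole` is a column, then its `mc`-entry is meaningless, and it is not matched. -/
structure IsMatching (N r : ℕ) (W : ℕ → ℕ → ℝ) (hole : Option ℕ) (mr mc : ℕ → ℕ) (b : ℝ) :
    Prop where
  ne_zero_iff : ∀ i < N, mr i ≠ 0 ↔ i < r
  row : ∀ i < N, ∀ c, mr i = c + 1 → c < N ∧ hole ≠ some c ∧ mc c = i + 1 ∧ W i c ≤ b
  col : ∀ c < N, hole ≠ some c → ∀ i, mc c = i + 1 → i < N ∧ mr i = c + 1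

/-- The alternating tree of visited columns (`vis c ≠ 0`) with predecessor rows `par c`. -/
def IsTree (N r : ℕ) (W : ℕ → ℕ → ℝ) (mr vis par : ℕ → ℕ) (b : ℝ) : Prop :=
  ∀ c < N, vis c ≠ 0 → par c < N ∧ W (par c) c ≤ b ∧
    (par c = r ∨ ∃ c' < N, vis c' ≠ 0 ∧ vis c' < vis c ∧ mr (par c) = c' + 1)

/-- The rows of the alternating tree. -/
def InTree (N r : ℕ) (mr vis : ℕ → ℕ) (i : ℕ) : Prop :=
  i < N ∧ (i = r ∨ ∃ c < N, vis c ≠ 0 ∧ mr i = c + 1)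

/-- The minimal weights `mv c` of the edges from tree rows to the unvisited columns `c`. -/
def IsFront (N r : ℕ) (W : ℕ → ℕ → ℝ) (mr vis par : ℕ → ℕ) (mv : ℕ → ℝ) : Prop :=
  ∀ c < N, vis c = 0 → InTree N r mr vis (par c) ∧ mv c = W (par c) c ∧
    ∀ i, InTree N r mr vis i → mv c ≤ W i c

/-- Every assignment has an edge of weight at least `b`. -/
def IsLowerBound (N : ℕ) (W : ℕ → ℕ → ℝ) (b : ℝ) : Prop :=
  ∀ π : Equiv.Perm (Fin N), ∃ i : Fin N, b ≤ W i (π i)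

/-- `t` columns are visited, and all of them are matched. -/
structure IsSearch (N r : ℕ) (W : ℕ → ℕ → ℝ) (mr mc vis par : ℕ → ℕ) (mv : ℕ → ℝ) (b : ℝ)
    (t : ℕ) : Prop where
  tree : IsTree N r W mr vis par b
  front : IsFront N r W mr vis par mv
  lower : IsLowerBound N W b
  card : ((Finset.range N).filter fun c => vis c ≠ 0).card = t
  le : ∀ c < N, vis c ≤ t
  matched : ∀ c < N, vis c ≠ 0 → mc c ≠ 0

section

variable {N r t c : ℕ} {W : ℕ → ℕ → ℝ} {mr mc vis par : ℕ → ℕ} {mv : ℕ → ℝ} {b : ℝ}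

theorem IsMatching.mono (h : IsMatching N r W none mr mc b) {b' : ℝ} (hb : b ≤ b') :
    IsMatching N r W none mr mc b' where
  __ := h
  row := fun i hi c hc => by
    obtain ⟨h1, h2, h3, h4⟩ := h.row i hi c hc
    exact ⟨h1, h2, h3, h4.trans hb⟩

/-- If all weights of an assignment were below `mv c`, it would send every row of the tree to a
visited column. But these rows are `r` and the partners of the visited columns, one more than there
are visited columns. -/
theorem IsSearch.lowerBound (h : IsSearch N r W mr mc vis par mv b t)
    (hm : IsMatching N r W none mr mc b) (hr : r < N) (hmin : ∀ c' < N, vis c' = 0 → mv c ≤ mv c') :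
    IsLowerBound N W (max b (mv c)) := by
  classical
  intro π
  rcases le_total (mv c) b with hb | hb
  · rw [max_eq_left hb]; exact h.lower π
  rw [max_eq_right hb]
  by_contra! hcon
  have hvis : ∀ i : Fin N, InTree N r mr vis i → vis (π i) ≠ 0 := by
    intro i hi h0
    have h1 := (h.front (π i) (π i).2 h0).2.2 i hi
    exact absurd (hcon i) ((hmin _ (π i).2 h0).trans h1).not_gt
  set V : Finset (Fin N) := Finset.univ.filter fun c : Fin N => vis c ≠ 0 with hV
  have hrow : ∀ c : Fin N, c ∈ V → ∃ i : Fin N, mc c = i + 1 ∧ mr i = c + 1 := by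
    intro c hc
    obtain ⟨k, hk⟩ := Nat.exists_eq_succ_of_ne_zero
      (h.matched c c.2 (Finset.mem_filter.1 hc).2)
    obtain ⟨h1, h2⟩ := hm.col c c.2 (by simp) k hk
    exact ⟨⟨k, h1⟩, hk, h2⟩
  choose! g hg1 hg2 using hrow
  have hg : Set.InjOn g V := by
    intro c hc c' hc' hcc
    have h1 := hg2 c hc
    rw [hcc, hg2 c' hc'] at h1
    exact Fin.ext (by omega)
  have hnot : (⟨r, hr⟩ : Fin N) ∉ V.image g := by
    intro hmem
    obtain ⟨c, hc, hcr⟩ := Finset.mem_image.1 hmem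
    have h1 := hg2 c hc
    rw [hcr] at h1
    exact absurd ((hm.ne_zero_iff r hr).1 (by simp only at h1; omega)) (lt_irrefl r)
  have h1 : (insert (⟨r, hr⟩ : Fin N) (V.image g)).card ≤ V.card := by
    refine Finset.card_le_card_of_injOn π ?_ π.injective.injOn
    intro i hi
    refine Finset.mem_coe.2 (Finset.mem_filter.2 ⟨Finset.mem_univ _, hvis i ⟨i.2, ?_⟩⟩)
    rcases Finset.mem_insert.1 (Finset.mem_coe.1 hi) with rfl | hi
    · exact .inl rfl
    · obtain ⟨c, hc, rfl⟩ := Finset.mem_image.1 hi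
      exact .inr ⟨c, c.2, (Finset.mem_filter.1 hc).2, hg2 c hc⟩
  rw [Finset.card_insert_of_notMem hnot, Finset.card_image_of_injOn hg] at h1
  omega

/-- The entry `t + 1` is a time stamp. Predecessors have smaller stamps, so that following `par` and
`mr` leads back to the root. -/
theorem IsSearch.visit_tree (h : IsSearch N r W mr mc vis par mv b t) (hc : c < N)
    (hvc : vis c = 0) :
    IsTree N r W mr (Function.update vis c (t + 1)) par (max b (mv c)) := by
  intro c' hc' hv
  by_cases hcc : c' = c
  · subst hcc
    obtain ⟨h1, h2, -⟩ := h.front c' hc hvc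
    refine ⟨h1.1, by rw [← h2]; exact le_max_right _ _, h1.2.imp_right ?_⟩
    rintro ⟨d, hd, hvd, hmd⟩
    have hne : d ≠ c' := by rintro rfl; exact hvd hvc
    exact ⟨d, hd, by simpa [hne] using hvd, by simpa [hne, Nat.lt_succ_iff] using h.le d hd, hmd⟩
  · rw [Function.update_of_ne hcc] at hv ⊢
    obtain ⟨h1, h2, h3⟩ := h.tree c' hc' hv
    refine ⟨h1, h2.trans (le_max_left _ _), h3.imp_right ?_⟩
    rintro ⟨d, hd, hvd, hlt, hmd⟩
    have hne : d ≠ c := by rintro rfl; exact hvd hvc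
    exact ⟨d, hd, by simpa [hne] using hvd, by simpa [hne] using hlt, hmd⟩

/-- Visiting a matched column adds just one row to the tree, its partner `i`. The front minima need
only be compared with the edges from `i`, as in Prim's algorithm. -/
theorem IsSearch.visit (h : IsSearch N r W mr mc vis par mv b t)
    (hm : IsMatching N r W none mr mc b) (hr : r < N) (hc : c < N)
    (hvc : vis c = 0) (hmin : ∀ c' < N, vis c' = 0 → mv c ≤ mv c') {i : ℕ} (hi : mc c = i + 1)
    {par' : ℕ → ℕ} {mv' : ℕ → ℝ}
    (hpar : ∀ j < N, par' j =
      if Function.update vis c (t + 1) j = 0 ∧ W i j < mv j then i else par j)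
    (hmv : ∀ j < N, mv' j =
      if Function.update vis c (t + 1) j = 0 ∧ W i j < mv j then W i j else mv j) :
    IsSearch N r W mr mc (Function.update vis c (t + 1)) par' mv' (max b (mv c)) (t + 1) := by
  obtain ⟨hiN, hmi⟩ := hm.col c hc (by simp) i hi
  have htree : ∀ i', InTree N r mr (Function.update vis c (t + 1)) i' ↔
      InTree N r mr vis i' ∨ i' = i := by
    intro i'
    constructor
    · rintro ⟨h1, h2 | ⟨d, hd, hvd, hmd⟩⟩
      · exact .inl ⟨h1, .inl h2⟩
      · by_cases hdc : d = c
        · subst hdc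
          have := (hm.row i' h1 d hmd).2.2.1
          exact .inr (by omega)
        · exact .inl ⟨h1, .inr ⟨d, hd, by simpa [hdc] using hvd, hmd⟩⟩
    · rintro (⟨h1, h2 | ⟨d, hd, hvd, hmd⟩⟩ | rfl)
      · exact ⟨h1, .inl h2⟩
      · have hdc : d ≠ c := by rintro rfl; exact hvd hvc
        exact ⟨h1, .inr ⟨d, hd, by simpa [hdc] using hvd, hmd⟩⟩
      · exact ⟨hiN, .inr ⟨c, hc, by simp, hmi⟩⟩
  refine ⟨fun c' hc' hv => ?_, fun c' hc' hv => ?_, h.lowerBound hm hr hmin, ?_, fun c' hc' => ?_,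
    fun c' hc' hv => ?_⟩
  · rw [hpar c' hc', if_neg (fun h => hv h.1)]
    exact h.visit_tree hc hvc c' hc' hv
  · have hcc : c' ≠ c := by rintro rfl; simp at hv
    have hv' : vis c' = 0 := by simpa [hcc] using hv
    obtain ⟨h1, h2, h3⟩ := h.front c' hc' hv'
    rw [hpar c' hc', hmv c' hc', hv]
    simp only [true_and, htree]
    split_ifs with hlt
    · refine ⟨.inr rfl, rfl, ?_⟩
      rintro i' (hi' | rfl)
      · exact hlt.le.trans (h3 i' hi')
      · exact le_rfl
    · refine ⟨.inl h1, h2, ?_⟩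
      rintro i' (hi' | rfl)
      · exact h3 i' hi'
      · exact not_lt.1 hlt
  · have : (Finset.range N).filter (fun d => Function.update vis c (t + 1) d ≠ 0) =
        insert c ((Finset.range N).filter fun d => vis d ≠ 0) := by
      ext d
      by_cases hdc : d = c
      · simp [hdc, hc]
      · simp [hdc]
    rw [this, Finset.card_insert_of_notMem (by simp [hvc]), h.card]
  · by_cases hcc : c' = c
    · simp [hcc]
    · simpa [hcc] using (h.le c' hc').trans (Nat.le_succ t)
  · by_cases hcc : c' = c
    · rw [hcc, hi]; omega
    · exact h.matched c' hc' (by simpa [hcc] using hv)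

theorem IsSearch.exists_unvisited (h : IsSearch N r W mr mc vis par mv b t) (ht : t < N) :
    ∃ c < N, vis c = 0 := by
  by_contra! hcon
  have : ((Finset.range N).filter fun c => vis c ≠ 0) = Finset.range N :=
    Finset.filter_true_of_mem fun c hc => hcon c (Finset.mem_range.1 hc)
  have h1 := h.card
  rw [this, Finset.card_range] at h1
  omega

/-- The partners of the visited columns are distinct rows below `r`, so a search that has met
matched columns only cannot have visited `N` of them. -/
theorem IsSearch.lt (h : IsSearch N r W mr mc vis par mv b t)
    (hm : IsMatching N r W none mr mc b) (hr : r < N) : t < N := by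
  have hrow : ∀ c ∈ (Finset.range N).filter fun c => vis c ≠ 0,
      mc c - 1 < r ∧ mc c - 1 + 1 = mc c ∧ mr (mc c - 1) = c + 1 := by
    intro c hc
    rw [Finset.mem_filter, Finset.mem_range] at hc
    have h1 := h.matched c hc.1 hc.2
    obtain ⟨h2, h3⟩ := hm.col c hc.1 (by simp) (mc c - 1) (by omega)
    exact ⟨(hm.ne_zero_iff _ h2).1 (by omega), by omega, h3⟩
  have h1 : ((Finset.range N).filter fun c => vis c ≠ 0).card ≤ (Finset.range r).card := by
    refine Finset.card_le_card_of_injOn (fun c => mc c - 1) (fun c hc => ?_) ?_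
    · exact Finset.mem_coe.2 (Finset.mem_range.2 (hrow c hc).1)
    · intro c hc c' hc' hcc
      have h2 := (hrow c hc).2.2
      simp only at hcc
      rw [hcc, (hrow c' hc').2.2] at h2
      omega
  rw [h.card, Finset.card_range] at h1
  omega

/-- The state of the augmentation along the path to the free column `c`. -/
structure IsAugmentation (N r : ℕ) (W : ℕ → ℕ → ℝ) (mr₀ vis par : ℕ → ℕ) (b : ℝ)
    (mr mc : ℕ → ℕ) (c : ℕ) : Prop where
  matching : IsMatching N r W (some c) mr mc b
  lt : c < N
  vis_ne : vis c ≠ 0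
  old : ∀ i < N, ∀ c', mr₀ i = c' + 1 → vis c' < vis c → mr i = c' + 1

theorem IsMatching.isAugmentation (h : IsMatching N r W none mr mc b) (hc : c < N)
    (hmc : mc c = 0) (hv : vis c ≠ 0) : IsAugmentation N r W mr vis par b mr mc c where
  matching :=
    { ne_zero_iff := h.ne_zero_iff
      row := fun i hi d hd => by
        obtain ⟨h1, -, h3, h4⟩ := h.row i hi d hd
        refine ⟨h1, ?_, h3, h4⟩
        rintro ⟨rfl⟩
        omega
      col := fun d hd _ => h.col d hd (by simp) }
  lt := hc
  vis_ne := hv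
  old := fun _ _ _ h _ => h

variable {mr₀ : ℕ → ℕ}

/-- An unmatched predecessor must be the root `r`: any other predecessor still has its old partner,
by the field `old`. -/
theorem IsAugmentation.finish (h : IsAugmentation N r W mr₀ vis par b mr mc c) (hr : r < N)
    (ht : IsTree N r W mr₀ vis par b) (h0 : mr (par c) = 0) :
    IsMatching N (r + 1) W none (Function.update mr (par c) (c + 1))
      (Function.update mc c (par c + 1)) b := by
  obtain ⟨h1, h2, h3⟩ := ht c h.lt h.vis_ne
  have hp : par c = r := by
    refine h3.resolve_right ?_
    rintro ⟨c', hc', -, hlt, hm⟩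
    have := h.old _ h1 c' hm hlt
    omega
  rw [hp] at h1 h2 h0 ⊢
  have hc := h.matching
  refine ⟨fun i hi => ?_, fun i hi d hd => ?_, fun d hd _ i hi => ?_⟩
  · by_cases hir : i = r
    · simp [hir]
    · have := hc.ne_zero_iff i hi
      rw [Function.update_of_ne hir, this]; omega
  · by_cases hir : i = r
    · subst hir
      rw [Function.update_self] at hd
      obtain rfl : c = d := by omega
      exact ⟨h.lt, by simp, by simp, h2⟩
    · rw [Function.update_of_ne hir] at hd
      obtain ⟨h4, h5, h6, h7⟩ := hc.row i hi d hd
      have hdc : d ≠ c := by rintro rfl; exact h5 rfl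
      exact ⟨h4, by simp, by simpa [hdc] using h6, h7⟩
  · by_cases hdc : d = c
    · subst hdc
      rw [Function.update_self] at hi
      obtain rfl : r = i := by omega
      exact ⟨hr, by simp⟩
    · rw [Function.update_of_ne hdc] at hi
      obtain ⟨h4, h5⟩ := hc.col d hd (by simpa [eq_comm] using hdc) i hi
      have hir : i ≠ r := by rintro rfl; omega
      exact ⟨h4, by simpa [hir] using h5⟩

/-- The hole moves to the former column of the predecessor row, which has a smaller time stamp. Rows
closer to the root are still untouched, and the decreasing stamps bound the length of the path. -/
theorem IsAugmentation.step (h : IsAugmentation N r W mr₀ vis par b mr mc c)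
    (ht : IsTree N r W mr₀ vis par b) {d : ℕ} (hd : mr (par c) = d + 1) :
    IsAugmentation N r W mr₀ vis par b (Function.update mr (par c) (c + 1))
      (Function.update mc c (par c + 1)) d ∧ vis d < vis c := by
  obtain ⟨h1, h2, h3⟩ := ht c h.lt h.vis_ne
  have hc := h.matching
  have hp : par c < r := (hc.ne_zero_iff _ h1).1 (by omega)
  obtain ⟨c', hc', hv', hlt, hm⟩ := h3.resolve_left (by omega)
  obtain rfl : c' = d := by
    have := h.old _ h1 c' hm hlt
    omega
  have hne : c' ≠ c := by rintro rfl; omega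
  obtain ⟨-, -, h5, -⟩ := hc.row _ h1 c' hd
  refine ⟨⟨⟨fun i hi => ?_, fun i hi e he => ?_, fun e he hce i hi => ?_⟩, hc', hv',
    fun i hi e he hlt' => ?_⟩, hlt⟩
  · by_cases hir : i = par c
    · simp [hir, hp]
    · rw [Function.update_of_ne hir]; exact hc.ne_zero_iff i hi
  · by_cases hir : i = par c
    · subst hir
      rw [Function.update_self] at he
      obtain rfl : c = e := by omega
      exact ⟨h.lt, by simpa using hne, by simp, h2⟩
    · rw [Function.update_of_ne hir] at he
      obtain ⟨h6, h7, h8, h9⟩ := hc.row i hi e he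
      have hec : e ≠ c := by rintro rfl; exact h7 rfl
      refine ⟨h6, ?_, by simpa [hec] using h8, h9⟩
      rintro ⟨rfl⟩
      exact hir (by omega)
  · by_cases hec : e = c
    · subst hec
      rw [Function.update_self] at hi
      obtain rfl : par e = i := by omega
      exact ⟨h1, by simp⟩
    · rw [Function.update_of_ne hec] at hi
      obtain ⟨h6, h7⟩ := hc.col e he (by simpa [eq_comm] using hec) i hi
      have hir : i ≠ par c := by
        rintro rfl
        exact hce (by congr 1; omega)
      exact ⟨h6, by simpa [hir] using h7⟩
  · have hir : i ≠ par c := by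
      rintro rfl
      have : e = c' := by omega
      subst this
      exact lt_irrefl _ hlt'
    rw [Function.update_of_ne hir]
    exact h.old i hi e he (hlt'.trans hlt)

theorem IsMatching.exists_perm (h : IsMatching N N W none mr mc b) :
    ∃ π : Equiv.Perm (Fin N), ∀ i : Fin N, W i (π i) ≤ b := by
  have h1 : ∀ i : Fin N, ∃ c : Fin N, mr i = c + 1 := by
    intro i
    obtain ⟨k, hk⟩ := Nat.exists_eq_succ_of_ne_zero ((h.ne_zero_iff i i.2).2 i.2)
    exact ⟨⟨k, (h.row i i.2 k hk).1⟩, hk⟩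
  choose g hg using h1
  have hinj : Function.Injective g := by
    intro i j hij
    have h2 := (h.row i i.2 _ (hg i)).2.2.1
    have h3 := (h.row j j.2 _ (hg j)).2.2.1
    rw [hij] at h2
    exact Fin.ext (by omega)
  exact ⟨Equiv.ofBijective g (Finite.injective_iff_bijective.1 hinj),
    fun i => (h.row i i.2 _ (hg i)).2.2.2⟩

end

/-! ### Implementation of the bottleneck assignment -/

theorem Store.setNat_nat_row (s : Store) (a i j v : ℕ) :
    (s.setNat a i j v).nat a i = Function.update (s.nat a i) j v := by
  funext k
  by_cases h : k = j <;> simp [h]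

/-- Raise entry `(0, 0)` of the real array `a` to the value of `e`. -/
def maxProg (a : ℕ) (e : RealExpr) : FProg :=
  .cond (.realLt (.get a 0 0) e) (.setR a 0 0 e) .skip

@[simp] theorem maxProg_nat (a : ℕ) (e : RealExpr) (s : Store) :
    ((maxProg a e).run s).nat = s.nat := by
  simp only [maxProg, run_cond]
  split_ifs <;> rfl

@[simp] theorem maxProg_real (a : ℕ) (e : RealExpr) (s : Store) :
    ((maxProg a e).run s).real a 0 0 = max (s.real a 0 0) (e.eval s) := by
  simp only [maxProg, run_cond, Test.holds_realLt, RealExpr.eval_get, NatExpr.eval_ofNat]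
  split_ifs with h
  · simp [h.le]
  · simp [not_lt.1 h]

theorem maxProg_real_ne {a a' : ℕ} (h : a' ≠ a) (e : RealExpr) (s : Store) :
    ((maxProg a e).run s).real a' = s.real a' := by
  simp only [maxProg, run_cond]
  split_ifs <;> simp [h]

/-- Start the search for the row in register `40`. -/
def initSearchProg : FProg :=
  .rep 42 (.setN 32 0 (reg 42) 0 ;; .setN 33 0 (reg 42) (reg 40) ;;
    .setR 33 0 (reg 42) (.get 23 (reg 40) (reg 42)))

/-- Register `54` receives an unvisited column with minimal front weight. -/
def selectProg : FProg :=
  .setN 54 0 0 (reg 5) ;;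
  .rep 42 (.cond (.and (.natEq (.get 32 0 (reg 42)) 0)
      (.not (.and (.not (.natEq (reg 54) (reg 5)))
        (.not (.realLt (.get 33 0 (reg 42)) (.get 33 0 (reg 54)))))))
    (.setN 54 0 0 (reg 42)) .skip)

/-- Update the front weights by the edges from the row in register `55`. -/
def relaxProg : FProg :=
  .rep 42 (.cond (.and (.natEq (.get 32 0 (reg 42)) 0)
      (.realLt (.get 23 (reg 55) (reg 42)) (.get 33 0 (reg 42))))
    (.setR 33 0 (reg 42) (.get 23 (reg 55) (reg 42)) ;; .setN 33 0 (reg 42) (reg 55)) .skip)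

/-- Visit one column. Register `53` becomes `1` if the column in register `54` is free. -/
def visitProg : FProg :=
  .cond (.natEq (reg 53) 0)
    (selectProg ;;
      maxProg 30 (.get 33 0 (reg 54)) ;;
      .setN 32 0 (reg 54) (reg 41 + 1) ;;
      .cond (.natEq (.get 30 0 (reg 54)) 0) (.setN 53 0 0 1)
        (.setN 55 0 0 (.get 30 0 (reg 54) - 1) ;; relaxProg))
    .skip

/-- One step of the augmentation, if register `57` is `1`. -/
def augmentProg : FProg :=
  .cond (.natEq (reg 57) 1)
    (.setN 55 0 0 (.get 33 0 (reg 54)) ;; .setN 56 0 0 (.get 31 0 (reg 55)) ;;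
      .setN 30 0 (reg 54) (reg 55 + 1) ;; .setN 31 0 (reg 55) (reg 54 + 1) ;;
      .cond (.natEq (reg 56) 0) (.setN 57 0 0 0) (.setN 54 0 0 (reg 56 - 1)))
    .skip

/-- Match the row in register `40`. -/
def matchRowProg : FProg :=
  initSearchProg ;; .setN 53 0 0 0 ;; .rep 41 visitProg ;; .setN 57 0 0 1 ;; .rep 41 augmentProg

/-- Bottleneck assignment for the weights in real array `23`; entry `(0, 0)` of real array `30`
receives the bottleneck weight. -/
def matchProg : FProg :=
  .setR 30 0 0 0 ;; .rep 40 (.setN 30 0 (reg 40) 0 ;; .setN 31 0 (reg 40) 0) ;;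
  .rep 40 matchRowProg

theorem initSearchProg_run (s : Store) : ∀ c < s.nat 5 0 0,
    (initSearchProg.run s).nat 32 0 c = 0 ∧ (initSearchProg.run s).nat 33 0 c = s.nat 40 0 0 ∧
      (initSearchProg.run s).real 33 0 c = s.real 23 (s.nat 40 0 0) c := by
  refine run_rep_induct initSearchProg rfl s (fun k s' => ∀ c < k, s'.nat 32 0 c = 0 ∧
    s'.nat 33 0 c = s.nat 40 0 0 ∧ s'.real 33 0 c = s.real 23 (s.nat 40 0 0) c)
    (fun _ _ _ h => h) (by simp) ?_
  intro k hk s' ih hv hf c hc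
  by_cases hck : c = k
  · simp [hck, hv, hf.nat 40 rfl, hf.real 23 rfl]
  · simp [hck, hv, ih c (by omega)]

theorem selectProg_run (s : Store) {N : ℕ} (hN : s.nat 5 0 0 = N) (h : ∃ c < N, s.nat 32 0 c = 0) :
    ∃ c < N, (selectProg.run s).nat 54 0 0 = c ∧ s.nat 32 0 c = 0 ∧
      ∀ c' < N, s.nat 32 0 c' = 0 → s.real 33 0 c ≤ s.real 33 0 c' := by
  rw [selectProg, run_seq]
  set P : FProg := .rep 42 (.cond (.and (.natEq (.get 32 0 (reg 42)) 0)
      (.not (.and (.not (.natEq (reg 54) (reg 5)))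
        (.not (.realLt (.get 33 0 (reg 42)) (.get 33 0 (reg 54)))))))
    (.setN 54 0 0 (reg 42)) .skip) with hP
  -- The value `N` in register `54` is a sentinel: no unvisited column has been seen so far.
  have key := run_rep_induct P rfl ((FProg.setN 54 0 0 (reg 5)).run s) (fun k s' =>
    (s'.nat 54 0 0 = N ∧ ∀ c < k, s.nat 32 0 c ≠ 0) ∨
    (s'.nat 54 0 0 < N ∧ s.nat 32 0 (s'.nat 54 0 0) = 0 ∧
      ∀ c' < k, s.nat 32 0 c' = 0 → s.real 33 0 (s'.nat 54 0 0) ≤ s.real 33 0 c'))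
    (fun _ _ _ h => h) (.inl (by simp [hN])) ?_
  · have h5 : ((FProg.setN 54 0 0 (reg 5)).run s).nat 5 0 0 = N := by simp [hN]
    rw [h5] at key
    rcases key with ⟨-, h1⟩ | ⟨h1, h2, h3⟩
    · obtain ⟨c, hc, hc0⟩ := h
      exact absurd hc0 (h1 c hc)
    · exact ⟨_, h1, rfl, h2, h3⟩
  · intro k hk s' ih hv hf
    have hk' : k < N := by simpa [hN] using hk
    have e1 : s'.nat 32 = s.nat 32 := by rw [hf.nat 32 rfl]; simp
    have e2 : s'.real 33 = s.real 33 := by rw [hf.real 33 rfl]; simp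
    have e3 : s'.nat 5 0 0 = N := by rw [hf.nat 5 rfl]; simp [hN]
    simp only [run_cond, Test.holds_and, Test.holds_natEq, Test.holds_not, Test.holds_realLt,
      NatExpr.eval_get, NatExpr.eval_ofNat, RealExpr.eval_get, hv, e1, e2, e3, run_setN, run_skip]
    by_cases h0 : s.nat 32 0 k = 0
    swap
    · rw [if_neg (fun h => h0 h.1)]
      refine ih.imp (fun h => ⟨h.1, fun c hc => ?_⟩) (fun h => ⟨h.1, h.2.1, fun c hc h' => ?_⟩)
      · rcases Nat.lt_succ_iff_lt_or_eq.1 hc with hc | rfl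
        exacts [h.2 c hc, h0]
      · rcases Nat.lt_succ_iff_lt_or_eq.1 hc with hc | rfl
        exacts [h.2.2 c hc h', absurd h' h0]
    right
    rcases ih with ⟨h1, h2⟩ | ⟨h1, h2, h3⟩
    · rw [if_pos ⟨h0, by simp [h1]⟩]
      simp only [Store.setNat_nat_self, and_self, if_true]
      refine ⟨hk', h0, fun c hc hc0 => ?_⟩
      rcases Nat.lt_succ_iff_lt_or_eq.1 hc with hc | rfl
      exacts [absurd hc0 (h2 c hc), le_rfl]
    · by_cases hlt : s.real 33 0 k < s.real 33 0 (s'.nat 54 0 0)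
      · rw [if_pos ⟨h0, by simp [hlt]⟩]
        simp only [Store.setNat_nat_self, and_self, if_true]
        refine ⟨hk', h0, fun c hc hc0 => ?_⟩
        rcases Nat.lt_succ_iff_lt_or_eq.1 hc with hc | rfl
        exacts [hlt.le.trans (h3 c hc hc0), le_rfl]
      · rw [if_neg (fun h => h.2 ⟨h1.ne, hlt⟩)]
        refine ⟨h1, h2, fun c hc hc0 => ?_⟩
        rcases Nat.lt_succ_iff_lt_or_eq.1 hc with hc | rfl
        exacts [h3 c hc hc0, not_lt.1 hlt]

theorem relaxProg_run (s : Store) {i : ℕ} (hi : s.nat 55 0 0 = i) : ∀ j < s.nat 5 0 0,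
    (relaxProg.run s).nat 33 0 j =
      (if s.nat 32 0 j = 0 ∧ s.real 23 i j < s.real 33 0 j then i else s.nat 33 0 j) ∧
    (relaxProg.run s).real 33 0 j =
      (if s.nat 32 0 j = 0 ∧ s.real 23 i j < s.real 33 0 j then s.real 23 i j
        else s.real 33 0 j) := by
  -- The claim for all `j` also says that entries the loop has not reached are unchanged, which the
  -- induction needs when it reads entry `k`.
  suffices h : ∀ j, (relaxProg.run s).nat 33 0 j =
      (if j < s.nat 5 0 0 ∧ s.nat 32 0 j = 0 ∧ s.real 23 i j < s.real 33 0 j then i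
        else s.nat 33 0 j) ∧ (relaxProg.run s).real 33 0 j =
      (if j < s.nat 5 0 0 ∧ s.nat 32 0 j = 0 ∧ s.real 23 i j < s.real 33 0 j then s.real 23 i j
        else s.real 33 0 j) by
    intro j hj; simpa [hj] using h j
  refine run_rep_induct relaxProg rfl s (fun k s' => ∀ j, s'.nat 33 0 j =
      (if j < k ∧ s.nat 32 0 j = 0 ∧ s.real 23 i j < s.real 33 0 j then i
        else s.nat 33 0 j) ∧ s'.real 33 0 j =
      (if j < k ∧ s.nat 32 0 j = 0 ∧ s.real 23 i j < s.real 33 0 j then s.real 23 i j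
        else s.real 33 0 j)) (fun _ _ _ h => h) (by simp) ?_
  intro k hk s' ih hv hf j
  have h1 := (ih k).2
  rw [if_neg (by simp)] at h1
  simp only [run_cond, Test.holds_and, Test.holds_natEq, Test.holds_realLt, NatExpr.eval_get,
    NatExpr.eval_ofNat, RealExpr.eval_get, hv, hf.nat 32 rfl, hf.real 23 rfl, hf.nat 55 rfl, hi, h1,
    run_seq, run_setN, run_setR, run_skip, Store.setReal_nat]
  by_cases hjk : j = k
  · subst hjk
    split_ifs with h2 <;> simp_all
  · have h3 : j < k + 1 ↔ j < k := by omega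
    simp only [h3]
    split_ifs with h2 h4 h4 <;> simp_all

/-- The state of the search for row `r` in memory. -/
def SearchMem (N r : ℕ) (W : ℕ → ℕ → ℝ) (mr mc : ℕ → ℕ) (t : ℕ) (s : Store) : Prop :=
  (s.nat 53 0 0 = 0 ∧
    IsSearch N r W mr mc (s.nat 32 0) (s.nat 33 0) (s.real 33 0) (s.real 30 0 0) t ∧
    IsMatching N r W none mr mc (s.real 30 0 0)) ∨
  (s.nat 53 0 0 = 1 ∧ IsTree N r W mr (s.nat 32 0) (s.nat 33 0) (s.real 30 0 0) ∧
    IsLowerBound N W (s.real 30 0 0) ∧ IsMatching N r W none mr mc (s.real 30 0 0) ∧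
    s.nat 54 0 0 < N ∧ s.nat 32 0 (s.nat 54 0 0) ≠ 0 ∧ s.nat 32 0 (s.nat 54 0 0) ≤ N ∧
    mc (s.nat 54 0 0) = 0)

/-- The threshold is raised to the least front weight, which remains a lower bound for every
assignment by `IsSearch.lowerBound`. Once a free column is found, the remaining iterations idle. -/
theorem visitProg_run (s : Store) {N r t : ℕ} {W : ℕ → ℕ → ℝ} {mr mc : ℕ → ℕ}
    (hN : s.nat 5 0 0 = N) (hr : r < N) (ht : s.nat 41 0 0 = t) (htN : t < N)
    (hW : s.real 23 = W) (hmc : s.nat 30 0 = mc) (h : SearchMem N r W mr mc t s) :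
    SearchMem N r W mr mc (t + 1) (visitProg.run s) := by
  rcases h with ⟨h0, hs, hm⟩ | h
  swap
  · have : visitProg.run s = s := by simp [visitProg, h.1]
    rw [this]; exact .inr h
  obtain ⟨c, hc, hc1, hc2, hc3⟩ := selectProg_run s hN (hs.exists_unvisited htN)
  simp only [visitProg, run_cond, Test.holds_natEq, NatExpr.eval_get, NatExpr.eval_ofNat, h0, if_true,
    run_seq]
  set s₁ := selectProg.run s with hs₁
  have e5 : s₁.nat 5 0 0 = N := by rw [run_nat 5 rfl, hN]
  have e32 : s₁.nat 32 = s.nat 32 := run_nat 32 rfl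
  have e33 : s₁.nat 33 = s.nat 33 := run_nat 33 rfl
  have e33' : s₁.real 33 = s.real 33 := run_real 33 rfl
  have e30 : s₁.real 30 = s.real 30 := run_real 30 rfl
  have e30' : s₁.nat 30 = s.nat 30 := run_nat 30 rfl
  have e23 : s₁.real 23 = s.real 23 := run_real 23 rfl
  have e41 : s₁.nat 41 = s.nat 41 := run_nat 41 rfl
  have e53 : s₁.nat 53 = s.nat 53 := run_nat 53 rfl
  rw [← e32, ← e33', ← e30, ← e33] at hs
  rw [← e30] at hm
  rw [← e32] at hc2 hc3
  rw [← e33'] at hc3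
  rw [← e41] at ht
  rw [← e53] at h0
  rw [← e30'] at hmc
  rw [← e23] at hW
  clear_value s₁
  have hb := maxProg_real 30 (.get 33 0 (reg 54)) s₁
  simp only [RealExpr.eval_get, NatExpr.eval_get, NatExpr.eval_ofNat, hc1] at hb
  have f5 := maxProg_nat 30 (.get 33 0 (reg 54)) s₁
  have f33 := maxProg_real_ne (by decide : 33 ≠ 30) (.get 33 0 (reg 54)) s₁
  have f23 := maxProg_real_ne (by decide : 23 ≠ 30) (.get 33 0 (reg 54)) s₁
  generalize (maxProg 30 (.get 33 0 (reg 54))).run s₁ = s₂ at hb f5 f33 f23 ⊢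
  simp only [NatExpr.eval_get, NatExpr.eval_ofNat, run_setN,
    NatExpr.eval_add, f5, ht, hc1, NatExpr.eval_sub, ne_eq, Nat.reduceEqDiff,
    not_false_eq_true, Store.setNat_nat_ne, hmc]
  have hm' := hm.mono (le_max_left _ (s₁.real 33 0 c))
  by_cases hfree : mc c = 0
  · rw [if_pos hfree]
    right
    simp only [Store.setNat_nat_self, Store.setNat_real, ne_eq, Nat.reduceEqDiff, and_self,
      not_false_eq_true, Store.setNat_nat_ne, Store.setNat_nat_row, f5, hc1, hb, if_true]
    refine ⟨trivial, hs.visit_tree hc hc2, hs.lowerBound hm hr hc3, hm', hc, by simp, by simpa,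
      hfree⟩
  · rw [if_neg hfree]
    left
    obtain ⟨i, hi⟩ := Nat.exists_eq_succ_of_ne_zero hfree
    set s₃ := (s₂.setNat 32 0 c (t + 1)).setNat 55 0 0 (mc c - 1) with hs₃
    have hi' : s₃.nat 55 0 0 = i := by simp [hs₃, hi]
    have g32 : s₃.nat 32 0 = Function.update (s₁.nat 32 0) c (t + 1) := by
      simp [hs₃, Store.setNat_nat_row, f5]
    have g23 : s₃.real 23 = W := by simp [hs₃, f23, hW]
    have g33 : s₃.real 33 = s₁.real 33 := by simp [hs₃, f33]
    have g33' : s₃.nat 33 = s₁.nat 33 := by simp [hs₃, f5]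
    have hrel := relaxProg_run s₃ hi'
    have g5 : s₃.nat 5 0 0 = N := by simp [hs₃, f5, e5]
    have g30 : s₃.real 30 = s₂.real 30 := by simp [hs₃]
    have g53 : s₃.nat 53 0 0 = 0 := by simp [hs₃, f5, h0]
    rw [g5, g32, g23, g33, g33'] at hrel
    rw [run_nat 53 rfl, run_nat 32 rfl, run_real 30 rfl, g30, hb, g32]
    exact ⟨g53, hs.visit hm hr hc hc2 hc3 hi (fun j hj => (hrel j hj).1)
      (fun j hj => (hrel j hj).2), hm'⟩

/-- The state of the augmentation in memory. -/
def AugmentMem (N r : ℕ) (W : ℕ → ℕ → ℝ) (mr₀ : ℕ → ℕ) (t : ℕ) (s : Store) : Prop :=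
  (s.nat 57 0 0 = 0 ∧ IsMatching N (r + 1) W none (s.nat 31 0) (s.nat 30 0) (s.real 30 0 0)) ∨
  (s.nat 57 0 0 = 1 ∧ IsAugmentation N r W mr₀ (s.nat 32 0) (s.nat 33 0) (s.real 30 0 0)
    (s.nat 31 0) (s.nat 30 0) (s.nat 54 0 0) ∧ s.nat 32 0 (s.nat 54 0 0) + t ≤ N)

theorem augmentProg_run (s : Store) {N r t : ℕ} {W : ℕ → ℕ → ℝ} {mr₀ : ℕ → ℕ} (hr : r < N)
    (htree : IsTree N r W mr₀ (s.nat 32 0) (s.nat 33 0) (s.real 30 0 0))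
    (h : AugmentMem N r W mr₀ t s) : AugmentMem N r W mr₀ (t + 1) (augmentProg.run s) := by
  rcases h with h | ⟨h0, ha, ht⟩
  · have : augmentProg.run s = s := by simp [augmentProg, h.1]
    rw [this]; exact .inl h
  simp only [augmentProg, run_cond, Test.holds_natEq, NatExpr.eval_get, NatExpr.eval_ofNat, h0,
    if_true, run_seq, run_setN, NatExpr.eval_add, NatExpr.eval_sub, ne_eq, Nat.reduceEqDiff,
    not_false_eq_true, Store.setNat_nat_ne, Store.setNat_nat_self, and_self]
  by_cases hold : s.nat 31 0 (s.nat 33 0 (s.nat 54 0 0)) = 0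
  · rw [if_pos hold]
    left
    simpa [Store.setNat_nat_row] using ha.finish hr htree hold
  · rw [if_neg hold]
    right
    obtain ⟨d, hd⟩ := Nat.exists_eq_succ_of_ne_zero hold
    obtain ⟨h1, h2⟩ := ha.step htree hd
    simp only [Store.setNat_real, ne_eq, Nat.reduceEqDiff, not_false_eq_true, Store.setNat_nat_ne,
      h0, Store.setNat_nat_row, hd, Nat.succ_eq_add_one, Nat.add_sub_cancel, Function.update_self]
    exact ⟨trivial, h1, by omega⟩

theorem matchRowProg_run (s : Store) {N r : ℕ} {W : ℕ → ℕ → ℝ} (hN : s.nat 5 0 0 = N) (hr : r < N)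
    (hr' : s.nat 40 0 0 = r) (hW : s.real 23 = W)
    (hm : IsMatching N r W none (s.nat 31 0) (s.nat 30 0) (s.real 30 0 0))
    (hb : IsLowerBound N W (s.real 30 0 0)) :
    IsMatching N (r + 1) W none ((matchRowProg.run s).nat 31 0) ((matchRowProg.run s).nat 30 0)
      ((matchRowProg.run s).real 30 0 0) ∧ IsLowerBound N W ((matchRowProg.run s).real 30 0 0) := by
  simp only [matchRowProg, run_seq]
  have hinit := initSearchProg_run s
  set s₁ := (FProg.setN 53 0 0 0).run (initSearchProg.run s) with hs₁
  rw [hr', hN, hW] at hinit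
  have e5 : s₁.nat 5 0 0 = N := by rw [hs₁, run_nat 5 rfl, run_nat 5 rfl, hN]
  have e31 : s₁.nat 31 = s.nat 31 := by rw [hs₁, run_nat 31 rfl, run_nat 31 rfl]
  have e30 : s₁.nat 30 = s.nat 30 := by rw [hs₁, run_nat 30 rfl, run_nat 30 rfl]
  have e30' : s₁.real 30 = s.real 30 := by rw [hs₁, run_real 30 rfl, run_real 30 rfl]
  have e23 : s₁.real 23 = W := by rw [hs₁, run_real 23 rfl, run_real 23 rfl, hW]
  have e53 : s₁.nat 53 0 0 = 0 := by simp [hs₁]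
  have hinit' : ∀ c < N, s₁.nat 32 0 c = 0 ∧ s₁.nat 33 0 c = r ∧ s₁.real 33 0 c = W r c := by
    intro c hc
    rw [hs₁, run_nat 32 rfl, run_nat 33 rfl, run_real 33 rfl]; exact hinit c hc
  clear_value s₁
  rw [← e30', ← e31, ← e30] at hm
  rw [← e30'] at hb
  have hsearch : SearchMem N r W (s.nat 31 0) (s.nat 30 0) 0 s₁ := by
    rw [← e31, ← e30]
    refine .inl ⟨e53, ⟨fun c hc hv => absurd (hinit' c hc).1 hv, fun c hc _ => ?_, hb, ?_,
      fun c hc => (hinit' c hc).1.le, fun c hc hv => absurd (hinit' c hc).1 hv⟩, hm⟩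
    · rw [(hinit' c hc).2.1, (hinit' c hc).2.2]
      refine ⟨⟨hr, .inl rfl⟩, rfl, ?_⟩
      rintro i ⟨-, rfl | ⟨d, hd, hvd, -⟩⟩
      · exact le_rfl
      · exact absurd (hinit' d hd).1 hvd
    · rw [Finset.card_eq_zero, Finset.filter_eq_empty_iff]
      intro c hc
      simp [(hinit' c (Finset.mem_range.1 hc)).1]
  have key := run_rep_induct (.rep 41 visitProg) rfl s₁
    (fun t s' => SearchMem N r W (s.nat 31 0) (s.nat 30 0) t s') (fun _ _ _ h => h) hsearch
    (fun t ht s' hs' hv hf => visitProg_run s' (by rw [hf.nat 5 rfl, e5]) hr hv (by omega)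
      (by rw [hf.real 23 rfl, e23]) (by rw [hf.nat 30 rfl, e30]) hs')
  have f5 : ((FProg.rep 41 visitProg).run s₁).nat 5 0 0 = N := by rw [run_nat 5 rfl, e5]
  have f31 : ((FProg.rep 41 visitProg).run s₁).nat 31 = s.nat 31 := by rw [run_nat 31 rfl, e31]
  have f30 : ((FProg.rep 41 visitProg).run s₁).nat 30 = s.nat 30 := by rw [run_nat 30 rfl, e30]
  generalize (FProg.rep 41 visitProg).run s₁ = s₂ at key f5 f31 f30
  rw [e5] at key
  rcases key with ⟨-, h1, h2⟩ | ⟨-, htree, hlow, hm2, hc, hv, hvN, hmc⟩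
  -- The search cannot have used up all `N` iterations without meeting a free column.
  · exact absurd (h1.lt h2 hr) (lt_irrefl _)
  simp only [run_setN, NatExpr.eval_ofNat]
  set s₃ := s₂.setNat 57 0 0 1 with hs₃
  have g5 : s₃.nat 5 0 0 = N := by simp [hs₃, f5]
  have g32 : s₃.nat 32 = s₂.nat 32 := by simp [hs₃]
  have g33 : s₃.nat 33 = s₂.nat 33 := by simp [hs₃]
  have g54 : s₃.nat 54 = s₂.nat 54 := by simp [hs₃]
  have g31 : s₃.nat 31 = s.nat 31 := by simp [hs₃, f31]
  have g30 : s₃.nat 30 = s.nat 30 := by simp [hs₃, f30]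
  have g30' : s₃.real 30 = s₂.real 30 := by simp [hs₃]
  have haug : AugmentMem N r W (s.nat 31 0) 0 s₃ := by
    refine .inr ⟨by simp [hs₃], ?_, by rw [g32, g54]; simpa using hvN⟩
    rw [g32, g33, g54, g31, g30, g30']
    exact hm2.isAugmentation hc hmc hv
  have key := run_rep_induct (.rep 41 augmentProg) rfl s₃
    (fun t s' => AugmentMem N r W (s.nat 31 0) t s') (fun _ _ _ h => h) haug
    (fun t ht s' hs' hv hf => augmentProg_run s' hr (by
      rw [hf.nat 32 rfl, hf.nat 33 rfl, hf.real 30 rfl, g32, g33, g30']; exact htree) hs')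
  have g30'' : ((FProg.rep 41 augmentProg).run s₃).real 30 = s₂.real 30 := by
    rw [run_real 30 rfl, g30']
  rw [g5] at key
  rcases key with h | ⟨-, h1, h2⟩
  · exact ⟨h.2, by rw [g30'']; exact hlow⟩
  -- After `N` steps the current column would have time stamp `0`, which visited columns do not
  -- have.
  · exact absurd h1.vis_ne (by omega)

/-- The same threshold bounds the matched weights from above and the bottleneck weight of every
assignment from below. Both properties persist from row to row, so the final threshold is optimal.
-/
theorem matchProg_run (s : Store) {N : ℕ} {W : ℕ → ℕ → ℝ} (hN : s.nat 5 0 0 = N) (hN1 : 1 ≤ N)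
    (hW : s.real 23 = W) (hW0 : ∀ i < N, ∀ j < N, 0 ≤ W i j) :
    (∃ π : Equiv.Perm (Fin N), ∀ i : Fin N, W i (π i) ≤ (matchProg.run s).real 30 0 0) ∧
      IsLowerBound N W ((matchProg.run s).real 30 0 0) := by
  simp only [matchProg, run_seq]
  set P : FProg := .rep 40 (.setN 30 0 (reg 40) 0 ;; .setN 31 0 (reg 40) 0) with hP
  have hz := run_rep_induct P rfl ((FProg.setR 30 0 0 0).run s)
    (fun k s' => ∀ i < k, s'.nat 30 0 i = 0 ∧ s'.nat 31 0 i = 0) (fun _ _ _ h => h) (by simp) (by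
      intro k hk s' ih hv hf i hi
      by_cases hik : i = k
      · simp [hik, hv]
      · simp [hik, hv, ih i (by omega)])
  have e5 : (P.run ((FProg.setR 30 0 0 0).run s)).nat 5 0 0 = N := by
    rw [run_nat 5 rfl, run_nat 5 rfl, hN]
  have e23 : (P.run ((FProg.setR 30 0 0 0).run s)).real 23 = W := by
    rw [run_real 23 rfl, run_real 23 rfl, hW]
  have e30 : (P.run ((FProg.setR 30 0 0 0).run s)).real 30 0 0 = 0 := by
    rw [run_real 30 rfl]; simp
  rw [run_nat 5 rfl, hN] at hz
  generalize P.run ((FProg.setR 30 0 0 0).run s) = s₁ at hz e5 e23 e30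
  have key := run_rep_induct (.rep 40 matchRowProg) rfl s₁
    (fun r s' => IsMatching N r W none (s'.nat 31 0) (s'.nat 30 0) (s'.real 30 0 0) ∧
      IsLowerBound N W (s'.real 30 0 0)) (fun _ _ _ h => h) ?_
    (fun r hr s' hs' hv hf => matchRowProg_run s' (by rw [hf.nat 5 rfl, e5]) (by omega) hv
      (by rw [hf.real 23 rfl, e23]) hs'.1 hs'.2)
  · rw [e5] at key
    exact ⟨key.1.exists_perm, key.2⟩
  · refine ⟨⟨fun i hi => ?_, fun i hi c hc => ?_, fun c hc _ i hi => ?_⟩, fun π => ?_⟩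
    · simp [(hz i hi).2]
    · rw [(hz i hi).2] at hc; omega
    · rw [(hz c hc).1] at hi; omega
    -- The initial threshold `0` is a lower bound because weights are nonnegative and there is at
    -- least one row.
    · rw [e30]
      exact ⟨⟨0, hN1⟩, hW0 _ hN1 _ (Fin.is_lt _)⟩

/-! ## Computing the bottleneck distance -/

/-- A diagram point in memory: `k = 1` for finite points, `k = 2` for infinite points, and otherwise
there is no point. -/
def decodePoint (k : ℕ) (b d : ℝ) : Option (ℝ × WithTop ℝ) :=
  if k = 2 then some (b, ⊤) else if k = 1 then some (b, (d : WithTop ℝ)) else none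

/-- The `i`-th diagram point stored in the arrays `a`. -/
def pointAt (s : Store) (a i : ℕ) : Option (ℝ × WithTop ℝ) :=
  decodePoint (s.nat a 0 i) (s.real a 0 i) (s.real a 1 i)

/-- Entry `(0, 0)` of real array `34` receives the cost of the points `40` and `41`, and
register `58` receives `1` if the cost is infinite. -/
def pairCostProg : FProg :=
  .setR 34 0 0 0 ;; .setN 58 0 0 0 ;;
  .cond (.natEq (.get 21 0 (reg 40)) 2)
    (.cond (.natEq (.get 22 0 (reg 41)) 2)
      (maxProg 34 (.get 21 0 (reg 40) - .get 22 0 (reg 41)) ;;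
        maxProg 34 (.get 22 0 (reg 41) - .get 21 0 (reg 40)))
      (.setN 58 0 0 1))
    (.cond (.natEq (.get 22 0 (reg 41)) 2) (.setN 58 0 0 1)
      (.cond (.natEq (.get 21 0 (reg 40)) 1)
        (.cond (.natEq (.get 22 0 (reg 41)) 1)
          (maxProg 34 (.get 21 0 (reg 40) - .get 22 0 (reg 41)) ;;
            maxProg 34 (.get 22 0 (reg 41) - .get 21 0 (reg 40)) ;;
            maxProg 34 (.get 21 1 (reg 40) - .get 22 1 (reg 41)) ;;
            maxProg 34 (.get 22 1 (reg 41) - .get 21 1 (reg 40)))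
          (maxProg 34 ((.get 21 1 (reg 40) - .get 21 0 (reg 40)) / 2)))
        (.cond (.natEq (.get 22 0 (reg 41)) 1)
          (maxProg 34 ((.get 22 1 (reg 41) - .get 22 0 (reg 41)) / 2)) .skip)))

/-- Fill the entry `(40, 41)` of the cost matrix. -/
def costEntryProg : FProg :=
  pairCostProg ;; .setR 23 (reg 40) (reg 41) (.get 34 0 0) ;;
    .setN 23 (reg 40) (reg 41) (reg 58) ;;
    .cond (.natEq (reg 58) 0) (maxProg 35 (.get 34 0 0 + 1)) .skip

/-- Replace infinite costs by a number that is larger than all finite costs. -/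
def capEntryProg : FProg :=
  .cond (.natEq (.get 23 (reg 40) (reg 41)) 1) (.setR 23 (reg 40) (reg 41) (.get 35 0 0)) .skip

/-- The cost matrix of the diagrams in the arrays `21` and `22`. -/
def costProg : FProg :=
  .setR 35 0 0 0 ;; .rep 40 (.rep 41 costEntryProg) ;; .rep 40 (.rep 41 capEntryProg)

/-- The bottleneck distance of the diagrams in the arrays `21` and `22`. -/
def bottleneckProg : FProg :=
  costProg ;; matchProg ;;
    .cond (.realLt (.get 30 0 0) (.get 35 0 0)) (.setN 36 0 0 0) (.setN 36 0 0 1)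

/-- The maxima start at `0`, as `ENNReal.ofReal` truncates there; so `|x - y|` and the distance to
the diagonal come out right whatever the signs of the differences. -/
theorem pairCostProg_run (s : Store) {i j : ℕ} (hi : s.nat 40 0 0 = i) (hj : s.nat 41 0 0 = j) :
    ((pairCostProg.run s).nat 58 0 0 = 0 ∧ 0 ≤ (pairCostProg.run s).real 34 0 0 ∧
      optCost (pointAt s 21 i) (pointAt s 22 j) =
        ENNReal.ofReal ((pairCostProg.run s).real 34 0 0)) ∨
    ((pairCostProg.run s).nat 58 0 0 = 1 ∧ optCost (pointAt s 21 i) (pointAt s 22 j) = ⊤) := by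
  have habs : ∀ x y : ℝ, ENNReal.ofReal |x - y| = ENNReal.ofReal (max (max 0 (x - y)) (y - x)) := by
    intro x y
    rw [max_assoc, ← neg_sub x y, ← abs_eq_max_neg, max_eq_right (abs_nonneg _)]
  have h34 : ∀ e t, (FProg.run (maxProg 34 e) t).real 21 = t.real 21 := fun e t =>
    maxProg_real_ne (by decide) e t
  have h34' : ∀ e t, (FProg.run (maxProg 34 e) t).real 22 = t.real 22 := fun e t =>
    maxProg_real_ne (by decide) e t
  simp only [pairCostProg, run_seq, run_cond, Test.holds_natEq, NatExpr.eval_get,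
    NatExpr.eval_ofNat, run_setR, run_setN, pointAt, decodePoint, ne_eq, Nat.reduceEqDiff,
    not_false_eq_true, Store.setNat_nat_ne, Store.setReal_nat, hi, hj, run_skip]
  generalize s.nat 21 0 i = k₁
  generalize s.nat 22 0 j = k₂
  by_cases h1 : k₁ = 2
  · subst h1
    by_cases h2 : k₂ = 2
    · subst h2
      left
      simp [h34, h34', hi, hj, optCost, matchCost, deathDist, habs]
    · right
      by_cases h3 : k₂ = 1 <;> simp [h2, h3, optCost, diagonalCost, matchCost, deathDist]
  · by_cases h2 : k₂ = 2
    · subst h2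
      right
      by_cases h3 : k₁ = 1 <;> simp [h1, h3, optCost, diagonalCost, matchCost, deathDist]
    · left
      by_cases h3 : k₁ = 1 <;> by_cases h4 : k₂ = 1 <;>
        simp [h1, h2, h3, h4, h34, h34', hi, hj, optCost, diagonalCost, matchCost, deathDist]
      · simp [ENNReal.ofReal_max, habs, max_assoc]

/-- Entry `35` ends up above all finite costs and then stands in for `∞`, so that the assignment
algorithm sees real weights only. -/
theorem costProg_run (s : Store) {N : ℕ} (hN : s.nat 5 0 0 = N) :
    0 ≤ (costProg.run s).real 35 0 0 ∧ ∀ i < N, ∀ j < N,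
    ((costProg.run s).real 23 i j < (costProg.run s).real 35 0 0 ∧
      0 ≤ (costProg.run s).real 23 i j ∧ optCost (pointAt s 21 i) (pointAt s 22 j) =
        ENNReal.ofReal ((costProg.run s).real 23 i j)) ∨
    ((costProg.run s).real 23 i j = (costProg.run s).real 35 0 0 ∧
      optCost (pointAt s 21 i) (pointAt s 22 j) = ⊤) := by
  simp only [costProg, run_seq]
  set x := fun i => pointAt s 21 i with hx
  set y := fun i => pointAt s 22 i with hy
  -- In the first pass infinite costs are only flagged. The properties of entries already filled
  -- persist because entry `35` never decreases.
  let Good : Store → ℕ → ℕ → Prop := fun t i j =>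
    (t.nat 23 i j = 0 ∧ t.real 23 i j < t.real 35 0 0 ∧ 0 ≤ t.real 23 i j ∧
      optCost (x i) (y j) = ENNReal.ofReal (t.real 23 i j)) ∨
    (t.nat 23 i j = 1 ∧ optCost (x i) (y j) = ⊤)
  have step : ∀ t i j, t.nat 40 0 0 = i → t.nat 41 0 0 = j → pointAt t 21 i = x i →
      pointAt t 22 j = y j → 0 ≤ t.real 35 0 0 → 0 ≤ (costEntryProg.run t).real 35 0 0 ∧
      Good (costEntryProg.run t) i j ∧ ∀ i' j', Good t i' j' → Good (costEntryProg.run t) i' j' := by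
    intro t i j hi hj hx hy h0
    have h1 := pairCostProg_run t hi hj
    simp only [costEntryProg, run_seq]
    have e35 : (pairCostProg.run t).real 35 = t.real 35 := run_real 35 rfl
    have e23 : (pairCostProg.run t).real 23 = t.real 23 := run_real 23 rfl
    have e23' : (pairCostProg.run t).nat 23 = t.nat 23 := run_nat 23 rfl
    have e40 : (pairCostProg.run t).nat 40 0 0 = i := by rw [run_nat 40 rfl, hi]
    have e41 : (pairCostProg.run t).nat 41 0 0 = j := by rw [run_nat 41 rfl, hj]
    rw [hx, hy] at h1
    generalize pairCostProg.run t = t₁ at *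
    rcases h1 with ⟨h1, h2, h3⟩ | ⟨h1, h3⟩
    · have hm : ∀ e t, (FProg.run (maxProg 35 e) t).real 23 = t.real 23 := fun e t =>
        maxProg_real_ne (by decide) e t
      simp only [run_setR, run_setN, RealExpr.eval_get, NatExpr.eval_get, NatExpr.eval_ofNat, e40,
        e41, Store.setReal_nat, h1, run_cond, Test.holds_natEq, ne_eq, Nat.reduceEqDiff,
        not_false_eq_true, Store.setNat_nat_ne, if_true, maxProg_real, Good, maxProg_nat,
        Store.setNat_nat_self, hm, Store.setNat_real, Store.setReal_real_ne,
        Store.setReal_real_self, RealExpr.eval_add, RealExpr.eval_ofNat, e35, e23, e23', and_self]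
      refine ⟨le_max_of_le_left h0, .inl ⟨trivial, ?_, h2, h3⟩, fun i' j' h => ?_⟩
      · refine lt_max_of_lt_right ?_
        simp
      · by_cases hij : i' = i ∧ j' = j
        · obtain ⟨rfl, rfl⟩ := hij
          simp only [and_self, if_true]
          exact .inl ⟨trivial, lt_max_of_lt_right (by simp), h2, h3⟩
        · simp only [hij, if_false]
          exact h.imp_left fun h => ⟨h.1, lt_max_of_lt_left h.2.1, h.2.2⟩
    · simp only [run_setR, run_setN, RealExpr.eval_get, NatExpr.eval_get, NatExpr.eval_ofNat, e40,
        e41, Store.setReal_nat, h1, run_cond, Test.holds_natEq, ne_eq, Nat.reduceEqDiff,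
        not_false_eq_true, Store.setNat_nat_ne, one_ne_zero, if_false, run_skip, Good,
        Store.setNat_nat_self, Store.setNat_real, Store.setReal_real_ne,
        Store.setReal_real_self, e35, e23, e23', and_self, if_true]
      refine ⟨h0, .inr ⟨trivial, h3⟩, fun i' j' h => ?_⟩
      by_cases hij : i' = i ∧ j' = j
      · obtain ⟨rfl, rfl⟩ := hij
        simp [h3]
      · simp only [hij, if_false]
        exact h
  set s₀ := (FProg.setR 35 0 0 0).run s with hs₀
  have a5 : s₀.nat 5 0 0 = N := by rw [run_nat 5 rfl, hN]
  have hpt : ∀ t : Store, t.nat 21 = s.nat 21 → t.nat 22 = s.nat 22 → t.real 21 = s.real 21 →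
      t.real 22 = s.real 22 → ∀ i, pointAt t 21 i = x i ∧ pointAt t 22 i = y i := by
    intro t h1 h2 h3 h4 i
    simp only [pointAt, h1, h2, h3, h4, hx, hy, and_self]
  have pass1 := run_rep_induct (.rep 40 (.rep 41 costEntryProg)) rfl s₀ (fun k t =>
    0 ≤ t.real 35 0 0 ∧ ∀ i < k, ∀ j < N, Good t i j) (fun _ _ _ h => h) (by simp [hs₀]) (by
      intro k hk t ih hv hf
      have b5 : t.nat 5 0 0 = N := by rw [hf.nat 5 rfl, a5]
      have := run_rep_induct (.rep 41 costEntryProg) rfl t (fun l t =>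
        0 ≤ t.real 35 0 0 ∧ (∀ i < k, ∀ j < N, Good t i j) ∧ ∀ j < l, Good t k j)
        (fun _ _ _ h => h) ⟨ih.1, ih.2, by simp⟩ (by
          intro l hl t' ih' hv' hf'
          obtain ⟨h1, h2, h3⟩ := step t' k l (by rw [hf'.nat 40 rfl, hv]) hv'
            (hpt t' (by rw [hf'.nat 21 rfl, hf.nat 21 rfl, run_nat 21 rfl])
              (by rw [hf'.nat 22 rfl, hf.nat 22 rfl, run_nat 22 rfl])
              (by rw [hf'.real 21 rfl, hf.real 21 rfl, run_real 21 rfl])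
              (by rw [hf'.real 22 rfl, hf.real 22 rfl, run_real 22 rfl]) _).1
            (hpt t' (by rw [hf'.nat 21 rfl, hf.nat 21 rfl, run_nat 21 rfl])
              (by rw [hf'.nat 22 rfl, hf.nat 22 rfl, run_nat 22 rfl])
              (by rw [hf'.real 21 rfl, hf.real 21 rfl, run_real 21 rfl])
              (by rw [hf'.real 22 rfl, hf.real 22 rfl, run_real 22 rfl]) _).2 ih'.1
          refine ⟨h1, fun i hi j hj => h3 _ _ (ih'.2.1 i hi j hj), fun j hj => ?_⟩
          rcases Nat.lt_succ_iff_lt_or_eq.1 hj with hj | rfl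
          exacts [h3 _ _ (ih'.2.2 j hj), h2])
      rw [b5] at this
      refine ⟨this.1, fun i hi j hj => ?_⟩
      rcases Nat.lt_succ_iff_lt_or_eq.1 hi with hi | rfl
      exacts [this.2.1 i hi j hj, this.2.2 j hj])
  rw [a5] at pass1
  have c5 : ((FProg.rep 40 (.rep 41 costEntryProg)).run s₀).nat 5 0 0 = N := by
    rw [run_nat 5 rfl, a5]
  generalize (FProg.rep 40 (.rep 41 costEntryProg)).run s₀ = s₁ at pass1 c5
  have e35 : ((FProg.rep 40 (.rep 41 capEntryProg)).run s₁).real 35 = s₁.real 35 := run_real 35 rfl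
  have pass2 := run_rep_induct (.rep 40 (.rep 41 capEntryProg)) rfl s₁ (fun k t =>
    ∀ i j, t.real 23 i j = if (i < k ∧ j < N) ∧ s₁.nat 23 i j = 1 then s₁.real 35 0 0
      else s₁.real 23 i j) (fun _ _ _ h => h) (by simp) (by
      intro k hk t ih hv hf
      have b5 : t.nat 5 0 0 = N := by rw [hf.nat 5 rfl, c5]
      have := run_rep_induct (.rep 41 capEntryProg) rfl t (fun l t => ∀ i j, t.real 23 i j =
        if ((i < k ∧ j < N) ∨ (i = k ∧ j < l)) ∧ s₁.nat 23 i j = 1 then s₁.real 35 0 0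
          else s₁.real 23 i j) (fun _ _ _ h => h) (by simpa using ih) (by
          intro l hl t' ih' hv' hf' i j
          simp only [capEntryProg, run_cond, Test.holds_natEq, NatExpr.eval_get, NatExpr.eval_ofNat,
            hf'.nat 40 rfl, hf'.nat 23 rfl, hf.nat 23 rfl, hv, hv', run_setR, RealExpr.eval_get,
            hf'.real 35 rfl, hf.real 35 rfl, run_skip]
          by_cases hij : i = k ∧ j = l
          · obtain ⟨rfl, rfl⟩ := hij
            split_ifs with h1 h2 h2 <;> simp_all
          · have h1 : (i = k ∧ j < l + 1) ↔ (i = k ∧ j < l) := by omega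
            simp only [h1]
            rw [← ih']
            split_ifs with h2
            · simp [hij]
            · rfl)
      rw [b5] at this
      intro i j
      rw [this]
      have h1 : (i < k + 1 ∧ j < N) ↔ (i < k ∧ j < N) ∨ (i = k ∧ j < N) := by omega
      simp only [h1])
  rw [c5] at pass2
  rw [e35]
  refine ⟨pass1.1, fun i hi j hj => ?_⟩
  rw [pass2]
  rcases pass1.2 i hi j hj with ⟨h1, h2⟩ | ⟨h1, h2⟩
  · left; simpa [h1] using h2
  · right; simpa [h1, hi, hj] using h2

/-- The optimal assignment gives `≤` and the lower bound for all assignments gives `≥`. The distance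
is infinite exactly if the optimal weight reaches the stand-in for `∞`. -/
theorem bottleneckProg_run (s : Store) {N : ℕ} (hN : s.nat 5 0 0 = N) (hN1 : 1 ≤ N)
    {D₁ D₂ : Multiset (ℝ × WithTop ℝ)}
    (hD₁ : D₁ = (Finset.univ : Finset (Fin N)).val.filterMap fun i : Fin N => pointAt s 21 i)
    (hD₂ : D₂ = (Finset.univ : Finset (Fin N)).val.filterMap fun i : Fin N => pointAt s 22 i)
    (hcard : D₁.card + D₂.card ≤ N) :
    RepresentsValue ((bottleneckProg.run s).nat 36 0 0) ((bottleneckProg.run s).real 30 0 0)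
      (bottleneck D₁ D₂) := by
  subst hD₁ hD₂
  obtain ⟨hM, hc⟩ := costProg_run s hN
  simp only [bottleneckProg, run_seq]
  have e5 : (costProg.run s).nat 5 0 0 = N := by rw [run_nat 5 rfl, hN]
  generalize costProg.run s = s₁ at *
  have hpos : ∀ i < N, ∀ j < N, 0 ≤ s₁.real 23 i j := fun i hi j hj =>
    (hc i hi j hj).elim (fun h => h.2.1) fun h => h.1 ▸ hM
  obtain ⟨⟨π, hπ⟩, hlow⟩ := matchProg_run s₁ e5 hN1 rfl hpos
  have e35 : (matchProg.run s₁).real 35 = s₁.real 35 := run_real 35 rfl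
  generalize matchProg.run s₁ = s₂ at *
  rw [← e35] at hc hM
  simp only [run_cond, Test.holds_realLt, RealExpr.eval_get, NatExpr.eval_ofNat, run_setN]
  split_ifs with hlt
  · right
    simp only [Store.setNat_nat_self, and_self, if_true, Store.setNat_real, true_and]
    refine ⟨(hpos 0 hN1 _ (Fin.is_lt _)).trans (hπ ⟨0, hN1⟩), le_antisymm ?_ ?_⟩
    · refine bottleneck_le (fun i : Fin N => pointAt s 21 i) (fun i => pointAt s 22 i) π fun i => ?_
      rcases hc i i.2 (π i) (π i).2 with h | h
      · rw [h.2.2]; exact ENNReal.ofReal_le_ofReal (hπ i)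
      · exact absurd (h.1.symm.le.trans (hπ i)) hlt.not_ge
    · refine le_bottleneck (fun i : Fin N => pointAt s 21 i) (fun i => pointAt s 22 i) hcard
        fun π => ?_
      obtain ⟨i, hi⟩ := hlow π
      refine ⟨i, ?_⟩
      rcases hc i i.2 (π i) (π i).2 with h | h
      · rw [h.2.2]; exact ENNReal.ofReal_le_ofReal hi
      · rw [h.2]; exact le_top
  · left
    simp only [Store.setNat_nat_self, and_self, if_true, true_and]
    refine top_le_iff.1 (le_bottleneck (fun i : Fin N => pointAt s 21 i)
      (fun i => pointAt s 22 i) hcard fun π => ?_)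
    obtain ⟨i, hi⟩ := hlow π
    refine ⟨i, ?_⟩
    rcases hc i i.2 (π i) (π i).2 with h | h
    · exact absurd (h.1.trans_le ((not_lt.1 hlt).trans hi)) (lt_irrefl _)
    · rw [h.2]

/-! ## Computing the persistence diagram of a slice -/

/-- The memory `s` holds the bi-filtration `F` in the arrays `a`. -/
structure HasInput (s : Store) (a : ℕ) (F : BiFiltration) : Prop where
  size : s.nat 0 0 (a - 1) = F.n
  card : ∀ i : Fin F.n, s.nat a i 0 = (F.simplex i).card
  mem : ∀ i v, v ∈ F.simplex i ↔ ∃ k < (F.simplex i).card, s.nat a i (k + 1) = v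
  fst : ∀ i : Fin F.n, s.real a i 0 = (F.val i).1
  snd : ∀ i : Fin F.n, s.real a i 1 = (F.val i).2

theorem HasInput.congr {s s' : Store} {a : ℕ} {F : BiFiltration} (h : HasInput s a F)
    (h0 : s'.nat 0 = s.nat 0) (h1 : s'.nat a = s.nat a) (h2 : s'.real a = s.real a) :
    HasInput s' a F := by
  refine ⟨?_, ?_, ?_, ?_, ?_⟩
  · rw [h0, h.size]
  · rw [h1]; exact h.card
  · rw [h1]; exact h.mem
  · rw [h2]; exact h.fst
  · rw [h2]; exact h.snd

/-- The memory `s` holds the parameters of a slice in the arrays `60`. -/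
structure HasSlice (s : Store) (t : SliceType) (l m : ℝ) : Prop where
  code : s.nat 60 0 0 = t.code
  fst : s.real 60 0 0 = l
  snd : s.real 60 0 1 = m

theorem HasSlice.congr {s s' : Store} {t : SliceType} {l m : ℝ} (h : HasSlice s t l m)
    (h1 : s'.nat 60 = s.nat 60) (h2 : s'.real 60 = s.real 60) : HasSlice s' t l m :=
  ⟨by rw [h1, h.code], by rw [h2, h.fst], by rw [h2, h.snd]⟩

/-- Real array `61` receives the weighted push of the point in row `40` of real array `a`. -/
def pushProg (a : ℕ) : FProg :=
  .cond (.natEq (reg 60) 0)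
    (.setR 61 0 0 (.get 60 0 0 * (.get a (reg 40) 1 - .get 60 0 1)) ;;
      maxProg 61 (.get a (reg 40) 0))
    (.cond (.natEq (reg 60) 1)
      (.setR 61 0 0 (.get a (reg 40) 1 - .get 60 0 1) ;;
        maxProg 61 (.get 60 0 0 * .get a (reg 40) 0))
      (.cond (.natEq (reg 60) 2)
        (.setR 61 0 0 (.get 60 0 0 * .get a (reg 40) 1) ;;
          maxProg 61 (.get a (reg 40) 0 - .get 60 0 1))
        (.setR 61 0 0 (.get a (reg 40) 1) ;;
          maxProg 61 (.get 60 0 0 * (.get a (reg 40) 0 - .get 60 0 1)))))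

theorem pushProg_run (s : Store) {a i : ℕ} {t : SliceType} {l m : ℝ} (ha : a ≠ 61)
    (hs : HasSlice s t l m) (hi : s.nat 40 0 0 = i) :
    ((pushProg a).run s).real 61 0 0 = wpush t l m (s.real a i 0, s.real a i 1) := by
  have hc := hs.code
  cases t <;> simp [SliceType.code] at hc <;>
    simp [pushProg, hc, hs.fst, hs.snd, ha, hi, wpush]

/-- Real array `11` receives the restriction of the bi-filtration `a` to the slice. -/
def restrictProg (a : ℕ) : FProg :=
  .rep 40 (pushProg a ;; .setR 11 0 (reg 40) (.get 61 0 0))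

theorem restrictProg_run (s : Store) {a : ℕ} {t : SliceType} {l m : ℝ} (ha : a ≠ 61) (ha' : a ≠ 11)
    (hs : HasSlice s t l m) : ∀ i < s.nat 5 0 0,
    ((restrictProg a).run s).real 11 0 i = wpush t l m (s.real a i 0, s.real a i 1) := by
  refine run_rep_induct (restrictProg a) rfl s (fun k s' => ∀ i < k,
    s'.real 11 0 i = wpush t l m (s.real a i 0, s.real a i 1)) (fun _ _ _ h => h) (by simp) ?_
  intro k hk s' ih hv hf i hi
  have e : s'.real a = s.real a := by
    refine hf.real a ?_
    simp [restrictProg, wR, pushProg, maxProg, ha, ha']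
  have h1 := pushProg_run s' ha (hs.congr (hf.nat 60 rfl) (hf.real 60 rfl)) hv
  rw [e] at h1
  have h2 : ((pushProg a).run s').real 11 = s'.real 11 := run_real 11 rfl
  have h3 : ((pushProg a).run s').nat 40 0 0 = k := by rw [run_nat 40 rfl, hv]
  simp only [run_seq, run_setR, RealExpr.eval_get, NatExpr.eval_ofNat, h1, h3, NatExpr.eval_get,
    Store.setReal_real_self, h2, true_and]
  rcases Nat.lt_succ_iff_lt_or_eq.1 hi with hi | rfl
  · rw [if_neg hi.ne, ih i hi]
  · simp

/-! ### The boundary matrix, by marking vertices -/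

/-- Store in array `7` the positions of the vertices of the simplex `41`. -/
def markProg (a : ℕ) : FProg :=
  .rep 42 (.cond (.natLt (reg 42) (.get a (reg 41) 0))
    (.setN 7 0 (.get a (reg 41) (reg 42 + 1)) (reg 42)) .skip)

/-- Register `59` receives `1` if the simplex `40` is a subset of the simplex `41`. -/
def subsetProg (a : ℕ) : FProg :=
  .rep 42 (.cond (.and (.natLt (reg 42) (.get a (reg 40) 0))
      (.not (.and (.natLt (.get 7 0 (.get a (reg 40) (reg 42 + 1))) (.get a (reg 41) 0))
        (.natEq (.get a (reg 41) (.get 7 0 (.get a (reg 40) (reg 42 + 1)) + 1))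
          (.get a (reg 40) (reg 42 + 1))))))
    (.setN 59 0 0 0) .skip)

/-- Fill the entry `(40, 41)` of the boundary matrix. -/
def faceEntryProg (a : ℕ) : FProg :=
  .setN 59 0 0 1 ;; subsetProg a ;;
    .cond (.and (.natEq (reg 59) 1) (.natEq (.get a (reg 40) 0 + 1) (.get a (reg 41) 0)))
      (.setN 12 (reg 40) (reg 41) 1) (.setN 12 (reg 40) (reg 41) 0)

/-- Fill the column `41` of the boundary matrix. -/
def faceColProg (a : ℕ) : FProg := markProg a ;; .rep 40 (faceEntryProg a)

/-- The boundary matrix of the bi-filtration `a`. -/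
def faceProg (a : ℕ) : FProg := .rep 41 (faceColProg a)

/-- Array `7` is never cleared and may contain marks of other simplices. A mark is therefore trusted
only if simplex `j` really has the vertex at the marked position. This makes the test of one vertex
constant-time and keeps the whole matrix within cubic time. -/
theorem markProg_run (s : Store) {a j : ℕ} (ha : (markProg a).wN a = false)
    (hj : s.nat 41 0 0 = j) : ∀ k < s.nat 5 0 0, k < s.nat a j 0 →
      ((markProg a).run s).nat 7 0 (s.nat a j (k + 1)) < s.nat a j 0 ∧
      s.nat a j (((markProg a).run s).nat 7 0 (s.nat a j (k + 1)) + 1) = s.nat a j (k + 1) := by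
  refine run_rep_induct (markProg a) rfl s (fun l t => ∀ k < l, k < s.nat a j 0 →
    t.nat 7 0 (s.nat a j (k + 1)) < s.nat a j 0 ∧
      s.nat a j (t.nat 7 0 (s.nat a j (k + 1)) + 1) = s.nat a j (k + 1)) (fun _ _ _ h => h)
    (by simp) ?_
  intro l hl t ih hv hf k hk hk'
  simp only [run_cond, Test.holds_natLt, NatExpr.eval_get, NatExpr.eval_ofNat, hv, hf.nat a ha,
    hf.nat 41 rfl, hj, run_setN, NatExpr.eval_add, run_skip]
  by_cases h : l < s.nat a j 0
  · simp only [h, if_true, Store.setNat_nat_self, true_and]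
    split_ifs with h1
    · exact ⟨h, h1.symm⟩
    · refine ih k ?_ hk'
      rcases Nat.lt_succ_iff_lt_or_eq.1 hk with hk | rfl
      exacts [hk, absurd rfl h1]
  · rw [if_neg h]
    exact ih k (by omega) hk'

theorem subsetProg_run (s : Store) {a i j : ℕ} (ha : (subsetProg a).wN a = false)
    (hi : s.nat 40 0 0 = i) (hj : s.nat 41 0 0 = j) (h59 : s.nat 59 0 0 = 1) :
    ((subsetProg a).run s).nat 59 0 0 = 1 ↔ ∀ k < s.nat 5 0 0, k < s.nat a i 0 →
      s.nat 7 0 (s.nat a i (k + 1)) < s.nat a j 0 ∧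
      s.nat a j (s.nat 7 0 (s.nat a i (k + 1)) + 1) = s.nat a i (k + 1) := by
  refine run_rep_induct (subsetProg a) rfl s (fun l t => t.nat 59 0 0 = 1 ↔
    ∀ k < l, k < s.nat a i 0 → s.nat 7 0 (s.nat a i (k + 1)) < s.nat a j 0 ∧
      s.nat a j (s.nat 7 0 (s.nat a i (k + 1)) + 1) = s.nat a i (k + 1))
    (fun _ _ _ h => h) (by simp [h59]) ?_
  intro l hl t ih hv hf
  simp only [run_cond, Test.holds_natLt, Test.holds_and, Test.holds_not, Test.holds_natEq,
    NatExpr.eval_get, NatExpr.eval_ofNat, hv, hf.nat a ha, hf.nat 40 rfl, hi,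
    hf.nat 41 rfl, hj, run_setN, NatExpr.eval_add, run_skip, hf.nat 7 rfl]
  split_ifs with h
  · simp only [Store.setNat_nat_self, and_self, if_true, zero_ne_one, false_iff]
    exact fun h' => h.2 (h' l (by omega) h.1)
  · rw [ih]
    refine ⟨fun h1 k hk hk' => ?_, fun h1 k hk => h1 k (by omega)⟩
    rcases Nat.lt_succ_iff_lt_or_eq.1 hk with hk | rfl
    · exact h1 k hk hk'
    · by_contra h2
      exact h ⟨hk', h2⟩

/-- The vertices of a simplex are themselves simplices of the complex. Hence a loop with `N`
iterations reaches all vertices of a simplex. -/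
theorem card_simplex_le (F : BiFiltration) (i : Fin F.n) : (F.simplex i).card ≤ F.n := by
  choose g hg using fun v : F.simplex i =>
    F.face_mem i {v.1} (by simp) (Finset.singleton_nonempty _)
  have hinj : Function.Injective g := fun v w h => by
    have := (hg v).symm.trans (h ▸ hg w)
    exact Subtype.ext (Finset.singleton_injective this)
  simpa using Fintype.card_le_of_injective g hinj

theorem faceProg_run (s : Store) {a : ℕ} {F : BiFiltration} (ha : (faceProg a).wN a = false)
    (hF : HasInput s a F) (hN : F.n ≤ s.nat 5 0 0) (i j : Fin F.n) :
    ((faceProg a).run s).nat 12 i j = (boundaryCol F.simplex j i).val := by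
  have ha1 : (markProg a).wN a = false := by
    simp only [faceProg, faceColProg, wN, Bool.or_eq_false_iff] at ha; exact ha.2.1
  have ha2 : (FProg.rep 40 (faceEntryProg a)).wN a = false := by
    simp only [faceProg, faceColProg, wN, Bool.or_eq_false_iff] at ha ⊢; exact ha.2.2
  have ha3 : (subsetProg a).wN a = false := by
    simp only [faceEntryProg, wN, Bool.or_eq_false_iff] at ha2; exact ha2.2.2.1
  have ha4 : a ≠ 59 := by
    simp only [faceEntryProg, wN, Bool.or_eq_false_iff, beq_eq_false_iff_ne] at ha2
    exact ha2.2.1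
  refine run_rep_induct (faceProg a) rfl s (fun l t => ∀ i j : Fin F.n, (j : ℕ) < l →
    t.nat 12 i j = (boundaryCol F.simplex j i).val) (fun _ _ _ h => h) (by simp) ?_ i j
    (j.2.trans_le hN)
  intro l hl t ih hv hf i j hj
  simp only [faceColProg, run_seq]
  have hm := markProg_run t ha1 hv
  rw [hf.nat 5 rfl] at hm
  have b5 : ((markProg a).run t).nat 5 0 0 = s.nat 5 0 0 := by rw [run_nat 5 rfl, hf.nat 5 rfl]
  have b41 : ((markProg a).run t).nat 41 0 0 = l := by rw [run_nat 41 rfl, hv]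
  have ba : ((markProg a).run t).nat a = s.nat a := by rw [run_nat a ha1, hf.nat a ha]
  have b12 : ((markProg a).run t).nat 12 = t.nat 12 := run_nat 12 rfl
  rw [hf.nat a ha] at hm
  generalize (markProg a).run t = t₁ at *
  have := run_rep_induct (.rep 40 (faceEntryProg a)) rfl t₁ (fun r t' =>
    (∀ i j : Fin F.n, (j : ℕ) < l → t'.nat 12 i j = (boundaryCol F.simplex j i).val) ∧
    ∀ i j : Fin F.n, (j : ℕ) = l → (i : ℕ) < r → t'.nat 12 i j = (boundaryCol F.simplex j i).val)
    (fun _ _ _ h => h) ⟨by rw [b12]; exact ih, by simp⟩ ?_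
  · rcases Nat.lt_succ_iff_lt_or_eq.1 hj with hj | hj
    · exact this.1 i j hj
    · exact this.2 i j hj (by rw [b5]; omega)
  intro r hr t' ih' hv' hf'
  have hs := subsetProg_run (t'.setNat 59 0 0 1) ha3 (i := r) (j := l) (by simp [hv'])
    (by simp [hf'.nat 41 rfl, b41]) (by simp)
  simp only [ne_eq, Nat.reduceEqDiff, not_false_eq_true, Store.setNat_nat_ne, ha4,
    hf'.nat 5 rfl, b5, hf'.nat a ha2, ba, hf'.nat 7 rfl] at hs
  simp only [faceEntryProg, run_seq, run_setN, NatExpr.eval_ofNat]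
  have c12 : ((subsetProg a).run (t'.setNat 59 0 0 1)).nat 12 = t'.nat 12 := by
    rw [run_nat 12 rfl]; simp
  have c40 : ((subsetProg a).run (t'.setNat 59 0 0 1)).nat 40 0 0 = r := by
    rw [run_nat 40 rfl]; simp [hv']
  have c41 : ((subsetProg a).run (t'.setNat 59 0 0 1)).nat 41 0 0 = l := by
    rw [run_nat 41 rfl]; simp [hf'.nat 41 rfl, b41]
  have ca : ((subsetProg a).run (t'.setNat 59 0 0 1)).nat a = s.nat a := by
    rw [run_nat a ha3]; simp [ha4, hf'.nat a ha2, ba]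
  generalize (subsetProg a).run (t'.setNat 59 0 0 1) = t₂ at *
  have hres : ∀ i' j', ((FProg.cond (.and (.natEq (reg 59) 1)
      (.natEq (.get a (reg 40) 0 + 1) (.get a (reg 41) 0)))
      (.setN 12 (reg 40) (reg 41) 1) (.setN 12 (reg 40) (reg 41) 0)).run t₂).nat 12 i' j' =
      if i' = r ∧ j' = l then
        (if t₂.nat 59 0 0 = 1 ∧ s.nat a r 0 + 1 = s.nat a l 0 then 1 else 0)
      else t'.nat 12 i' j' := by
    intro i' j'
    simp only [run_cond, Test.holds_and, Test.holds_natEq, NatExpr.eval_get, NatExpr.eval_ofNat,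
      NatExpr.eval_add, ca, c40, c41, run_setN]
    split_ifs <;> simp_all
  refine ⟨fun i j hj => ?_, fun i j hj hi => ?_⟩
  · rw [hres, if_neg (by omega), ih'.1 i j hj]
  · rw [hres]
    by_cases hir : (i : ℕ) = r
    swap
    · rw [if_neg (by omega), ih'.2 i j hj (by omega)]
    subst hir hj
    rw [if_pos ⟨rfl, rfl⟩, boundaryCol, hF.card, hF.card]
    rw [hF.card, hF.card] at hs
    -- A stale mark gives no false positive since membership is checked again; there is no false
    -- negative since all vertices of simplex `j` have just been marked.
    have hsub : (∀ k < s.nat 5 0 0, k < (F.simplex i).card →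
        t₁.nat 7 0 (s.nat a i (k + 1)) < (F.simplex j).card ∧
        s.nat a j (t₁.nat 7 0 (s.nat a i (k + 1)) + 1) = s.nat a i (k + 1)) ↔
        F.simplex i ⊆ F.simplex j := by
      constructor
      · intro h v hv
        obtain ⟨k, hk, rfl⟩ := (hF.mem i v).1 hv
        obtain ⟨h1, h2⟩ := h k (hk.trans_le ((card_simplex_le F i).trans hN)) hk
        exact (hF.mem j _).2 ⟨_, h1, h2⟩
      · intro h k _ hk
        obtain ⟨k', hk', e⟩ := (hF.mem j _).1 (h ((hF.mem i _).2 ⟨k, hk, rfl⟩))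
        have := hm k' (hk'.trans_le ((card_simplex_le F j).trans hN)) (by rwa [hF.card])
        rwa [hF.card, e] at this
    simp only [hs, hsub]
    split_ifs <;> rfl

/-! ### Reading the diagram off the pairing -/

/-- Store the diagram point born at the simplex `40` of the bi-filtration `a` in the arrays `b`. -/
def savePointProg (a b : ℕ) : FProg :=
  .setN b 0 (reg 40) 0 ;;
  .cond (.and (.natLt (reg 40) (reg 10)) (.natEq (.get a (reg 40) 0) (.get 0 0 2 + 1)))
    (.cond (.natEq (.get 14 0 (reg 40)) 0)
      (.cond (.natEq (.get 15 0 (reg 40)) 0)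
        (.setN b 0 (reg 40) 2 ;; .setR b 0 (reg 40) (.get 11 0 (reg 40))) .skip)
      (.cond (.realLt (.get 11 0 (reg 40)) (.get 11 0 (.get 14 0 (reg 40) - 1)))
        (.setN b 0 (reg 40) 1 ;; .setR b 0 (reg 40) (.get 11 0 (reg 40)) ;;
          .setR b 1 (reg 40) (.get 11 0 (.get 14 0 (reg 40) - 1)))
        .skip))
    .skip

/-- Store the diagram of the bi-filtration `a` in the arrays `b`. -/
def saveProg (a b : ℕ) : FProg := .rep 40 (savePointProg a b)

/-- The persistence diagram of the slice of the bi-filtration `a`. -/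
def diagramProg (a b : ℕ) : FProg :=
  .setN 10 0 0 (.get 0 0 (.lit (a - 1))) ;; restrictProg a ;; faceProg a ;; orderProg ;;
    reduceProg ;; saveProg a b

/-- The diagram point born at the simplex `i`, according to the reduced boundary matrix. -/
def labelAt (s : Store) (a i : ℕ) : Option (ℝ × WithTop ℝ) :=
  if i < s.nat 10 0 0 ∧ s.nat a i 0 = s.nat 0 0 2 + 1 then
    if s.nat 14 0 i = 0 then
      if s.nat 15 0 i = 0 then some (s.real 11 0 i, ⊤) else none
    else if s.real 11 0 i < s.real 11 0 (s.nat 14 0 i - 1) then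
      some (s.real 11 0 i, (s.real 11 0 (s.nat 14 0 i - 1) : WithTop ℝ)) else none
  else none

theorem saveProg_run (s : Store) {a b : ℕ} (hab : a = 1 ∧ b = 21 ∨ a = 2 ∧ b = 22) :
    ∀ i < s.nat 5 0 0, pointAt ((saveProg a b).run s) b i = labelAt s a i := by
  refine run_rep_induct (saveProg a b) rfl s (fun l t => ∀ i < l, pointAt t b i = labelAt s a i)
    ?_ (by simp) ?_
  · rcases hab with ⟨rfl, rfl⟩ | ⟨rfl, rfl⟩ <;> exact fun _ _ _ h => h
  intro l hl t ih hv hf i hi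
  have h0 : t.nat 0 = s.nat 0 ∧ t.nat 10 = s.nat 10 ∧ t.nat 14 = s.nat 14 ∧ t.nat 15 = s.nat 15 ∧
      t.nat a = s.nat a ∧ t.real 11 = s.real 11 := by
    rcases hab with ⟨rfl, rfl⟩ | ⟨rfl, rfl⟩ <;>
    exact ⟨hf.nat 0 rfl, hf.nat 10 rfl, hf.nat 14 rfl, hf.nat 15 rfl, hf.nat _ rfl,
      hf.real 11 rfl⟩
  obtain ⟨h0, h10, h14, h15, ha, h11⟩ := h0
  have hb : b ≠ 0 ∧ b ≠ 10 ∧ b ≠ 14 ∧ b ≠ 15 ∧ b ≠ a ∧ b ≠ 11 ∧ b ≠ 40 := by omega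
  obtain ⟨b0, b10, b14, b15, ba, b11, b40⟩ := hb
  have step : pointAt ((savePointProg a b).run t) b l = labelAt s a l ∧
      ∀ i, i ≠ l → pointAt ((savePointProg a b).run t) b i = pointAt t b i := by
    simp only [savePointProg, run_seq, run_setN, run_cond, Test.holds_and, Test.holds_natLt,
      Test.holds_natEq, NatExpr.eval_get, NatExpr.eval_ofNat, NatExpr.eval_add, hv, run_skip,
      run_setR, RealExpr.eval_get, Test.holds_realLt, NatExpr.eval_sub, Store.setNat_real,
      Store.setReal_nat, Store.setNat_nat_ne b0.symm, Store.setNat_nat_ne b10.symm,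
      Store.setNat_nat_ne b14.symm, Store.setNat_nat_ne b15.symm, Store.setNat_nat_ne ba.symm,
      Store.setReal_real_ne b11.symm, Store.setNat_nat_ne b40.symm, h0, h10, h14, h15, ha, h11]
    simp only [labelAt]
    split_ifs <;> refine ⟨?_, fun i hi => ?_⟩ <;> simp [pointAt, decodePoint, *]
  rcases Nat.lt_succ_iff_lt_or_eq.1 hi with hi | rfl
  exacts [(step.2 i hi.ne).trans (ih i hi), step.1]

theorem optCode_eq_zero {n : ℕ} {x : Option (Fin n)} : optCode x = 0 ↔ x = none := by
  cases x <;> simp [optCode]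

/-- Indices from `n` on carry no point, so both diagrams can be indexed by the common type `Fin N`.
-/
theorem filterMap_univ_of_le {α : Type*} {n N : ℕ} (h : n ≤ N) (g : ℕ → Option α)
    (hg : ∀ i, n ≤ i → g i = none) :
    (Finset.univ : Finset (Fin N)).val.filterMap (fun i : Fin N => g i) =
      (Finset.univ : Finset (Fin n)).val.filterMap (fun i : Fin n => g i) := by
  have key : ∀ m, (Finset.univ : Finset (Fin m)).val.filterMap (fun i : Fin m => g i) =
      (Multiset.range m).filterMap g := by
    intro m
    rw [← Finset.range_val, ← Nat.Iio_eq_range, ← Fin.map_valEmbedding_univ, Finset.map_val, Multiset.filterMap_map]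
    rfl
  rw [key, key]
  induction N, h using Nat.le_induction with
  | base => rfl
  | succ N hN ih => rw [Multiset.range_succ, Multiset.filterMap_cons_none _ _ (hg N hN), ih]

theorem card_diagram_le {n : ℕ} {σ : Fin n → Finset ℕ} {f : Fin n → ℝ} {p : ℕ}
    {lab : Fin n → Option (ℝ × WithTop ℝ)}
    (h : diagram σ f p = (Finset.univ : Finset (Fin n)).val.filterMap lab) :
    (diagram σ f p).card ≤ n := by
  have h1 : ∀ s : Multiset (Fin n), (s.filterMap lab).card ≤ s.card := by
    intro s
    induction s using Multiset.induction_on with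
    | empty => simp
    | cons i s ih =>
      cases hi : lab i with
      | none => rw [Multiset.filterMap_cons_none _ _ hi, Multiset.card_cons]; omega
      | some x => simpa [Multiset.filterMap_cons_some _ _ _ hi] using ih
  rw [h]
  simpa using h1 Finset.univ.val

/-- The table `piv` leads from a birth to its death. Pairs with equal values are skipped, in
accordance with the condition `b < d` in `diagram`. -/
theorem isLabeling_labelAt {s : Store} {a p : ℕ} {F : BiFiltration} {f : Fin F.n → ℝ}
    {low piv : Fin F.n → Option (Fin F.n)} (hn : s.nat 10 0 0 = F.n) (hp : s.nat 0 0 2 = p)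
    (hcard : ∀ i : Fin F.n, s.nat a i 0 = (F.simplex i).card)
    (hf : ∀ i : Fin F.n, s.real 11 0 i = f i)
    (hlow : ∀ i : Fin F.n, s.nat 15 0 i = optCode (low i))
    (hpiv : ∀ i : Fin F.n, s.nat 14 0 i = optCode (piv i))
    (hinv : ∀ i j, piv i = some j ↔ low j = some i) :
    IsLabeling F.simplex low f p fun i => labelAt s a i := by
  have key : ∀ i : Fin F.n, labelAt s a i = if (F.simplex i).card = p + 1 then
      match piv i with
      | none => if low i = none then some (f i, ⊤) else none
      | some j => if f i < f j then some (f i, (f j : WithTop ℝ)) else none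
    else none := by
    intro i
    simp only [labelAt, hn, i.2, true_and, hcard, hp, hpiv, hlow, hf]
    cases h : piv i with
    | none => simp [optCode_eq_zero]
    | some j => simp [optCode, hf]
  refine ⟨fun i b d => ?_, fun i b => ?_⟩
  · rw [key]
    by_cases hc : (F.simplex i).card = p + 1
    · cases h : piv i with
      | none =>
        have : ∀ j, low j ≠ some i := fun j hj => by simp [(hinv i j).2 hj] at h
        by_cases hl : low i = none <;> simp [hc, hl, this]
      | some j =>
        have h1 : ∀ j', low j' = some i ↔ j' = j := fun j' => by
          rw [← hinv, h, Option.some_inj, eq_comm]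
        simp only [hc, if_true, true_and, h1, exists_eq_right]
        by_cases hlt : f i < f j
        · simp only [hlt, if_true, Option.some_inj, Prod.mk.injEq, WithTop.coe_inj]
          exact ⟨fun ⟨h2, h3⟩ => ⟨h2, h3, h2 ▸ h3 ▸ hlt⟩, fun ⟨h2, h3, _⟩ => ⟨h2, h3⟩⟩
        · simp only [hlt, if_false, reduceCtorEq, false_iff]
          rintro ⟨rfl, rfl, h2⟩
          exact hlt h2
    · simp [hc]
  · rw [key]
    by_cases hc : (F.simplex i).card = p + 1
    · cases h : piv i with
      | none =>
        have : ∀ j, low j ≠ some i := fun j hj => by simp [(hinv i j).2 hj] at h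
        by_cases hl : low i = none <;> simp [hc, hl, this]
      | some j =>
        have := (hinv i j).1 h
        have h3 : ¬ (∀ j, low j ≠ some i) := fun h' => h' j this
        simp only [hc, if_true, h3, and_false, iff_false]
        split_ifs <;> simp
    · simp [hc]

/-- Breaking ties by index may place a simplex before one of its faces. This is harmless: the theory
of reductions used here only needs the sublevel sets to be initial segments of the order. -/
theorem diagramProg_run (s : Store) {a b p N : ℕ} {F : BiFiltration} {t : SliceType} {l m : ℝ}
    (hab : a = 1 ∧ b = 21 ∨ a = 2 ∧ b = 22) (hF : HasInput s a F) (hs : HasSlice s t l m)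
    (hp : s.nat 0 0 2 = p) (hN : s.nat 5 0 0 = N) (hn : F.n ≤ N) :
    diagram F.simplex (restriction F t l m) p = (Finset.univ : Finset (Fin N)).val.filterMap
      (fun i : Fin N => pointAt ((diagramProg a b).run s) b i) ∧
    (diagram F.simplex (restriction F t l m) p).card ≤ F.n := by
  simp only [diagramProg, run_seq, run_setN, NatExpr.eval_get, NatExpr.eval_ofNat,
    NatExpr.eval_lit, hF.size]
  set s₁ := s.setNat 10 0 0 F.n with hs₁
  have ha10 : a ≠ 10 := by omega
  have hF₁ : HasInput s₁ a F := hF.congr (by simp [hs₁]) (by simp [hs₁, ha10]) (by simp [hs₁])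
  have hv := restrictProg_run s₁ (a := a) (by omega) (by omega)
    (hs.congr (by simp [hs₁]) (by simp [hs₁]))
  have b5 : s₁.nat 5 0 0 = N := by simp [hs₁, hN]
  have b10 : s₁.nat 10 0 0 = F.n := by simp [hs₁]
  have bp : s₁.nat 0 0 2 = p := by simp [hs₁, hp]
  clear_value s₁
  have hfv : ∀ i : Fin F.n, ((restrictProg a).run s₁).real 11 0 i = restriction F t l m i := by
    intro i
    rw [hv i (by omega), hF₁.fst, hF₁.snd, restriction]
  have hF₂ : HasInput ((restrictProg a).run s₁) a F := by
    refine hF₁.congr (run_nat 0 rfl) (run_nat a ?_) (run_real a ?_) <;>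
    rcases hab with ⟨rfl, rfl⟩ | ⟨rfl, rfl⟩ <;> rfl
  have c5 : ((restrictProg a).run s₁).nat 5 0 0 = N := by rw [run_nat 5 rfl, b5]
  have c10 : ((restrictProg a).run s₁).nat 10 0 0 = F.n := by rw [run_nat 10 rfl, b10]
  have cp : ((restrictProg a).run s₁).nat 0 0 2 = p := by rw [run_nat 0 rfl, bp]
  generalize (restrictProg a).run s₁ = s₂ at *
  have wa : (faceProg a).wN a = false := by rcases hab with ⟨rfl, rfl⟩ | ⟨rfl, rfl⟩ <;> rfl
  have hm := faceProg_run s₂ wa hF₂ (by omega)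
  have hF₃ : HasInput ((faceProg a).run s₂) a F :=
    hF₂.congr (run_nat 0 rfl) (run_nat a wa) (run_real a rfl)
  have d5 : ((faceProg a).run s₂).nat 5 0 0 = N := by rw [run_nat 5 rfl, c5]
  have d10 : ((faceProg a).run s₂).nat 10 0 0 = F.n := by rw [run_nat 10 rfl, c10]
  have dp : ((faceProg a).run s₂).nat 0 0 2 = p := by rw [run_nat 0 rfl, cp]
  have d11 : ((faceProg a).run s₂).real 11 = s₂.real 11 := run_real 11 rfl
  rw [← d11] at hfv
  generalize (faceProg a).run s₂ = s₃ at *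
  have ho := orderProg_run s₃ F.n d10 (by omega)
  have hF₄ : HasInput (orderProg.run s₃) a F := by
    refine hF₃.congr (run_nat 0 rfl) (run_nat a ?_) (run_real a rfl)
    rcases hab with ⟨rfl, rfl⟩ | ⟨rfl, rfl⟩ <;> rfl
  have e5 : (orderProg.run s₃).nat 5 0 0 = N := by rw [run_nat 5 rfl, d5]
  have e10 : (orderProg.run s₃).nat 10 0 0 = F.n := by rw [run_nat 10 rfl, d10]
  have ep : (orderProg.run s₃).nat 0 0 2 = p := by rw [run_nat 0 rfl, dp]
  have e12 : (orderProg.run s₃).nat 12 = s₃.nat 12 := run_nat 12 rfl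
  have e11 : (orderProg.run s₃).real 11 = s₃.real 11 := run_real 11 rfl
  rw [← e12] at hm
  rw [← e11] at hfv ho
  generalize orderProg.run s₃ = s₄ at *
  obtain ⟨R, low, piv, hmem, hred, hinv⟩ := reduceProg_run (σ := F.simplex)
    (rk := fun i : Fin F.n => rankOf (s₄.real 11 0) F.n i) s₄ e10 (by omega)
    (fun i j h => Fin.ext (rankOf_injOn i.2 j.2 h)) (fun i => rankOf_lt i.2)
    (fun i => ho i i.2) hm
  have hF₅ : HasInput (reduceProg.run s₄) a F := by
    refine hF₄.congr (run_nat 0 rfl) (run_nat a ?_) (run_real a rfl)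
    rcases hab with ⟨rfl, rfl⟩ | ⟨rfl, rfl⟩ <;> rfl
  have f5 : (reduceProg.run s₄).nat 5 0 0 = N := by rw [run_nat 5 rfl, e5]
  have f10 : (reduceProg.run s₄).nat 10 0 0 = F.n := by rw [run_nat 10 rfl, e10]
  have fp : (reduceProg.run s₄).nat 0 0 2 = p := by rw [run_nat 0 rfl, ep]
  have f11 : (reduceProg.run s₄).real 11 = s₄.real 11 := run_real 11 rfl
  have hlab := isLabeling_labelAt f10 fp hF₅.card (fun i => by rw [f11, hfv i]) hmem.low
    hmem.piv hinv
  have hD := hred.diagram_eq F.simplex_injective F.face_mem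
    (fun i j h => by rw [← hfv, ← hfv]; exact le_of_rankOf_le j.2 h) hlab
  generalize reduceProg.run s₄ = s₅ at *
  refine ⟨?_, card_diagram_le hD⟩
  rw [hD, ← filterMap_univ_of_le hn (labelAt s₅ a) fun i hi => by
    rw [labelAt, if_neg]; rw [f10]; omega]
  congr 1
  funext i
  exact (saveProg_run s₅ hab i (by rw [f5]; exact i.2)).symm

/-- Evaluate the bottleneck distance at the slice in the arrays `60`. -/
def evalProg : FProg := diagramProg 1 21 ;; diagramProg 2 22 ;; bottleneckProg

theorem evalProg_run (s : Store) {p : ℕ} {F₁ F₂ : BiFiltration} {t : SliceType} {l m : ℝ}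
    (hF₁ : HasInput s 1 F₁) (hF₂ : HasInput s 2 F₂) (hs : HasSlice s t l m)
    (hp : s.nat 0 0 2 = p) (hN : s.nat 5 0 0 = F₁.n + F₂.n) (hN1 : 1 ≤ F₁.n + F₂.n) :
    RepresentsValue ((evalProg.run s).nat 36 0 0) ((evalProg.run s).real 30 0 0)
      (evalDist F₁ F₂ p t l m) := by
  simp only [evalProg, run_seq]
  obtain ⟨h1, h1'⟩ := diagramProg_run s (.inl ⟨rfl, rfl⟩) hF₁ hs hp hN (by omega)
  have hF₂' : HasInput ((diagramProg 1 21).run s) 2 F₂ :=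
    hF₂.congr (run_nat 0 rfl) (run_nat 2 rfl) (run_real 2 rfl)
  have hs' : HasSlice ((diagramProg 1 21).run s) t l m :=
    hs.congr (run_nat 60 rfl) (run_real 60 rfl)
  have hp' : ((diagramProg 1 21).run s).nat 0 0 2 = p := by rw [run_nat 0 rfl, hp]
  have hN' : ((diagramProg 1 21).run s).nat 5 0 0 = F₁.n + F₂.n := by rw [run_nat 5 rfl, hN]
  generalize (diagramProg 1 21).run s = s₁ at *
  obtain ⟨h2, h2'⟩ := diagramProg_run s₁ (.inr ⟨rfl, rfl⟩) hF₂' hs' hp' hN' (by omega)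
  -- The diagrams have at most `F₁.n` and `F₂.n` points, so `N = F₁.n + F₂.n` indices leave room for
  -- all diagonal copies.
  refine bottleneckProg_run _ (by rw [run_nat 5 rfl, hN']) hN1 ?_ h2 (by omega)
  rw [h1]
  simp only [pointAt, run_nat (P := diagramProg 2 22) 21 rfl, run_real (P := diagramProg 2 22) 21 rfl]

/-! ## Computing the bounds -/

/-- One entry of the maximum does not depend on `l` and the other is `l` times a constant, whose
sign decides the direction. -/
theorem monotone_or_antitone_wpush_left (t : SliceType) (m : ℝ) (q : ℝ × ℝ) :
    Monotone (fun l => wpush t l m q) ∨ Antitone fun l => wpush t l m q := by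
  have key : ∀ u : ℝ, (Monotone fun l : ℝ => l * u) ∨ Antitone fun l : ℝ => l * u := fun u =>
    (le_total 0 u).imp (fun h _ _ h' => mul_le_mul_of_nonneg_right h' h)
      fun h _ _ h' => mul_le_mul_of_nonpos_right h' h
  cases t <;> simp only [wpush]
  · exact (key (q.2 - m)).imp (fun h => h.max monotone_const) fun h => h.max antitone_const
  · exact (key q.1).imp (fun h => monotone_const.max h) fun h => antitone_const.max h
  · exact (key q.2).imp (fun h => h.max monotone_const) fun h => h.max antitone_const
  · exact (key (q.1 - m)).imp (fun h => monotone_const.max h) fun h => antitone_const.max h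

theorem monotone_or_antitone_wpush_right (t : SliceType) (l : ℝ) (q : ℝ × ℝ) :
    Monotone (fun m => wpush t l m q) ∨ Antitone fun m => wpush t l m q := by
  have key : ∀ u : ℝ, (Monotone fun m : ℝ => l * (u - m)) ∨ Antitone fun m : ℝ => l * (u - m) :=
    fun u => ((le_total 0 l).imp (fun h _ _ h' => mul_le_mul_of_nonneg_left (by linarith) h)
      fun h _ _ h' => mul_le_mul_of_nonpos_left (by linarith) h).symm
  have key' : ∀ u : ℝ, Antitone fun m : ℝ => u - m := fun u _ _ h => sub_le_sub_left h u
  cases t <;> simp only [wpush]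
  · exact (key q.2).imp (fun h => h.max monotone_const) fun h => h.max antitone_const
  · exact .inr ((key' q.2).max antitone_const)
  · exact .inr (antitone_const.max (key' q.1))
  · exact (key q.1).imp (fun h => monotone_const.max h) fun h => antitone_const.max h

/-- The maximal deviation from the center at the corners of a box. -/
def cornerVariation (B : Box) (q : ℝ × ℝ) : ℝ :=
  max (max |wpush B.type B.lmin B.mmin q - wpush B.type B.lmid B.mmid q|
      |wpush B.type B.lmin B.mmax q - wpush B.type B.lmid B.mmid q|)
    (max |wpush B.type B.lmax B.mmin q - wpush B.type B.lmid B.mmid q|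
      |wpush B.type B.lmax B.mmax q - wpush B.type B.lmid B.mmid q|)

theorem abs_sub_le_of_monotone_or_antitone {g : ℝ → ℝ} (hg : Monotone g ∨ Antitone g) {a b x : ℝ}
    (hx : x ∈ Set.Icc a b) (c : ℝ) : |g x - c| ≤ max |g a - c| |g b - c| := by
  rcases hg with h | h
  · exact abs_le_max_abs_abs (by linarith [h hx.1]) (by linarith [h hx.2])
  · rw [max_comm]
    exact abs_le_max_abs_abs (by linarith [h hx.2]) (by linarith [h hx.1])

theorem abs_wpush_sub_le_cornerVariation {B : Box} {l m : ℝ} (hl : l ∈ Set.Icc B.lmin B.lmax)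
    (hm : m ∈ Set.Icc B.mmin B.mmax) (q : ℝ × ℝ) :
    |wpush B.type l m q - wpush B.type B.lmid B.mmid q| ≤ cornerVariation B q :=
  (abs_sub_le_of_monotone_or_antitone (monotone_or_antitone_wpush_left B.type m q) hl _).trans
    (max_le_max
      (abs_sub_le_of_monotone_or_antitone (monotone_or_antitone_wpush_right B.type _ q) hm _)
      (abs_sub_le_of_monotone_or_antitone (monotone_or_antitone_wpush_right B.type _ q) hm _))

/-- Being monotone or antitone in each parameter separately, the push deviates most from its central
value at a corner. So the supremum over the box is a maximum over four slices. -/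
theorem pointVariation_eq {B : Box} (hl : B.lmin ≤ B.lmax) (hm : B.mmin ≤ B.mmax) (q : ℝ × ℝ) :
    pointVariation B q = cornerVariation B q := by
  refine IsGreatest.csSup_eq ⟨?_, ?_⟩
  · have key : ∀ l m, l ∈ Set.Icc B.lmin B.lmax → m ∈ Set.Icc B.mmin B.mmax →
        |wpush B.type l m q - wpush B.type B.lmid B.mmid q| = cornerVariation B q →
        cornerVariation B q ∈ (fun L : ℝ × ℝ => |wpush B.type L.1 L.2 q -
          wpush B.type B.lmid B.mmid q|) '' (Set.Icc B.lmin B.lmax ×ˢ Set.Icc B.mmin B.mmax) :=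
      fun l m h1 h2 h3 => ⟨(l, m), ⟨h1, h2⟩, h3⟩
    have l1 := Set.left_mem_Icc.2 hl
    have l2 := Set.right_mem_Icc.2 hl
    have m1 := Set.left_mem_Icc.2 hm
    have m2 := Set.right_mem_Icc.2 hm
    rcases max_choice
      (max |wpush B.type B.lmin B.mmin q - wpush B.type B.lmid B.mmid q|
        |wpush B.type B.lmin B.mmax q - wpush B.type B.lmid B.mmid q|)
      (max |wpush B.type B.lmax B.mmin q - wpush B.type B.lmid B.mmid q|
        |wpush B.type B.lmax B.mmax q - wpush B.type B.lmid B.mmid q|) with h | h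
    · rcases max_choice (|wpush B.type B.lmin B.mmin q - wpush B.type B.lmid B.mmid q|)
        (|wpush B.type B.lmin B.mmax q - wpush B.type B.lmid B.mmid q|) with h' | h'
      · exact key _ _ l1 m1 (h.trans h').symm
      · exact key _ _ l1 m2 (h.trans h').symm
    · rcases max_choice (|wpush B.type B.lmax B.mmin q - wpush B.type B.lmid B.mmid q|)
        (|wpush B.type B.lmax B.mmax q - wpush B.type B.lmid B.mmid q|) with h' | h'
      · exact key _ _ l2 m1 (h.trans h').symm
      · exact key _ _ l2 m2 (h.trans h').symm
  · rintro _ ⟨L, ⟨h1, h2⟩, rfl⟩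
    exact abs_wpush_sub_le_cornerVariation h1 h2 q

/-- The memory `s` holds the box `B` in the natural array `60` and the real array `63`. -/
structure HasBox (s : Store) (B : Box) : Prop where
  code : s.nat 60 0 0 = B.type.code
  lmin : s.real 63 0 0 = B.lmin
  lmax : s.real 63 0 1 = B.lmax
  mmin : s.real 63 0 2 = B.mmin
  mmax : s.real 63 0 3 = B.mmax

theorem HasBox.congr {s s' : Store} {B : Box} (h : HasBox s B)
    (h1 : s'.nat 60 = s.nat 60) (h2 : s'.real 63 = s.real 63) : HasBox s' B :=
  ⟨by rw [h1, h.code], by rw [h2, h.lmin], by rw [h2, h.lmax], by rw [h2, h.mmin],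
    by rw [h2, h.mmax]⟩

/-- Select the slice with the given parameters. -/
def sliceProg (e e' : RealExpr) : FProg := .setR 60 0 0 e ;; .setR 60 0 1 e'

/-- Select the slice at the center of the box. -/
def centerProg : FProg :=
  sliceProg ((.get 63 0 0 + .get 63 0 1) / 2) ((.get 63 0 2 + .get 63 0 3) / 2)

theorem centerProg_run (s : Store) {B : Box} (hB : HasBox s B) :
    HasSlice (centerProg.run s) B.type B.lmid B.mmid := by
  refine ⟨by rw [run_nat 60 rfl, hB.code], ?_, ?_⟩ <;>
  simp [centerProg, sliceProg, hB.lmin, hB.lmax, hB.mmin, hB.mmax, Box.lmid, Box.mmid]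

/-- Raise `62` to the deviation of the push of the point `40` to the given slice from `64`. -/
def deviationProg (a : ℕ) (e e' : RealExpr) : FProg :=
  sliceProg e e' ;; pushProg a ;; maxProg 62 (.get 61 0 0 - .get 64 0 0) ;;
    maxProg 62 (.get 64 0 0 - .get 61 0 0)

/-- Raise `62` to the variation of the point `40`. -/
def pointVariationProg (a : ℕ) : FProg :=
  centerProg ;; pushProg a ;; .setR 64 0 0 (.get 61 0 0) ;;
    deviationProg a (.get 63 0 0) (.get 63 0 2) ;; deviationProg a (.get 63 0 0) (.get 63 0 3) ;;
    deviationProg a (.get 63 0 1) (.get 63 0 2) ;; deviationProg a (.get 63 0 1) (.get 63 0 3)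

/-- The body of the loop of `variationProg`. -/
def variationStepProg (a : ℕ) : FProg :=
  .cond (.natLt (reg 40) (.get 0 0 (.lit (a - 1)))) (pointVariationProg a) .skip

/-- Real array `62` receives the variation of the bi-filtration `a` in the box. -/
def variationProg (a : ℕ) : FProg := .setR 62 0 0 0 ;; .rep 40 (variationStepProg a)

theorem deviationProg_run (s : Store) {a i : ℕ} (ha : a = 1 ∨ a = 2) {t : SliceType}
    (ht : s.nat 60 0 0 = t.code) (hi : s.nat 40 0 0 = i) {x y : ℕ} :
    ((deviationProg a (.get 63 0 (.lit x)) (.get 63 0 (.lit y))).run s).real 62 0 0 =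
      max (s.real 62 0 0) |wpush t (s.real 63 0 x) (s.real 63 0 y) (s.real a i 0, s.real a i 1) -
        s.real 64 0 0| := by
  simp only [deviationProg, run_seq]
  have h0 : HasSlice ((sliceProg (.get 63 0 (.lit x)) (.get 63 0 (.lit y))).run s) t
      (s.real 63 0 x) (s.real 63 0 y) := by
    refine ⟨by rw [run_nat 60 rfl, ht], ?_, ?_⟩ <;> simp [sliceProg]
  have e40 : ((sliceProg (.get 63 0 (.lit x)) (.get 63 0 (.lit y))).run s).nat 40 0 0 = i := by
    rw [run_nat 40 rfl, hi]
  have e62 : ((sliceProg (.get 63 0 (.lit x)) (.get 63 0 (.lit y))).run s).real 62 = s.real 62 :=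
    run_real 62 rfl
  have e64 : ((sliceProg (.get 63 0 (.lit x)) (.get 63 0 (.lit y))).run s).real 64 = s.real 64 :=
    run_real 64 rfl
  have ea : ((sliceProg (.get 63 0 (.lit x)) (.get 63 0 (.lit y))).run s).real a = s.real a := by
    rcases ha with rfl | rfl <;> exact run_real _ rfl
  generalize (sliceProg (.get 63 0 (.lit x)) (.get 63 0 (.lit y))).run s = s₁ at *
  have h1 := pushProg_run s₁ (a := a) (by omega) h0 e40
  rw [ea] at h1
  have f62 : ((pushProg a).run s₁).real 62 = s.real 62 := by rw [run_real 62 rfl, e62]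
  have f64 : ((pushProg a).run s₁).real 64 = s.real 64 := by rw [run_real 64 rfl, e64]
  simp only [maxProg_real, RealExpr.eval_sub, RealExpr.eval_get, NatExpr.eval_ofNat, f62, h1, f64,
    maxProg_real_ne (a := 62) (a' := 64) (by decide),
    maxProg_real_ne (a := 62) (a' := 61) (by decide)]
  rw [max_assoc, abs_eq_max_neg, neg_sub]

theorem pointVariationProg_run (s : Store) {a i : ℕ} (ha : a = 1 ∨ a = 2) {B : Box}
    (hB : HasBox s B) (hi : s.nat 40 0 0 = i) :
    ((pointVariationProg a).run s).real 62 0 0 =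
      max (s.real 62 0 0) (cornerVariation B (s.real a i 0, s.real a i 1)) := by
  simp only [pointVariationProg, run_seq]
  have h0 := centerProg_run s hB
  have e40 : (centerProg.run s).nat 40 0 0 = i := by rw [run_nat 40 rfl, hi]
  have e62 : (centerProg.run s).real 62 = s.real 62 := run_real 62 rfl
  have e63 : (centerProg.run s).real 63 = s.real 63 := run_real 63 rfl
  have ea : (centerProg.run s).real a = s.real a := by
    rcases ha with rfl | rfl <;> exact run_real _ rfl
  generalize centerProg.run s = s₁ at *
  have h1 := pushProg_run s₁ (a := a) (by omega) h0 e40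
  rw [ea] at h1
  have f60 : ((pushProg a).run s₁).nat 60 0 0 = B.type.code := by rw [run_nat 60 rfl, h0.code]
  have f40 : ((pushProg a).run s₁).nat 40 0 0 = i := by rw [run_nat 40 rfl, e40]
  have f62 : ((pushProg a).run s₁).real 62 = s.real 62 := by rw [run_real 62 rfl, e62]
  have f63 : ((pushProg a).run s₁).real 63 = s.real 63 := by rw [run_real 63 rfl, e63]
  have fa : ((pushProg a).run s₁).real a = s.real a := by
    rcases ha with rfl | rfl <;> rw [run_real _ rfl, ea]
  generalize (pushProg a).run s₁ = s₂ at *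
  simp only [run_setR, RealExpr.eval_get, NatExpr.eval_ofNat, h1]
  have ha64 : a ≠ 64 := by omega
  have hdev : ∀ (s' : Store) (x y : ℕ), s'.nat 60 0 0 = B.type.code → s'.nat 40 0 0 = i →
      s'.real 63 = s.real 63 → s'.real a = s.real a →
      s'.real 64 0 0 = wpush B.type B.lmid B.mmid (s.real a i 0, s.real a i 1) →
      ∃ s'', (deviationProg a (.get 63 0 (.lit x)) (.get 63 0 (.lit y))).run s' = s'' ∧
      (s''.nat 60 0 0 = B.type.code ∧ s''.nat 40 0 0 = i ∧
        s''.real 63 = s.real 63 ∧ s''.real a = s.real a ∧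
        s''.real 64 0 0 = wpush B.type B.lmid B.mmid (s.real a i 0, s.real a i 1)) ∧
      s''.real 62 0 0 = max (s'.real 62 0 0) |wpush B.type (s.real 63 0 x) (s.real 63 0 y)
        (s.real a i 0, s.real a i 1) -
        wpush B.type B.lmid B.mmid (s.real a i 0, s.real a i 1)| := by
    intro s' x y g60 g40 g63 ga g64
    refine ⟨_, rfl, ⟨by rw [run_nat 60 rfl, g60], by rw [run_nat 40 rfl, g40],
      by rw [run_real 63 rfl, g63], ?_, by rw [run_real 64 rfl, g64]⟩, ?_⟩
    · rcases ha with rfl | rfl <;> rw [run_real _ rfl, ga]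
    · rw [deviationProg_run s' ha g60 g40, g63, ga, g64]
  obtain ⟨t₁, g1, ⟨k1, k2, k3, k4, k5⟩, v1⟩ := hdev (s₂.setReal 64 0 0 (wpush B.type B.lmid B.mmid
    (s.real a i 0, s.real a i 1))) 0 2 f60 f40 (by simp [f63]) (by simp [ha64, fa]) (by simp)
  obtain ⟨t₂, g2, ⟨k1, k2, k3, k4, k5⟩, v2⟩ := hdev t₁ 0 3 k1 k2 k3 k4 k5
  obtain ⟨t₃, g3, ⟨k1, k2, k3, k4, k5⟩, v3⟩ := hdev t₂ 1 2 k1 k2 k3 k4 k5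
  obtain ⟨t₄, g4, -, v4⟩ := hdev t₃ 1 3 k1 k2 k3 k4 k5
  change ((deviationProg a (.get 63 0 (.lit 1)) (.get 63 0 (.lit 3))).run
    ((deviationProg a (.get 63 0 (.lit 1)) (.get 63 0 (.lit 2))).run
    ((deviationProg a (.get 63 0 (.lit 0)) (.get 63 0 (.lit 3))).run
    ((deviationProg a (.get 63 0 (.lit 0)) (.get 63 0 (.lit 2))).run _)))).real 62 0 0 = _
  rw [g1, g2, g3, g4, v4, v3, v2, v1, hB.lmin, hB.lmax, hB.mmin, hB.mmax, cornerVariation]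
  simp only [Store.setReal_real_ne (show 62 ≠ 64 by decide), f62, max_assoc]

/-- Starting the running maximum at `0` is correct because variations are nonnegative and `⨆` over
an empty family of reals is `0`. -/
theorem variationProg_run (s : Store) {a : ℕ} (ha : a = 1 ∨ a = 2) {B : Box} {F : BiFiltration}
    (hF : HasInput s a F) (hB : HasBox s B) (hl : B.lmin ≤ B.lmax) (hm : B.mmin ≤ B.mmax)
    (hn : F.n ≤ s.nat 5 0 0) : ((variationProg a).run s).real 62 0 0 = variation F B := by
  have hnonneg : ∀ i, 0 ≤ pointVariation B (F.val i) := fun i => by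
    rw [pointVariation_eq hl hm]
    exact le_max_of_le_left (le_max_of_le_left (abs_nonneg _))
  simp only [variationProg, run_seq]
  set s₀ := (FProg.setR 62 0 0 0).run s with hs₀
  have e5 : s₀.nat 5 = s.nat 5 := run_nat 5 rfl
  have hF₀ : HasInput s₀ a F := by
    refine hF.congr (run_nat 0 rfl) ?_ ?_ <;> rcases ha with rfl | rfl <;>
    first | exact run_nat _ rfl | exact run_real _ rfl
  have hB₀ : HasBox s₀ B := hB.congr (run_nat 60 rfl) (run_real 63 rfl)
  have key := run_rep_induct (.rep 40 (variationStepProg a)) rfl s₀ (fun k t =>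
    0 ≤ t.real 62 0 0 ∧ (∀ i : Fin F.n, (i : ℕ) < k → pointVariation B (F.val i) ≤ t.real 62 0 0) ∧
    (t.real 62 0 0 ≤ variation F B)) (fun _ _ _ h => h)
    ⟨by simp [hs₀], by simp, by simpa [hs₀, variation] using Real.iSup_nonneg hnonneg⟩ ?_
  · refine le_antisymm key.2.2 ?_
    exact Real.iSup_le (fun i => key.2.1 i (by rw [e5]; omega)) key.1
  intro k hk t ih hv hf
  have hF' : HasInput t a F := by
    refine hF₀.congr (hf.nat 0 rfl) ?_ ?_ <;> rcases ha with rfl | rfl <;>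
    first | exact hf.nat _ rfl | exact hf.real _ rfl
  simp only [variationStepProg, run_cond, Test.holds_natLt, NatExpr.eval_get, NatExpr.eval_ofNat,
    NatExpr.eval_lit, hv, hF'.size, run_skip]
  split_ifs with h
  · have h1 := pointVariationProg_run t ha (hB₀.congr (hf.nat 60 rfl) (hf.real 63 rfl)) hv
    have h2 := hF'.fst ⟨k, h⟩
    have h3 := hF'.snd ⟨k, h⟩
    simp only at h2 h3
    rw [h2, h3, ← pointVariation_eq hl hm] at h1
    rw [h1]
    refine ⟨le_max_of_le_left ih.1, fun i hi => ?_, max_le ih.2.2 ?_⟩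
    · rcases Nat.lt_succ_iff_lt_or_eq.1 hi with hi | hi
      · exact le_max_of_le_left (ih.2.1 i hi)
      · subst hi; exact le_max_right _ _
    · exact le_ciSup (f := fun i => pointVariation B (F.val i)) (Set.finite_range _).bddAbove ⟨k, h⟩
  · exact ⟨ih.1, fun i hi => ih.2.1 i (by omega), ih.2.2⟩

/-- Real array `65` receives the estimate of the local constant bound. -/
def constantVariationProg : FProg :=
  .cond (.natEq (reg 60) 0)
    (.setR 65 0 0 (((.get 63 0 0 + .get 63 0 1) / 2 * (.get 63 0 3 - .get 63 0 2) +
      (.get 6 0 1 - .get 63 0 2) * (.get 63 0 1 - .get 63 0 0)) / 2))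
    (.cond (.natEq (reg 60) 1)
      (.setR 65 0 0 ((.get 63 0 3 - .get 63 0 2 +
        .get 6 0 0 * (.get 63 0 1 - .get 63 0 0)) / 2))
      (.cond (.natEq (reg 60) 2)
        (.setR 65 0 0 ((.get 63 0 3 - .get 63 0 2 +
          .get 6 0 1 * (.get 63 0 1 - .get 63 0 0)) / 2))
        (.setR 65 0 0 (((.get 63 0 0 + .get 63 0 1) / 2 * (.get 63 0 3 - .get 63 0 2) +
          (.get 6 0 0 - .get 63 0 2) * (.get 63 0 1 - .get 63 0 0)) / 2))))

theorem constantVariationProg_run (s : Store) {B : Box} (hB : HasBox s B) :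
    (constantVariationProg.run s).real 65 0 0 =
      constantVariation (s.real 6 0 0) (s.real 6 0 1) B := by
  have hc := hB.code
  rcases B with ⟨t, a, b, c, d⟩
  cases t <;> simp only [SliceType.code] at hc <;>
    simp [constantVariationProg, hc, hB.lmin, hB.lmax, hB.mmin, hB.mmax, constantVariation,
      Box.lmid]

/-- The term that a bound adds to the distance at the center. -/
def boundTerm (kind : BoundKind) (F₁ F₂ : BiFiltration) (B : Box) : ℝ :=
  match kind with
  | .linear => variation F₁ B + variation F₂ B
  | .constant => 2 * constantVariation (maxX F₁ F₂) (maxY F₁ F₂) B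

theorem upperBound_eq (kind : BoundKind) (F₁ F₂ : BiFiltration) (p : ℕ) (B : Box) :
    upperBound kind F₁ F₂ p B = evalDist F₁ F₂ p B.type B.lmid B.mmid +
      ENNReal.ofReal (boundTerm kind F₁ F₂ B) := by
  cases kind <;> rfl

/-- Real array `66` receives the nonnegative part of the term that the bound adds. -/
def boundTermProg (kind : BoundKind) : FProg :=
  .setR 66 0 0 0 ;;
  match kind with
  | .linear => variationProg 1 ;; .setR 65 0 0 (.get 62 0 0) ;; variationProg 2 ;;
      maxProg 66 (.get 65 0 0 + .get 62 0 0)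
  | .constant => constantVariationProg ;; maxProg 66 (2 * .get 65 0 0)

/-- The maximum with `0` matches the truncation by `ENNReal.ofReal` in `upperBound`. -/
theorem boundTermProg_run (kind : BoundKind) (s : Store) {B : Box} {F₁ F₂ : BiFiltration}
    (hF₁ : HasInput s 1 F₁) (hF₂ : HasInput s 2 F₂) (hB : HasBox s B) (hl : B.lmin ≤ B.lmax)
    (hm : B.mmin ≤ B.mmax) (hN : s.nat 5 0 0 = F₁.n + F₂.n) (hX : s.real 6 0 0 = maxX F₁ F₂)
    (hY : s.real 6 0 1 = maxY F₁ F₂) :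
    ((boundTermProg kind).run s).real 66 0 0 = max 0 (boundTerm kind F₁ F₂ B) := by
  cases kind with
  | linear =>
    simp only [boundTermProg, run_seq, boundTerm]
    set s₀ := (FProg.setR 66 0 0 0).run s with hs₀
    have h1 := variationProg_run s₀ (.inl rfl) (hF₁.congr (run_nat 0 rfl) (run_nat 1 rfl)
      (run_real 1 rfl)) (hB.congr (run_nat 60 rfl) (run_real 63 rfl)) hl hm
      (by rw [run_nat 5 rfl, hN]; omega)
    have e5 : ((variationProg 1).run s₀).nat 5 = s.nat 5 := run_nat 5 rfl
    have e66 : ((variationProg 1).run s₀).real 66 0 0 = 0 := by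
      rw [run_real 66 rfl]; simp [hs₀]
    have hF₂' : HasInput ((variationProg 1).run s₀) 2 F₂ :=
      hF₂.congr (run_nat 0 rfl) (run_nat 2 rfl) (run_real 2 rfl)
    have hB' : HasBox ((variationProg 1).run s₀) B :=
      hB.congr (run_nat 60 rfl) (run_real 63 rfl)
    generalize (variationProg 1).run s₀ = s₁ at *
    set s₂ := (FProg.setR 65 0 0 (.get 62 0 0)).run s₁ with hs₂
    have h2 := variationProg_run s₂ (.inr rfl) (hF₂'.congr (run_nat 0 rfl) (run_nat 2 rfl)
      (run_real 2 rfl)) (hB'.congr (run_nat 60 rfl) (run_real 63 rfl)) hl hm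
      (by rw [run_nat 5 rfl, e5, hN]; omega)
    have f65 : ((variationProg 2).run s₂).real 65 0 0 = variation F₁ B := by
      rw [run_real 65 rfl]; simp [hs₂, h1]
    have f66 : ((variationProg 2).run s₂).real 66 0 0 = 0 := by
      rw [run_real 66 rfl]; simp [hs₂, e66]
    rw [maxProg_real]
    simp [f65, f66, h2]
  | constant =>
    simp only [boundTermProg, run_seq, boundTerm]
    set s₀ := (FProg.setR 66 0 0 0).run s with hs₀
    have h1 := constantVariationProg_run s₀ (hB.congr (run_nat 60 rfl) (run_real 63 rfl))
    rw [run_real 6 rfl, hX, hY] at h1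
    have f66 : (constantVariationProg.run s₀).real 66 0 0 = 0 := by
      rw [run_real 66 rfl]; simp [hs₀]
    rw [maxProg_real]
    simp [h1, f66]

/-! ## The number of iterations -/

/-- `B` is a box of parameters that arises from the initial boxes by `d` subdivisions. -/
structure IsSubBox (X Y : ℝ) (d : ℕ) (B : Box) : Prop where
  lmin_nonneg : 0 ≤ B.lmin
  lmin_le : B.lmin ≤ B.lmax
  lmax_le : B.lmax ≤ 1
  lwidth : B.lmax - B.lmin ≤ 1 / 2 ^ d
  mmin_nonneg : 0 ≤ B.mmin
  mmin_le : B.mmin ≤ B.mmax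
  mmax_le : B.mmax ≤ match B.type with
    | .ySteep | .yFlat => Y
    | .xSteep | .xFlat => X
  mwidth : B.mmax - B.mmin ≤ max X Y / 2 ^ d

theorem IsSubBox.split {X Y : ℝ} {d : ℕ} {B : Box} (h : IsSubBox X Y d B) :
    ∀ B' ∈ B.split, IsSubBox X Y (d + 1) B' := by
  obtain ⟨h1, h2, h3, h4, h5, h6, h7, h8⟩ := h
  have e1 : (1 : ℝ) / 2 ^ (d + 1) = 1 / 2 ^ d / 2 := by rw [pow_succ]; field_simp
  have e2 : max X Y / 2 ^ (d + 1) = max X Y / 2 ^ d / 2 := by rw [pow_succ]; field_simp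
  intro B' hB'
  simp only [Box.split, List.mem_cons, List.not_mem_nil, or_false, Box.lmid, Box.mmid] at hB'
  rcases hB' with rfl | rfl | rfl | rfl <;> refine ⟨?_, ?_, ?_, ?_, ?_, ?_, ?_, ?_⟩ <;>
  simp only [e1, e2] <;> linarith

theorem abs_mul_sub_mul_le {l l' u u' a b C : ℝ} (hl : |l - l'| ≤ a) (hu : |u - u'| ≤ b)
    (hl' : |l'| ≤ 1) (hu' : |u| ≤ C) : |l * u - l' * u'| ≤ a * C + b := by
  have e : l * u - l' * u' = (l - l') * u + l' * (u - u') := by ring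
  rw [e]
  refine (abs_add_le _ _).trans (add_le_add ?_ ?_)
  · rw [abs_mul]
    exact mul_le_mul hl hu' (abs_nonneg _) ((abs_nonneg _).trans hl)
  · rw [abs_mul]
    exact (mul_le_of_le_one_left (abs_nonneg _) hl').trans hu

/-- The maximum is 1-Lipschitz, so the two entries are treated separately. The half-widths
contribute `C/2ᵈ/2` each: the deviation of `l` is multiplied by a factor of size at most `C`, that
of `m` by one of size at most `1`. In the entry `l * (y - m)` the first factor is bounded because
`m` does not exceed the extent of the bi-filtrations. -/
theorem abs_wpush_sub_le {X Y : ℝ} {d : ℕ} {B : Box} (h : IsSubBox X Y d B) {q : ℝ × ℝ}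
    (hq : 0 ≤ q) (hX : q.1 ≤ X) (hY : q.2 ≤ Y) {l m : ℝ} (hl : l ∈ Set.Icc B.lmin B.lmax)
    (hm : m ∈ Set.Icc B.mmin B.mmax) :
    |wpush B.type l m q - wpush B.type B.lmid B.mmid q| ≤ max X Y / 2 ^ d := by
  obtain ⟨h1, h2, h3, h4, h5, h6, h7, h8⟩ := h
  have q1 : 0 ≤ q.1 := hq.1
  have q2 : 0 ≤ q.2 := hq.2
  have cX := le_max_left X Y
  have cY := le_max_right X Y
  set C := max X Y
  have hC : 0 ≤ C := q1.trans (hX.trans cX)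
  have dl : |l - B.lmid| ≤ 1 / 2 ^ d / 2 := by
    rw [Box.lmid, abs_le]; constructor <;> linarith [hl.1, hl.2]
  have dm : |m - B.mmid| ≤ C / 2 ^ d / 2 := by
    rw [Box.mmid, abs_le]; constructor <;> linarith [hm.1, hm.2]
  have hc : |B.lmid| ≤ 1 := by
    rw [Box.lmid, abs_le]; constructor <;> linarith
  have e : 1 / 2 ^ d / 2 * C + C / 2 ^ d / 2 = C / 2 ^ d := by ring
  have e' : 1 / 2 ^ d / 2 * C + 0 ≤ C / 2 ^ d := by
    rw [← e]; exact add_le_add le_rfl (by positivity)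
  have e'' : C / 2 ^ d / 2 ≤ C / 2 ^ d := half_le_self (by positivity)
  have e0 : (0 : ℝ) ≤ C / 2 ^ d := by positivity
  have ds : ∀ y, |y - m - (y - B.mmid)| ≤ C / 2 ^ d / 2 := by
    intro y; rw [show y - m - (y - B.mmid) = -(m - B.mmid) by ring, abs_neg]; exact dm
  have fy : ∀ y, 0 ≤ y → y ≤ C → |l * y - B.lmid * y| ≤ C / 2 ^ d := fun y hy hy' =>
    (abs_mul_sub_mul_le dl (by rw [sub_self, abs_zero]) hc
      (by rw [abs_of_nonneg hy]; exact hy')).trans e'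
  have f0 : ∀ y : ℝ, |y - y| ≤ C / 2 ^ d := fun y => by simpa using e0
  have fm : ∀ y M, 0 ≤ y → y ≤ M → M ≤ C → B.mmax ≤ M →
      |l * (y - m) - B.lmid * (y - B.mmid)| ≤ C / 2 ^ d := fun y M hy hy' hM hM' => by
    rw [← e]
    refine abs_mul_sub_mul_le dl (ds y) hc ?_
    rw [abs_le]
    constructor <;> linarith [hm.1, hm.2]
  rcases ht : B.type with _ | _ | _ | _ <;> simp only [ht, wpush] at h7 ⊢ <;>
  refine (abs_max_sub_max_le_max _ _ _ _).trans (max_le ?_ ?_)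
  · exact fm _ _ q2 hY cY h7
  · exact f0 _
  · exact (ds _).trans e''
  · exact fy _ q1 (hX.trans cX)
  · exact fy _ q2 (hY.trans cY)
  · exact (ds _).trans e''
  · exact f0 _
  · exact fm _ _ q1 hX cX h7

section

variable {F₁ F₂ : BiFiltration}

theorem val_le_max (F₁ F₂ : BiFiltration) :
    (∀ i, (F₁.val i).1 ≤ maxX F₁ F₂) ∧ (∀ i, (F₂.val i).1 ≤ maxX F₁ F₂) ∧
    (∀ i, (F₁.val i).2 ≤ maxY F₁ F₂) ∧ ∀ i, (F₂.val i).2 ≤ maxY F₁ F₂ :=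
  ⟨fun i => le_max_of_le_left
      (le_ciSup (f := fun i => (F₁.val i).1) (Set.finite_range _).bddAbove i),
    fun i => le_max_of_le_right
      (le_ciSup (f := fun i => (F₂.val i).1) (Set.finite_range _).bddAbove i),
    fun i => le_max_of_le_left
      (le_ciSup (f := fun i => (F₁.val i).2) (Set.finite_range _).bddAbove i),
    fun i => le_max_of_le_right
      (le_ciSup (f := fun i => (F₂.val i).2) (Set.finite_range _).bddAbove i)⟩

theorem maxX_nonneg (h : F₁.InQuadrant) : 0 ≤ maxX F₁ F₂ :=
  le_max_of_le_left (Real.iSup_nonneg fun i => (h i).1)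

theorem maxY_nonneg (h : F₁.InQuadrant) : 0 ≤ maxY F₁ F₂ :=
  le_max_of_le_left (Real.iSup_nonneg fun i => (h i).2)

theorem variation_le {F : BiFiltration} {X Y : ℝ} {d : ℕ} {B : Box} (h : IsSubBox X Y d B)
    (hF : F.InQuadrant) (hX : ∀ i, (F.val i).1 ≤ X) (hY : ∀ i, (F.val i).2 ≤ Y)
    (hX0 : 0 ≤ X) : variation F B ≤ max X Y / 2 ^ d := by
  have hC : 0 ≤ max X Y := le_max_of_le_left hX0
  refine Real.iSup_le (fun i => ?_) (by positivity)
  refine csSup_le ?_ ?_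
  · exact ⟨_, (B.lmin, B.mmin), ⟨Set.left_mem_Icc.2 h.lmin_le, Set.left_mem_Icc.2 h.mmin_le⟩, rfl⟩
  · rintro _ ⟨L, ⟨h1, h2⟩, rfl⟩
    exact abs_wpush_sub_le h (hF i) (hX i) (hY i) h1 h2

theorem two_mul_constantVariation_le {X Y : ℝ} {d : ℕ} {B : Box} (h : IsSubBox X Y d B)
    (hX0 : 0 ≤ X) (hY0 : 0 ≤ Y) : 2 * constantVariation X Y B ≤ 2 * (max X Y / 2 ^ d) := by
  obtain ⟨h1, h2, h3, h4, h5, h6, h7, h8⟩ := h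
  have cX := le_max_left X Y
  have cY := le_max_right X Y
  have hC : 0 ≤ max X Y := hX0.trans cX
  have g : ∀ x, 0 ≤ x → x ≤ max X Y → x * (B.lmax - B.lmin) ≤ max X Y / 2 ^ d := fun x hx hx' => by
    rw [← mul_one_div]
    exact mul_le_mul hx' h4 (by linarith) hC
  have g' : B.lmid * (B.mmax - B.mmin) ≤ max X Y / 2 ^ d :=
    (mul_le_of_le_one_left (by linarith) (by rw [Box.lmid]; linarith)).trans h8
  rcases ht : B.type with _ | _ | _ | _ <;> simp only [ht, constantVariation] at h7 ⊢
  · linarith [g (Y - B.mmin) (by linarith) (by linarith)]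
  · linarith [g X hX0 cX]
  · linarith [g Y hY0 cY]
  · linarith [g (X - B.mmin) (by linarith) (by linarith)]

theorem boundTerm_le (kind : BoundKind) {d : ℕ} {B : Box}
    (h : IsSubBox (maxX F₁ F₂) (maxY F₁ F₂) d B) (h₁ : F₁.InQuadrant) (h₂ : F₂.InQuadrant) :
    boundTerm kind F₁ F₂ B ≤ 2 * (max (maxX F₁ F₂) (maxY F₁ F₂) / 2 ^ d) := by
  obtain ⟨a, b, c, e⟩ := val_le_max F₁ F₂
  cases kind with
  | linear =>
    have := variation_le h h₁ a c (maxX_nonneg h₁)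
    have := variation_le h h₂ b e (maxX_nonneg h₁)
    simp only [boundTerm]
    linarith
  | constant => exact two_mul_constantVariation_le h (maxX_nonneg h₁) (maxY_nonneg h₁)

/-- The current maximum already dominates the distance at the center, which therefore cancels from
the test. If that distance is infinite, the strict inequality fails anyway. -/
theorem lt_boundTerm {kind : BoundKind} {p : ℕ} {ε : ℝ} {B : Box} {ρ : ℝ≥0∞}
    (h : max ρ (evalDist F₁ F₂ p B.type B.lmid B.mmid) + ENNReal.ofReal ε <
      upperBound kind F₁ F₂ p B) : ε < boundTerm kind F₁ F₂ B := by
  rw [upperBound_eq] at h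
  have h1 := (add_le_add_left (le_max_right ρ (evalDist F₁ F₂ p B.type B.lmid B.mmid))
    (ENNReal.ofReal ε)).trans_lt h
  exact lt_of_not_ge fun h2 => (h1.trans_le (add_le_add_right (ENNReal.ofReal_le_ofReal h2) _)).false

/-- The number of nodes of a complete quaternary tree of height `m`. -/
def treeSize : ℕ → ℕ
  | 0 => 1
  | m + 1 => 1 + 4 * treeSize m

theorem three_mul_treeSize (m : ℕ) : 3 * treeSize m + 1 = 4 ^ (m + 1) := by
  induction m with
  | zero => rfl
  | succ m ih => rw [treeSize, pow_succ, ← ih]; ring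

theorem treeSize_pos (m : ℕ) : 0 < treeSize m := by
  cases m <;> simp [treeSize]

/-- The boxes in the queue arise by at most `D` subdivisions, and at most `M` further iterations are
needed for them. -/
def QueueBound (X Y : ℝ) (D : ℕ) (Q : List Box) (M : ℕ) : Prop :=
  ∃ ds : List ℕ, List.Forall₂ (IsSubBox X Y) ds Q ∧ (∀ d ∈ ds, d ≤ D) ∧
    (ds.map fun d => treeSize (D - d)).sum ≤ M

theorem QueueBound.init (hX : 0 ≤ maxX F₁ F₂) (hY : 0 ≤ maxY F₁ F₂) (D : ℕ) :
    QueueBound (maxX F₁ F₂) (maxY F₁ F₂) D (initialState F₁ F₂).queue (4 * treeSize D) := by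
  refine ⟨[0, 0, 0, 0], ?_, by simp, by simp; omega⟩
  simp only [initialState, List.forall₂_cons, List.forall₂_nil_right_iff, and_true]
  refine ⟨⟨?_, ?_, ?_, ?_, ?_, ?_, ?_, ?_⟩, ⟨?_, ?_, ?_, ?_, ?_, ?_, ?_, ?_⟩,
    ⟨?_, ?_, ?_, ?_, ?_, ?_, ?_, ?_⟩, ⟨?_, ?_, ?_, ?_, ?_, ?_, ?_, ?_⟩⟩ <;> simp [hX, hY]

/-- The potential is the total size of the complete trees that may still grow below the queued
boxes. A pop consumes a root, and a split replaces a tree by its four subtrees. At depth `D` the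
bound term is at most `2C/2ᴰ ≤ ε`, so no split occurs there. -/
theorem QueueBound.step {kind : BoundKind} {p : ℕ} {ε : ℝ} {D M : ℕ} {S : AlgState}
    (h₁ : F₁.InQuadrant) (h₂ : F₂.InQuadrant)
    (hD : 2 * max (maxX F₁ F₂) (maxY F₁ F₂) ≤ ε * 2 ^ D) (hS : S.queue ≠ [])
    (h : QueueBound (maxX F₁ F₂) (maxY F₁ F₂) D S.queue M) :
    1 ≤ M ∧ QueueBound (maxX F₁ F₂) (maxY F₁ F₂) D (iterate kind F₁ F₂ p ε S).queue (M - 1) := by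
  obtain ⟨Q, ρ⟩ := S
  cases Q with
  | nil => exact absurd rfl hS
  | cons B rest =>
  obtain ⟨ds, h3, h4, h5⟩ := h
  cases h3 with
  | @cons d _ ds _ hB hrest =>
  simp only [List.mem_cons, forall_eq_or_imp, List.map_cons, List.sum_cons] at h4 h5
  have hpos := treeSize_pos (D - d)
  refine ⟨by omega, ?_⟩
  simp only [iterate]
  split_ifs with hlt
  · have hdD : d < D := by
      by_contra! hle
      have hd : d = D := le_antisymm h4.1 hle
      have h6 := (lt_boundTerm hlt).trans_le (boundTerm_le kind hB h₁ h₂)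
      rw [hd, ← mul_div_assoc, lt_div_iff₀ (by positivity)] at h6
      exact h6.not_ge hD
    refine ⟨ds ++ [d + 1, d + 1, d + 1, d + 1], ?_, ?_, ?_⟩
    · refine List.rel_append hrest ?_
      have := hB.split
      simp only [Box.split, List.mem_cons, List.not_mem_nil, or_false, forall_eq_or_imp,
        forall_eq] at this
      simpa [Box.split] using this
    · simp only [List.mem_append, List.mem_cons, List.not_mem_nil, or_false]
      rintro d' (hd' | hd')
      · exact h4.2 d' hd'
      · omega
    · have e : D - d = (D - (d + 1)) + 1 := by omega
      rw [e, treeSize] at h5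
      simp
      omega
  · exact ⟨ds, hrest, h4.2, by omega⟩

theorem stateAfter_succ (kind : BoundKind) (F₁ F₂ : BiFiltration) (p : ℕ) (ε : ℝ) (k : ℕ) :
    stateAfter kind F₁ F₂ p ε (k + 1) =
      iterate kind F₁ F₂ p ε (stateAfter kind F₁ F₂ p ε k) := by
  rw [stateAfter, Function.iterate_succ_apply']; rfl

theorem queueBound_stateAfter {kind : BoundKind} {p : ℕ} {ε : ℝ} {D : ℕ}
    (h₁ : F₁.InQuadrant) (h₂ : F₂.InQuadrant)
    (hD : 2 * max (maxX F₁ F₂) (maxY F₁ F₂) ≤ ε * 2 ^ D) {k : ℕ}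
    (hk : ∀ j < k, (stateAfter kind F₁ F₂ p ε j).queue ≠ []) : k ≤ 4 * treeSize D ∧
    QueueBound (maxX F₁ F₂) (maxY F₁ F₂) D (stateAfter kind F₁ F₂ p ε k).queue
      (4 * treeSize D - k) := by
  induction k with
  | zero => exact ⟨zero_le, QueueBound.init (maxX_nonneg h₁) (maxY_nonneg h₁) D⟩
  | succ k ih =>
    obtain ⟨h3, h4⟩ := ih fun j hj => hk j (by omega)
    obtain ⟨h5, h6⟩ := h4.step (kind := kind) (p := p) h₁ h₂ hD (hk k (by omega))
    rw [stateAfter_succ]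
    exact ⟨by omega, by rwa [Nat.sub_sub] at h6⟩

/-- The algorithm terminates, and the number of iterations is bounded; before that, all boxes in the
queue are boxes of admissible parameters. -/
theorem exists_iterations (kind : BoundKind) (p : ℕ) {ε : ℝ} (hε : 0 < ε) (h₁ : F₁.InQuadrant)
    (h₂ : F₂.InQuadrant) : ∃ N : ℕ, (stateAfter kind F₁ F₂ p ε N).queue = [] ∧
      (∀ k < N, (stateAfter kind F₁ F₂ p ε k).queue ≠ [] ∧
        ∀ B ∈ (stateAfter kind F₁ F₂ p ε k).queue, B.lmin ≤ B.lmax ∧ B.mmin ≤ B.mmax) ∧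
      (N : ℝ) ≤ 86 * (max 1 (max (maxX F₁ F₂) (maxY F₁ F₂) / ε)) ^ 2 := by
  set C := max (maxX F₁ F₂) (maxY F₁ F₂) with hC
  set x := max 1 (C / ε) with hx
  have hx1 : 1 ≤ x := le_max_left _ _
  -- The depth is `D = n + 1` with `2ⁿ ≤ 2x < 2ᴰ`: the right inequality stops the subdivision at
  -- depth `D`, the left one keeps `4ᴰ` of order `x²`.
  obtain ⟨n, hn, hn'⟩ := exists_nat_pow_near (show (1 : ℝ) ≤ 2 * x by linarith) one_lt_two
  have hD : 2 * C ≤ ε * 2 ^ (n + 1) := by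
    have h3 : C / ε ≤ x := le_max_right _ _
    rw [div_le_iff₀ hε] at h3
    nlinarith
  have hex : ∃ k, (stateAfter kind F₁ F₂ p ε k).queue = [] := by
    by_contra! hne
    have := (queueBound_stateAfter (kind := kind) (p := p) h₁ h₂ hD
      (k := 4 * treeSize (n + 1) + 1) fun j _ => hne j).1
    omega
  classical
  have hmin : ∀ k < Nat.find hex, (stateAfter kind F₁ F₂ p ε k).queue ≠ [] := fun k hk =>
    Nat.find_min hex hk
  refine ⟨Nat.find hex, Nat.find_spec hex, fun k hk => ⟨hmin k hk, ?_⟩, ?_⟩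
  · obtain ⟨-, ds, h3, -⟩ := queueBound_stateAfter (kind := kind) (p := p) h₁ h₂ hD (k := k)
      fun j hj => hmin j (hj.trans hk)
    intro B hB
    have key : ∀ (ds : List ℕ) (Q : List Box),
        List.Forall₂ (IsSubBox (maxX F₁ F₂) (maxY F₁ F₂)) ds Q → ∀ B ∈ Q,
        B.lmin ≤ B.lmax ∧ B.mmin ≤ B.mmax := by
      intro ds Q h
      induction h with
      | nil => simp
      | cons h _ ih =>
        simp only [List.mem_cons, forall_eq_or_imp]
        exact ⟨⟨h.lmin_le, h.mmin_le⟩, ih⟩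
    exact key ds _ h3 B hB
  -- With `N` iterations, `3N ≤ 4·4ⁿ⁺² = 64·(2ⁿ)² ≤ 256x²`, and `256/3 < 86`.
  · have h3 := (queueBound_stateAfter (kind := kind) (p := p) h₁ h₂ hD hmin).1
    have h4 := three_mul_treeSize (n + 1)
    have h5 : 3 * Nat.find hex ≤ 4 * 4 ^ (n + 2) := by
      have : (4 : ℕ) ^ (n + 1 + 1) = 4 ^ (n + 2) := rfl
      omega
    have h6 : (3 : ℝ) * Nat.find hex ≤ 4 * 4 ^ (n + 2) := by exact_mod_cast h5
    have h7 : (4 : ℝ) ^ (n + 2) = 16 * (2 ^ n) ^ 2 := by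
      rw [← pow_mul, mul_comm n 2, pow_mul, pow_add]; norm_num; ring
    have h8 : ((2 : ℝ) ^ n) ^ 2 ≤ (2 * x) ^ 2 := pow_le_pow_left₀ (by positivity) hn 2
    nlinarith

end

/-! ## The queue in memory -/

/-- Row `r` of the arrays `3` holds the box `B`. -/
structure RowBox (s : Store) (r : ℕ) (B : Box) : Prop where
  code : s.nat 3 r 0 = B.type.code
  lmin : s.real 3 r 0 = B.lmin
  lmax : s.real 3 r 1 = B.lmax
  mmin : s.real 3 r 2 = B.mmin
  mmax : s.real 3 r 3 = B.mmax

/-- The queue `Q` is stored in the arrays `3`, from the row `k` to the row before the one given by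
register `6`. -/
structure QueueMem (s : Store) (k : ℕ) (Q : List Box) : Prop where
  tail : s.nat 6 0 0 = k + Q.length
  row : ∀ i (h : i < Q.length), RowBox s (k + i) Q[i]

/-- Append a box to the queue. -/
def enqueueProg (c : NatExpr) (e₀ e₁ e₂ e₃ : RealExpr) : FProg :=
  .setN 3 (reg 6) 0 c ;; .setR 3 (reg 6) 0 e₀ ;; .setR 3 (reg 6) 1 e₁ ;; .setR 3 (reg 6) 2 e₂ ;;
    .setR 3 (reg 6) 3 e₃ ;; .setN 6 0 0 (reg 6 + 1)

/-- Two memories agree on the type and the sides of the current box, and on the extent of the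
bi-filtrations. -/
structure SameBox (s s' : Store) : Prop where
  nat : s'.nat 60 = s.nat 60
  real : s'.real 63 = s.real 63
  extent : s'.real 6 = s.real 6

/-- Each side of the box is evaluated after the preceding writes. The hypotheses therefore quantify
over all memories that agree with `s` on the arrays that these expressions read. -/
theorem enqueueProg_run (s : Store) {c : NatExpr} {e₀ e₁ e₂ e₃ : RealExpr} {B : Box} {k : ℕ}
    {Q : List Box} (hQ : QueueMem s k Q) (hc : c.eval s = B.type.code)
    (h₀ : ∀ s', SameBox s s' → e₀.eval s' = B.lmin)
    (h₁ : ∀ s', SameBox s s' → e₁.eval s' = B.lmax)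
    (h₂ : ∀ s', SameBox s s' → e₂.eval s' = B.mmin)
    (h₃ : ∀ s', SameBox s s' → e₃.eval s' = B.mmax) :
    QueueMem ((enqueueProg c e₀ e₁ e₂ e₃).run s) k (Q ++ [B]) ∧
    SameBox s ((enqueueProg c e₀ e₁ e₂ e₃).run s) ∧ ∀ r < k + Q.length,
      ((enqueueProg c e₀ e₁ e₂ e₃).run s).nat 3 r = s.nat 3 r ∧
      ((enqueueProg c e₀ e₁ e₂ e₃).run s).real 3 r = s.real 3 r := by
  have ht := hQ.tail
  simp only [enqueueProg, run_seq, run_setN, NatExpr.eval_get, NatExpr.eval_ofNat, ht, hc,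
    run_setR, ne_eq, Nat.reduceEqDiff, not_false_eq_true, Store.setNat_nat_ne, Store.setReal_nat,
    NatExpr.eval_add]
  set s₀ := s.setNat 3 (k + Q.length) 0 B.type.code with hs₀
  rw [h₀ s₀ ⟨by simp [hs₀], by simp [hs₀], by simp [hs₀]⟩]
  set s₁ := s₀.setReal 3 (k + Q.length) 0 B.lmin with hs₁
  rw [h₁ s₁ ⟨by simp [hs₀, hs₁], by simp [hs₀, hs₁], by simp [hs₀, hs₁]⟩]
  set s₂ := s₁.setReal 3 (k + Q.length) 1 B.lmax with hs₂
  rw [h₂ s₂ ⟨by simp [hs₀, hs₁, hs₂], by simp [hs₀, hs₁, hs₂], by simp [hs₀, hs₁, hs₂]⟩]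
  set s₃ := s₂.setReal 3 (k + Q.length) 2 B.mmin with hs₃
  rw [h₃ s₃ ⟨by simp [hs₀, hs₁, hs₂, hs₃], by simp [hs₀, hs₁, hs₂, hs₃],
    by simp [hs₀, hs₁, hs₂, hs₃]⟩]
  refine ⟨⟨by simp [add_assoc], fun i h => ?_⟩, ⟨?_, ?_, ?_⟩, fun r hr => ⟨?_, ?_⟩⟩
  · rw [List.length_append, List.length_singleton] at h
    by_cases hi : i < Q.length
    · have := hQ.row i hi
      simp only [List.getElem_append_left hi]
      have hne : i ≠ Q.length := hi.ne
      refine ⟨?_, ?_, ?_, ?_, ?_⟩ <;>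
        simp [hs₀, hs₁, hs₂, hs₃, hne, this.code, this.lmin, this.lmax, this.mmin, this.mmax]
    · obtain rfl : i = Q.length := by omega
      refine ⟨?_, ?_, ?_, ?_, ?_⟩ <;> simp [hs₀, hs₁, hs₂, hs₃]
  · simp [hs₀, hs₁, hs₂, hs₃]
  · simp [hs₀, hs₁, hs₂, hs₃]
  · simp [hs₀, hs₁, hs₂, hs₃]
  · funext j
    simp [hs₀, hr.ne]
  · funext j
    simp [hs₀, hs₁, hs₂, hs₃, hr.ne]

/-- Append the sub-boxes of the current box to the queue. -/
def splitProg : FProg :=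
  enqueueProg (reg 60) (.get 63 0 0) ((.get 63 0 0 + .get 63 0 1) / 2) (.get 63 0 2)
    ((.get 63 0 2 + .get 63 0 3) / 2) ;;
  enqueueProg (reg 60) ((.get 63 0 0 + .get 63 0 1) / 2) (.get 63 0 1) (.get 63 0 2)
    ((.get 63 0 2 + .get 63 0 3) / 2) ;;
  enqueueProg (reg 60) (.get 63 0 0) ((.get 63 0 0 + .get 63 0 1) / 2)
    ((.get 63 0 2 + .get 63 0 3) / 2) (.get 63 0 3) ;;
  enqueueProg (reg 60) ((.get 63 0 0 + .get 63 0 1) / 2) (.get 63 0 1)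
    ((.get 63 0 2 + .get 63 0 3) / 2) (.get 63 0 3)

theorem splitProg_run (s : Store) {B : Box} {k : ℕ} {Q : List Box} (hB : HasBox s B)
    (hQ : QueueMem s k Q) : QueueMem (splitProg.run s) k (Q ++ B.split) ∧
    ∀ r < k + Q.length, (splitProg.run s).nat 3 r = s.nat 3 r ∧
      (splitProg.run s).real 3 r = s.real 3 r := by
  have key : ∀ t : Store, HasBox t B → ∀ e₀ e₁ e₂ e₃ l₀ l₁ m₀ m₁ Q, QueueMem t k Q →
      (∀ s', HasBox s' B → e₀.eval s' = l₀) → (∀ s', HasBox s' B → e₁.eval s' = l₁) →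
      (∀ s', HasBox s' B → e₂.eval s' = m₀) → (∀ s', HasBox s' B → e₃.eval s' = m₁) →
      ∃ t', (enqueueProg (reg 60) e₀ e₁ e₂ e₃).run t = t' ∧ HasBox t' B ∧
        QueueMem t' k (Q ++ [⟨B.type, l₀, l₁, m₀, m₁⟩]) ∧
        ∀ r < k + Q.length, t'.nat 3 r = t.nat 3 r ∧ t'.real 3 r = t.real 3 r := by
    intro t hB e₀ e₁ e₂ e₃ l₀ l₁ m₀ m₁ Q hQ h₀ h₁ h₂ h₃
    obtain ⟨a, b, c⟩ := enqueueProg_run t (c := reg 60) (e₀ := e₀) (e₁ := e₁) (e₂ := e₂) (e₃ := e₃)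
      (B := ⟨B.type, l₀, l₁, m₀, m₁⟩) hQ
      hB.code (fun s' hs' => h₀ s' (hB.congr hs'.nat hs'.real))
      (fun s' hs' => h₁ s' (hB.congr hs'.nat hs'.real))
      (fun s' hs' => h₂ s' (hB.congr hs'.nat hs'.real))
      (fun s' hs' => h₃ s' (hB.congr hs'.nat hs'.real))
    exact ⟨_, rfl, hB.congr b.nat b.real, a, c⟩
  have v0 : ∀ s', HasBox s' B → (RealExpr.get 63 0 0).eval s' = B.lmin := fun s' h => h.lmin
  have v1 : ∀ s', HasBox s' B → (RealExpr.get 63 0 1).eval s' = B.lmax := fun s' h => h.lmax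
  have v2 : ∀ s', HasBox s' B → (RealExpr.get 63 0 2).eval s' = B.mmin := fun s' h => h.mmin
  have v3 : ∀ s', HasBox s' B → (RealExpr.get 63 0 3).eval s' = B.mmax := fun s' h => h.mmax
  have w0 : ∀ s', HasBox s' B →
      RealExpr.eval s' ((.get 63 0 0 + .get 63 0 1) / 2) = B.lmid := fun s' h => by
    simp [h.lmin, h.lmax, Box.lmid]
  have w1 : ∀ s', HasBox s' B →
      RealExpr.eval s' ((.get 63 0 2 + .get 63 0 3) / 2) = B.mmid := fun s' h => by
    simp [h.mmin, h.mmax, Box.mmid]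
  simp only [splitProg, run_seq]
  obtain ⟨s₁, g1, b1, q1, r1⟩ := key s hB _ _ _ _ _ _ _ _ _ hQ v0 w0 v2 w1
  obtain ⟨s₂, g2, b2, q2, r2⟩ := key s₁ b1 _ _ _ _ _ _ _ _ _ q1 w0 v1 v2 w1
  obtain ⟨s₃, g3, b3, q3, r3⟩ := key s₂ b2 _ _ _ _ _ _ _ _ _ q2 v0 w0 w1 v3
  obtain ⟨s₄, g4, b4, q4, r4⟩ := key s₃ b3 _ _ _ _ _ _ _ _ _ q3 w0 v1 w1 v3
  rw [g1, g2, g3, g4]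
  refine ⟨by simpa [Box.split] using q4, fun r hr => ?_⟩
  simp only [List.length_append, List.length_singleton] at r2 r3 r4
  obtain ⟨c1, d1⟩ := r1 r hr
  obtain ⟨c2, d2⟩ := r2 r (by omega)
  obtain ⟨c3, d3⟩ := r3 r (by omega)
  obtain ⟨c4, d4⟩ := r4 r (by omega)
  exact ⟨by rw [c4, c3, c2, c1], by rw [d4, d3, d2, d1]⟩

/-! ## One iteration -/

/-- The memory holds the input and the extent of the bi-filtrations. -/
structure Inputs (F₁ F₂ : BiFiltration) (p : ℕ) (ε : ℝ) (s : Store) : Prop where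
  left : HasInput s 1 F₁
  right : HasInput s 2 F₂
  dim : s.nat 0 0 2 = p
  size : s.nat 5 0 0 = F₁.n + F₂.n
  eps : s.real 0 0 0 = ε

/-- The program does not change the input. -/
def keepsInputs (P : FProg) : Bool :=
  !(P.wN 0) && !(P.wN 1) && !(P.wN 2) && !(P.wN 5) && !(P.wR 0) && !(P.wR 1) && !(P.wR 2)

theorem Inputs.run {F₁ F₂ : BiFiltration} {p : ℕ} {ε : ℝ} {s : Store} (h : Inputs F₁ F₂ p ε s)
    {P : FProg} (hP : keepsInputs P = true) : Inputs F₁ F₂ p ε (P.run s) := by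
  simp only [keepsInputs, Bool.and_eq_true, Bool.not_eq_true'] at hP
  obtain ⟨⟨⟨⟨⟨⟨h0, h1⟩, h2⟩, h5⟩, r0⟩, r1⟩, r2⟩ := hP
  refine ⟨h.left.congr (run_nat 0 h0) (run_nat 1 h1) (run_real 1 r1),
    h.right.congr (run_nat 0 h0) (run_nat 2 h2) (run_real 2 r2), ?_, ?_, ?_⟩
  · rw [run_nat 0 h0, h.dim]
  · rw [run_nat 5 h5, h.size]
  · rw [run_real 0 r0, h.eps]

/-- Copy the box at the head of the queue to the arrays `60` and `63`. -/
def popProg : FProg :=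
  .setN 60 0 0 (.get 3 (reg 4) 0) ;; .setR 63 0 0 (.get 3 (reg 4) 0) ;;
    .setR 63 0 1 (.get 3 (reg 4) 1) ;; .setR 63 0 2 (.get 3 (reg 4) 2) ;;
    .setR 63 0 3 (.get 3 (reg 4) 3)

theorem popProg_run (s : Store) {k : ℕ} {B : Box} (hk : s.nat 4 0 0 = k) (hB : RowBox s k B) :
    HasBox (popProg.run s) B := by
  refine ⟨?_, ?_, ?_, ?_, ?_⟩ <;>
  simp [popProg, hk, hB.code, hB.lmin, hB.lmax, hB.mmin, hB.mmax]

/-- Replace the current distance by its maximum with the distance in `36` and `30`. -/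
def updateProg : FProg :=
  .cond (.natEq (.get 4 0 1) 0)
    (.cond (.natEq (reg 36) 0) (maxProg 4 (.get 30 0 0)) (.setN 4 0 1 1)) .skip

theorem updateProg_run (s : Store) {ρ d : ℝ≥0∞}
    (hρ : RepresentsValue (s.nat 4 0 1) (s.real 4 0 0) ρ)
    (hd : RepresentsValue (s.nat 36 0 0) (s.real 30 0 0) d) :
    RepresentsValue ((updateProg.run s).nat 4 0 1) ((updateProg.run s).real 4 0 0) (max ρ d) ∧
    (updateProg.run s).nat 4 0 0 = s.nat 4 0 0 := by
  rcases hρ with ⟨h1, rfl⟩ | ⟨h1, h2, rfl⟩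
  · simp [updateProg, h1, RepresentsValue]
  · rcases hd with ⟨h3, rfl⟩ | ⟨h3, h4, rfl⟩
    · simp [updateProg, h1, h3, RepresentsValue]
    · simp [updateProg, h1, h3, RepresentsValue, h2, ENNReal.ofReal_max]

/-- Record the current distance in the row of the current box. -/
def recordProg : FProg :=
  .setN 3 (reg 4) 1 (.get 4 0 1) ;; .setR 3 (reg 4) 4 (.get 4 0 0)

/-- One iteration of the algorithm. -/
def bodyProg (kind : BoundKind) : FProg :=
  popProg ;; centerProg ;; evalProg ;; updateProg ;; recordProg ;; boundTermProg kind ;;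
    .cond (.and (.natEq (.get 4 0 1) 0)
      (.realLt (.get 4 0 0 + .get 0 0 0) (.get 30 0 0 + .get 66 0 0))) splitProg .skip ;;
    .setN 4 0 0 (reg 4 + 1)

/-- Row `k` of the record of the run. -/
def RecordedRow (kind : BoundKind) (F₁ F₂ : BiFiltration) (p : ℕ) (ε : ℝ) (s : Store) (k : ℕ) :
    Prop :=
  ∃ B rest, (stateAfter kind F₁ F₂ p ε k).queue = B :: rest ∧ RowBox s k B ∧
    RepresentsValue (s.nat 3 k 1) (s.real 3 k 4) (stateAfter kind F₁ F₂ p ε (k + 1)).rho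

/-- The memory after `k` iterations. -/
structure LoopInv (kind : BoundKind) (F₁ F₂ : BiFiltration) (p : ℕ) (ε : ℝ) (k : ℕ) (s : Store) :
    Prop where
  inputs : Inputs F₁ F₂ p ε s
  extentX : s.real 6 0 0 = maxX F₁ F₂
  extentY : s.real 6 0 1 = maxY F₁ F₂
  head : s.nat 4 0 0 = k
  queue : QueueMem s k (stateAfter kind F₁ F₂ p ε k).queue
  rho : RepresentsValue (s.nat 4 0 1) (s.real 4 0 0) (stateAfter kind F₁ F₂ p ε k).rho
  record : ∀ j < k, RecordedRow kind F₁ F₂ p ε s j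

/-- If the maximal distance is infinite, no box is split. Otherwise the distance at the center is
finite too, and the test is an inequality between nonnegative real numbers. -/
theorem split_iff {kind : BoundKind} {F₁ F₂ : BiFiltration} {p : ℕ} {ε : ℝ} {B : Box} {ρ : ℝ≥0∞}
    {b b' : ℕ} {r r' v : ℝ} (hε : 0 < ε)
    (hd : RepresentsValue b r (evalDist F₁ F₂ p B.type B.lmid B.mmid))
    (hρ : RepresentsValue b' r' (max ρ (evalDist F₁ F₂ p B.type B.lmid B.mmid)))
    (hv : v = max 0 (boundTerm kind F₁ F₂ B)) :
    max ρ (evalDist F₁ F₂ p B.type B.lmid B.mmid) + ENNReal.ofReal ε <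
      upperBound kind F₁ F₂ p B ↔ b' = 0 ∧ r' + ε < r + v := by
  have h0 : ENNReal.ofReal (boundTerm kind F₁ F₂ B) = ENNReal.ofReal v := by
    rw [hv, ENNReal.ofReal_max, ENNReal.ofReal_zero, max_eq_right zero_le]
  have hv0 : 0 ≤ v := hv ▸ le_max_left _ _
  rw [upperBound_eq, h0]
  rcases hρ with ⟨h1, h2⟩ | ⟨h1, h2, h3⟩
  · rw [h2]; simp [h1]
  · rcases hd with ⟨h4, h5⟩ | ⟨h4, h5, h6⟩
    · rw [h5] at h3; simp at h3
    · rw [h3, h6, ← ENNReal.ofReal_add h2 hε.le, ← ENNReal.ofReal_add h5 hv0,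
        ENNReal.ofReal_lt_ofReal_iff_of_nonneg (by positivity)]
      simp [h1]

/-- Popping only advances the head index, which equals the number of iterations. The record of `rho`
uses entries of the popped row that no box occupies, and new boxes go behind the tail, so earlier
rows are preserved and the queue doubles as the record. -/
theorem bodyProg_run {kind : BoundKind} {F₁ F₂ : BiFiltration} {p : ℕ} {ε : ℝ} {k : ℕ} {s : Store}
    (h : LoopInv kind F₁ F₂ p ε k s) (hε : 0 < ε) (hn : 1 ≤ F₁.n + F₂.n)
    (hne : (stateAfter kind F₁ F₂ p ε k).queue ≠ [])
    (hbox : ∀ B ∈ (stateAfter kind F₁ F₂ p ε k).queue, B.lmin ≤ B.lmax ∧ B.mmin ≤ B.mmax) :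
    LoopInv kind F₁ F₂ p ε (k + 1) ((bodyProg kind).run s) := by
  obtain ⟨hI, hX, hY, hk, hQ, hρ, hrec⟩ := h
  have hsucc := stateAfter_succ kind F₁ F₂ p ε k
  generalize hS : stateAfter kind F₁ F₂ p ε k = S at *
  obtain ⟨Q, ρ⟩ := S
  cases Q with
  | nil => exact absurd rfl hne
  | cons B rest =>
  have hBox := hbox B (by simp)
  have hrow : RowBox s k B := hQ.row 0 (Nat.succ_pos _)
  simp only [bodyProg, run_seq]
  -- the current box
  have b1 := popProg_run s hk hrow
  have i1 : Inputs F₁ F₂ p ε (popProg.run s) := hI.run rfl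
  have n1 : ∀ a, a = 3 ∨ a = 4 ∨ a = 6 → (popProg.run s).nat a = s.nat a := by
    rintro a (rfl | rfl | rfl) <;> exact run_nat _ rfl
  have r1 : ∀ a, a = 3 ∨ a = 4 ∨ a = 6 → (popProg.run s).real a = s.real a := by
    rintro a (rfl | rfl | rfl) <;> exact run_real _ rfl
  generalize popProg.run s = s₁ at *
  have c2 := centerProg_run s₁ b1
  have b2 : HasBox (centerProg.run s₁) B := b1.congr (run_nat 60 rfl) (run_real 63 rfl)
  have i2 : Inputs F₁ F₂ p ε (centerProg.run s₁) := i1.run rfl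
  have n2 : ∀ a, a = 3 ∨ a = 4 ∨ a = 6 → (centerProg.run s₁).nat a = s.nat a := by
    intro a ha
    rw [← n1 a ha]
    rcases ha with rfl | rfl | rfl <;> exact run_nat _ rfl
  have r2 : ∀ a, a = 3 ∨ a = 4 ∨ a = 6 → (centerProg.run s₁).real a = s.real a := by
    intro a ha
    rw [← r1 a ha]
    rcases ha with rfl | rfl | rfl <;> exact run_real _ rfl
  generalize centerProg.run s₁ = s₂ at *
  -- the distance
  have v3 := evalProg_run s₂ i2.left i2.right c2 i2.dim i2.size hn
  have b3 : HasBox (evalProg.run s₂) B := b2.congr (run_nat 60 rfl) (run_real 63 rfl)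
  have i3 : Inputs F₁ F₂ p ε (evalProg.run s₂) := i2.run rfl
  have n3 : ∀ a, a = 3 ∨ a = 4 ∨ a = 6 → (evalProg.run s₂).nat a = s.nat a := by
    intro a ha
    rw [← n2 a ha]
    rcases ha with rfl | rfl | rfl <;> exact run_nat _ rfl
  have r3 : ∀ a, a = 3 ∨ a = 4 ∨ a = 6 → (evalProg.run s₂).real a = s.real a := by
    intro a ha
    rw [← r2 a ha]
    rcases ha with rfl | rfl | rfl <;> exact run_real _ rfl
  generalize evalProg.run s₂ = s₃ at *
  -- the maximum
  obtain ⟨u4, k4⟩ := updateProg_run s₃ (by rwa [n3 4 (by simp), r3 4 (by simp)]) v3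
  rw [n3 4 (by simp), hk] at k4
  have b4 : HasBox (updateProg.run s₃) B := b3.congr (run_nat 60 rfl) (run_real 63 rfl)
  have i4 : Inputs F₁ F₂ p ε (updateProg.run s₃) := i3.run rfl
  have n4 : ∀ a, a = 3 ∨ a = 6 → (updateProg.run s₃).nat a = s.nat a := by
    intro a ha
    rw [← n3 a (by tauto)]
    rcases ha with rfl | rfl <;> exact run_nat _ rfl
  have r4 : ∀ a, a = 3 ∨ a = 6 → (updateProg.run s₃).real a = s.real a := by
    intro a ha
    rw [← r3 a (by tauto)]
    rcases ha with rfl | rfl <;> exact run_real _ rfl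
  have v4 : RepresentsValue ((updateProg.run s₃).nat 36 0 0) ((updateProg.run s₃).real 30 0 0)
      (evalDist F₁ F₂ p B.type B.lmid B.mmid) := by
    rwa [run_nat 36 rfl, run_real 30 rfl]
  generalize updateProg.run s₃ = s₄ at *
  -- the record
  have b5 : HasBox (recordProg.run s₄) B := b4.congr (run_nat 60 rfl) (run_real 63 rfl)
  have i5 : Inputs F₁ F₂ p ε (recordProg.run s₄) := i4.run rfl
  have f5 : (recordProg.run s₄).nat 4 = s₄.nat 4 ∧ (recordProg.run s₄).real 4 = s₄.real 4 ∧
      (recordProg.run s₄).nat 36 = s₄.nat 36 ∧ (recordProg.run s₄).real 30 = s₄.real 30 ∧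
      (recordProg.run s₄).nat 6 = s.nat 6 ∧ (recordProg.run s₄).real 6 = s.real 6 :=
    ⟨run_nat 4 rfl, run_real 4 rfl, run_nat 36 rfl, run_real 30 rfl,
      (run_nat 6 rfl).trans (n4 6 (by simp)), (run_real 6 rfl).trans (r4 6 (by simp))⟩
  have g5 : ∀ r, r ≠ k → (recordProg.run s₄).nat 3 r = s.nat 3 r ∧
      (recordProg.run s₄).real 3 r = s.real 3 r := by
    intro r hr
    constructor <;> funext j <;> simp [recordProg, k4, hr, n4, r4]
  have h5 : RowBox (recordProg.run s₄) k B := by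
    refine ⟨?_, ?_, ?_, ?_, ?_⟩ <;>
    simp [recordProg, n4, r4, hrow.code, hrow.lmin, hrow.lmax, hrow.mmin, hrow.mmax]
  have u5 : RepresentsValue ((recordProg.run s₄).nat 3 k 1) ((recordProg.run s₄).real 3 k 4)
      (max ρ (evalDist F₁ F₂ p B.type B.lmid B.mmid)) := by
    simpa [recordProg, k4] using u4
  generalize recordProg.run s₄ = s₅ at *
  obtain ⟨f51, f52, f53, f54, f55, f56⟩ := f5
  rw [← f51, ← f52] at u4
  rw [← f53, ← f54] at v4
  rw [← f51] at k4
  -- the bound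
  have v6 := boundTermProg_run kind s₅ i5.left i5.right b5 hBox.1 hBox.2 i5.size
    (by rw [f56, hX]) (by rw [f56, hY])
  have b6 : HasBox ((boundTermProg kind).run s₅) B := by
    refine b5.congr ?_ ?_ <;> cases kind <;> first | exact run_nat _ rfl | exact run_real _ rfl
  have i6 : Inputs F₁ F₂ p ε ((boundTermProg kind).run s₅) := by
    refine i5.run ?_
    cases kind <;> rfl
  have n6 : ∀ a, a = 3 ∨ a = 4 ∨ a = 6 ∨ a = 36 →
      ((boundTermProg kind).run s₅).nat a = s₅.nat a := by
    rintro a (rfl | rfl | rfl | rfl) <;> cases kind <;> exact run_nat _ rfl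
  have r6 : ∀ a, a = 3 ∨ a = 4 ∨ a = 6 ∨ a = 30 →
      ((boundTermProg kind).run s₅).real a = s₅.real a := by
    rintro a (rfl | rfl | rfl | rfl) <;> cases kind <;> exact run_real _ rfl
  generalize (boundTermProg kind).run s₅ = s₆ at *
  rw [← n6 4 (by simp), ← r6 4 (by simp)] at u4
  rw [← n6 36 (by simp), ← r6 30 (by simp)] at v4
  rw [← n6 4 (by simp)] at k4
  rw [← n6 3 (by simp), ← r6 3 (by simp)] at u5
  have h6 : RowBox s₆ k B := by
    refine ⟨?_, ?_, ?_, ?_, ?_⟩ <;>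
    simp only [n6, r6, true_or, h5.code, h5.lmin, h5.lmax, h5.mmin, h5.mmax]
  have g6 : ∀ r, r ≠ k → s₆.nat 3 r = s.nat 3 r ∧ s₆.real 3 r = s.real 3 r := by
    intro r hr
    rw [n6 3 (by simp), r6 3 (by simp)]
    exact g5 r hr
  have q6 : QueueMem s₆ (k + 1) rest := by
    refine ⟨?_, fun i hi => ?_⟩
    · have := hQ.tail
      rw [n6 6 (by simp), f55, this, List.length_cons]; omega
    · have h7 := hQ.row (i + 1) (by simpa using hi)
      simp only [List.getElem_cons_succ] at h7
      obtain ⟨e1, e2⟩ := g6 (k + (i + 1)) (by omega)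
      rw [show k + 1 + i = k + (i + 1) by omega]
      exact ⟨by rw [e1, h7.code], by rw [e2, h7.lmin], by rw [e2, h7.lmax], by rw [e2, h7.mmin],
        by rw [e2, h7.mmax]⟩
  have x6 : s₆.real 6 = s.real 6 := (r6 6 (by simp)).trans f56
  have hcond := split_iff (kind := kind) (v := s₆.real 66 0 0) hε v4 u4 v6
  -- the final memory, up to the increment
  have hfin : ∀ (t : Store), Inputs F₁ F₂ p ε t → t.real 6 = s₆.real 6 → t.nat 4 = s₆.nat 4 →
      t.real 4 = s₆.real 4 → (∀ r < k + 1, t.nat 3 r = s₆.nat 3 r ∧ t.real 3 r = s₆.real 3 r) →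
      QueueMem t (k + 1) (stateAfter kind F₁ F₂ p ε (k + 1)).queue →
      (stateAfter kind F₁ F₂ p ε (k + 1)).rho =
        max ρ (evalDist F₁ F₂ p B.type B.lmid B.mmid) →
      LoopInv kind F₁ F₂ p ε (k + 1) ((FProg.setN 4 0 0 (reg 4 + 1)).run t) := by
    intro t it t6 t4 t4' t3 tq tρ
    refine ⟨it.run rfl, ?_, ?_, ?_, ⟨?_, fun i hi => ?_⟩, ?_, fun j hj => ?_⟩
    · rw [run_real 6 rfl, t6, x6, hX]
    · rw [run_real 6 rfl, t6, x6, hY]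
    · simp [t4, k4]
    · rw [run_nat 6 rfl, tq.tail]
    · have := tq.row i hi
      refine ⟨?_, ?_, ?_, ?_, ?_⟩ <;>
      simp [this.code, this.lmin, this.lmax, this.mmin, this.mmax]
    · rw [tρ]
      simpa [t4, t4'] using u4
    · obtain ⟨e1, e2⟩ := t3 j hj
      rcases Nat.lt_succ_iff_lt_or_eq.1 hj with hj | rfl
      · obtain ⟨B', rest', a1, a2, a3⟩ := hrec j hj
        obtain ⟨e3, e4⟩ := g6 j hj.ne
        refine ⟨B', rest', a1, ⟨?_, ?_, ?_, ?_, ?_⟩, ?_⟩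
        any_goals simp [e1, e2, e3, e4, a2.code, a2.lmin, a2.lmax, a2.mmin, a2.mmax]
        simpa [e1, e2, e3, e4] using a3
      · refine ⟨B, rest, by rw [hS], ⟨?_, ?_, ?_, ?_, ?_⟩, ?_⟩
        any_goals simp [e1, e2, h6.code, h6.lmin, h6.lmax, h6.mmin, h6.mmax]
        rw [tρ]
        simpa [e1, e2] using u5
  rw [hsucc] at hfin
  simp only [iterate] at hfin
  have hI6 := i6.eps
  simp only [run_cond, Test.holds_and, Test.holds_natEq, Test.holds_realLt, RealExpr.eval_add,
    RealExpr.eval_get, NatExpr.eval_get, NatExpr.eval_ofNat, run_skip]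
  rw [hI6]
  by_cases hsplit : s₆.nat 4 0 1 = 0 ∧ s₆.real 4 0 0 + ε < s₆.real 30 0 0 + s₆.real 66 0 0
  · rw [if_pos (hcond.2 hsplit)] at hfin
    rw [if_pos hsplit]
    obtain ⟨q7, t7⟩ := splitProg_run s₆ b6 q6
    exact hfin _ (i6.run rfl) (run_real 6 rfl) (run_nat 4 rfl) (run_real 4 rfl)
      (fun r hr => t7 r (by omega)) q7 rfl
  · rw [if_neg fun h => hsplit (hcond.1 h)] at hfin
    rw [if_neg hsplit]
    exact hfin _ i6 rfl rfl rfl (fun r hr => ⟨rfl, rfl⟩) q6 rfl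

/-! ## The main program -/

/-- Raise `67` and `68` to the maximal coordinates of the critical values of the
bi-filtration `a`. -/
def extentProg (a : ℕ) : FProg :=
  .rep 40 (.cond (.natLt (reg 40) (.get 0 0 (.lit (a - 1))))
    (maxProg 67 (.get a (reg 40) 0) ;; maxProg 68 (.get a (reg 40) 1)) .skip)

/-- Nonnegative initial entries reconcile the running maximum with `⨆`, which is `0` for a
bi-filtration without simplices. -/
theorem extentProg_run (s : Store) {a : ℕ} (ha : a = 1 ∨ a = 2) {F : BiFiltration}
    (hF : HasInput s a F) (hn : F.n ≤ s.nat 5 0 0) (h67 : 0 ≤ s.real 67 0 0)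
    (h68 : 0 ≤ s.real 68 0 0) :
    ((extentProg a).run s).real 67 0 0 = max (s.real 67 0 0) (⨆ i, (F.val i).1) ∧
    ((extentProg a).run s).real 68 0 0 = max (s.real 68 0 0) (⨆ i, (F.val i).2) := by
  have key := run_rep_induct (extentProg a) rfl s (fun k t =>
    ((s.real 67 0 0 ≤ t.real 67 0 0 ∧ t.real 67 0 0 ≤ max (s.real 67 0 0) (⨆ i, (F.val i).1)) ∧
      ∀ i : Fin F.n, (i : ℕ) < k → (F.val i).1 ≤ t.real 67 0 0) ∧
    (s.real 68 0 0 ≤ t.real 68 0 0 ∧ t.real 68 0 0 ≤ max (s.real 68 0 0) (⨆ i, (F.val i).2)) ∧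
      ∀ i : Fin F.n, (i : ℕ) < k → (F.val i).2 ≤ t.real 68 0 0) (fun _ _ _ h => h)
    (by simp) ?_
  · obtain ⟨⟨h1, h2⟩, h3, h4⟩ := key
    exact ⟨le_antisymm h1.2 (max_le h1.1 (Real.iSup_le (fun i => h2 i (by omega))
        (h67.trans h1.1))),
      le_antisymm h3.2 (max_le h3.1 (Real.iSup_le (fun i => h4 i (by omega)) (h68.trans h3.1)))⟩
  intro k hk t ih hv hf
  have hF' : HasInput t a F := by
    refine hF.congr (hf.nat 0 rfl) ?_ ?_ <;> rcases ha with rfl | rfl <;>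
    first | exact hf.nat _ rfl | exact hf.real _ rfl
  have ha67 : a ≠ 67 := by omega
  simp only [run_cond, Test.holds_natLt, NatExpr.eval_get, NatExpr.eval_ofNat,
    NatExpr.eval_lit, hv, hF'.size, run_skip, run_seq]
  obtain ⟨⟨h1, h2⟩, h3, h4⟩ := ih
  split_ifs with h
  · have e1 := hF'.fst ⟨k, h⟩
    have e2 := hF'.snd ⟨k, h⟩
    simp only at e1 e2
    simp only [maxProg_real_ne (a := 68) (a' := 67) (by decide), maxProg_real, RealExpr.eval_get,
      NatExpr.eval_get, NatExpr.eval_ofNat, hv, maxProg_nat,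
      maxProg_real_ne (a := 67) (a' := 68) (by decide), maxProg_real_ne ha67, e1, e2]
    have g1 := le_ciSup (f := fun i => (F.val i).1) (Set.finite_range _).bddAbove ⟨k, h⟩
    have g2 := le_ciSup (f := fun i => (F.val i).2) (Set.finite_range _).bddAbove ⟨k, h⟩
    refine ⟨⟨⟨le_max_of_le_left h1.1, max_le h1.2 (le_max_of_le_right g1)⟩, fun i hi => ?_⟩,
      ⟨le_max_of_le_left h3.1, max_le h3.2 (le_max_of_le_right g2)⟩, fun i hi => ?_⟩
    · rcases Nat.lt_succ_iff_lt_or_eq.1 hi with hi | hi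
      · exact le_max_of_le_left (h2 i hi)
      · subst hi; exact le_max_right _ _
    · rcases Nat.lt_succ_iff_lt_or_eq.1 hi with hi | hi
      · exact le_max_of_le_left (h4 i hi)
      · subst hi; exact le_max_right _ _
  · exact ⟨⟨h1, fun i hi => h2 i (by omega)⟩, h3, fun i hi => h4 i (by omega)⟩

/-- Compute the extent of the bi-filtrations in real array `6`. -/
def measureProg : FProg :=
  .setR 67 0 0 0 ;; .setR 68 0 0 0 ;; extentProg 1 ;; extentProg 2 ;;
    .setR 6 0 0 (.get 67 0 0) ;; .setR 6 0 1 (.get 68 0 0)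

theorem measureProg_run (s : Store) {F₁ F₂ : BiFiltration} {p : ℕ} {ε : ℝ}
    (h : Inputs F₁ F₂ p ε s) (h₁ : F₁.InQuadrant) :
    (measureProg.run s).real 6 0 0 = maxX F₁ F₂ ∧ (measureProg.run s).real 6 0 1 = maxY F₁ F₂ := by
  simp only [measureProg, run_seq]
  set s₀ := (FProg.setR 68 0 0 0).run ((FProg.setR 67 0 0 0).run s) with hs₀
  have i0 : Inputs F₁ F₂ p ε s₀ := (h.run (P := .setR 67 0 0 0) rfl).run rfl
  have z67 : s₀.real 67 0 0 = 0 := by simp [hs₀]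
  have z68 : s₀.real 68 0 0 = 0 := by simp [hs₀]
  clear_value s₀
  obtain ⟨a1, a2⟩ := extentProg_run s₀ (.inl rfl) i0.left (by rw [i0.size]; omega) z67.ge z68.ge
  have i1 : Inputs F₁ F₂ p ε ((extentProg 1).run s₀) := i0.run rfl
  rw [z67, max_eq_right (Real.iSup_nonneg fun i => (h₁ i).1)] at a1
  rw [z68, max_eq_right (Real.iSup_nonneg fun i => (h₁ i).2)] at a2
  generalize (extentProg 1).run s₀ = s₁ at *
  obtain ⟨b1, b2⟩ := extentProg_run s₁ (.inr rfl) i1.right (by rw [i1.size]; omega)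
    (by rw [a1]; exact Real.iSup_nonneg fun i => (h₁ i).1)
    (by rw [a2]; exact Real.iSup_nonneg fun i => (h₁ i).2)
  rw [a1] at b1
  rw [a2] at b2
  generalize (extentProg 2).run s₁ = s₂ at *
  simp [b1, b2, maxX, maxY]

/-- Put the initial boxes into the queue. -/
def rootsProg : FProg :=
  enqueueProg 0 0 1 0 (.get 6 0 1) ;; enqueueProg 1 0 1 0 (.get 6 0 1) ;;
    enqueueProg 2 0 1 0 (.get 6 0 0) ;; enqueueProg 3 0 1 0 (.get 6 0 0)

theorem rootsProg_run (s : Store) {F₁ F₂ : BiFiltration} (h6 : s.nat 6 0 0 = 0)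
    (hX : s.real 6 0 0 = maxX F₁ F₂) (hY : s.real 6 0 1 = maxY F₁ F₂) :
    QueueMem (rootsProg.run s) 0 (initialState F₁ F₂).queue := by
  have key : ∀ t : Store, t.real 6 = s.real 6 → ∀ c e l Q (ty : SliceType), QueueMem t 0 Q →
      (∀ t, c.eval t = ty.code) → (∀ t : Store, t.real 6 = s.real 6 → RealExpr.eval t e = l) →
      ∃ t', (enqueueProg c 0 1 0 e).run t = t' ∧ t'.real 6 = s.real 6 ∧
        QueueMem t' 0 (Q ++ [⟨ty, 0, 1, 0, l⟩]) := by
    intro t ht c e l Q ty hQ hc he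
    obtain ⟨a, b, -⟩ := enqueueProg_run t (c := c) (e₀ := 0) (e₁ := 1) (e₂ := 0) (e₃ := e)
      (B := ⟨ty, 0, 1, 0, l⟩) hQ (hc t) (by simp) (by simp) (by simp)
      (fun s' hs' => he s' (hs'.extent.trans ht))
    exact ⟨_, rfl, b.extent.trans ht, a⟩
  have v0 : ∀ t : Store, t.real 6 = s.real 6 → (RealExpr.get 6 0 0).eval t = maxX F₁ F₂ := by
    intro t ht; simp [ht, hX]
  have v1 : ∀ t : Store, t.real 6 = s.real 6 → (RealExpr.get 6 0 1).eval t = maxY F₁ F₂ := by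
    intro t ht; simp [ht, hY]
  simp only [rootsProg, run_seq]
  obtain ⟨s₁, g1, b1, q1⟩ := key s rfl 0 _ _ [] .ySteep ⟨h6, by simp⟩ (fun _ => rfl) v1
  obtain ⟨s₂, g2, b2, q2⟩ := key s₁ b1 1 _ _ _ .yFlat q1 (fun _ => rfl) v1
  obtain ⟨s₃, g3, b3, q3⟩ := key s₂ b2 2 _ _ _ .xSteep q2 (fun _ => rfl) v0
  obtain ⟨s₄, g4, b4, q4⟩ := key s₃ b3 3 _ _ _ .xFlat q3 (fun _ => rfl) v0
  rw [g1, g2, g3, g4]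
  exact q4

theorem hasInput_inputStore {F₁ F₂ : BiFiltration} {p : ℕ} {ε : ℝ} :
    HasInput (inputStore F₁ F₂ p ε) 1 F₁ ∧ HasInput (inputStore F₁ F₂ p ε) 2 F₂ := by
  have key : ∀ (A : Finset ℕ) v, v ∈ A ↔
      ∃ k < A.card, (A.card :: A.sort (· ≤ ·)).getD (k + 1) 0 = v := by
    intro A v
    rw [← Finset.mem_sort (· ≤ ·), List.mem_iff_getElem]
    constructor
    · rintro ⟨k, hk, rfl⟩
      exact ⟨k, by simpa using hk, by
        rw [List.getD_cons_succ, List.getD_eq_getElem _ _ hk]⟩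
    · rintro ⟨k, hk, rfl⟩
      refine ⟨k, by simpa using hk, ?_⟩
      simp [hk]
  refine ⟨⟨rfl, fun i => ?_, fun i v => ?_, fun i => ?_, fun i => ?_⟩,
    ⟨rfl, fun i => ?_, fun i v => ?_, fun i => ?_, fun i => ?_⟩⟩
  all_goals simp only [inputStore, i.2, dif_pos]
  · simp
  · exact key _ v
  · simp
  · simp
  · simp
  · exact key _ v
  · simp
  · simp

/-- The preparation of the first iteration. -/
def initProg : FProg := measureProg ;; rootsProg

/-- The approximation algorithm. -/
def mainProgram (kind : BoundKind) : Program :=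
  .seq (.setNat 5 0 0 (.get 0 0 0 + .get 0 0 1))
    (.seq initProg.compile (.loop (.natLt (reg 4) (reg 6)) (bodyProg kind).compile))

theorem loopInv_init (kind : BoundKind) (F₁ F₂ : BiFiltration) (p : ℕ) (ε : ℝ)
    (h₁ : F₁.InQuadrant) : LoopInv kind F₁ F₂ p ε 0
      (initProg.run ((inputStore F₁ F₂ p ε).setNat 5 0 0 (F₁.n + F₂.n))) := by
  set s := (inputStore F₁ F₂ p ε).setNat 5 0 0 (F₁.n + F₂.n) with hs
  have i0 : Inputs F₁ F₂ p ε s := by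
    obtain ⟨a, b⟩ := hasInput_inputStore (F₁ := F₁) (F₂ := F₂) (p := p) (ε := ε)
    exact ⟨a.congr (by simp [hs]) (by simp [hs]) (by simp [hs]),
      b.congr (by simp [hs]) (by simp [hs]) (by simp [hs]), by simp [hs, inputStore],
      by simp [hs], by simp [hs, inputStore]⟩
  have z4 : s.nat 4 = fun _ _ => 0 := by simp [hs, inputStore]
  have z4' : s.real 4 = fun _ _ => 0 := by simp [hs, inputStore]
  have z6 : s.nat 6 = fun _ _ => 0 := by simp [hs, inputStore]
  clear_value s
  simp only [initProg, run_seq]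
  obtain ⟨hX, hY⟩ := measureProg_run s i0 h₁
  have i1 : Inputs F₁ F₂ p ε (measureProg.run s) := i0.run rfl
  have y6 : (measureProg.run s).nat 6 0 0 = 0 := by rw [run_nat 6 rfl, z6]
  have y4 : (measureProg.run s).nat 4 = fun _ _ => 0 := by rw [run_nat 4 rfl, z4]
  have y4' : (measureProg.run s).real 4 = fun _ _ => 0 := by rw [run_real 4 rfl, z4']
  generalize measureProg.run s = s₁ at *
  refine ⟨i1.run rfl, ?_, ?_, ?_, rootsProg_run s₁ y6 hX hY, .inr ⟨?_, ?_, ?_⟩, by simp⟩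
  · rw [run_real 6 rfl, hX]
  · rw [run_real 6 rfl, hY]
  · rw [run_nat 4 rfl, y4]
  · rw [run_nat 4 rfl, y4]
  · rw [run_real 4 rfl, y4']
  · rw [run_real 4 rfl, y4']
    simp [stateAfter, initialState]

/-- The test whether the head is before the tail says that the queue is nonempty, and it costs 7
steps. The body has nesting depth three, whence the cube. -/
theorem exec_loop {kind : BoundKind} {F₁ F₂ : BiFiltration} {p : ℕ} {ε : ℝ} {N : ℕ} (hε : 0 < ε)
    (hn : 1 ≤ F₁.n + F₂.n) (hN : (stateAfter kind F₁ F₂ p ε N).queue = [])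
    (hk : ∀ k < N, (stateAfter kind F₁ F₂ p ε k).queue ≠ [] ∧
      ∀ B ∈ (stateAfter kind F₁ F₂ p ε k).queue, B.lmin ≤ B.lmax ∧ B.mmin ≤ B.mmax) :
    ∀ j k s, k + j = N → LoopInv kind F₁ F₂ p ε k s → ∃ s' T,
      Exec (.loop (.natLt (reg 4) (reg 6)) (bodyProg kind).compile) s s' T ∧
      LoopInv kind F₁ F₂ p ε N s' ∧
      T ≤ j * ((bodyProg kind).coef * (F₁.n + F₂.n) ^ 3 + 7) + 7 := by
  intro j
  induction j with
  | zero =>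
    rintro k s rfl h
    refine ⟨s, _, .loop_false ?_, h, by simp [Test.cost, NatExpr.cost]⟩
    have := h.queue.tail
    rw [add_zero] at hN
    rw [hN] at this
    simp [h.head, this]
  | succ j ih =>
    intro k s hkj h
    obtain ⟨hne, hbox⟩ := hk k (by omega)
    have h' := bodyProg_run h hε hn hne hbox
    obtain ⟨T, hT, hT'⟩ := exec_compile (bodyProg kind) (by cases kind <;> rfl) hn s h.inputs.size
    obtain ⟨s', T', hL, hI, hLT⟩ := ih (k + 1) _ (by omega) h'
    refine ⟨s', _, .loop_true ?_ hT hL, hI, ?_⟩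
    · have := h.queue.tail
      have := List.length_pos_iff.2 hne
      simp only [Test.holds_natLt, NatExpr.eval_get, NatExpr.eval_ofNat, h.head]
      omega
    · have hd : (bodyProg kind).depth = 3 := by cases kind <;> rfl
      have hc : (Test.natLt (reg 4) (reg 6)).cost = 7 := rfl
      rw [hd] at hT'
      rw [hc, add_mul, one_mul]
      omega

end MatchDist

end

/-! ### Cost per iteration times number of iterations -/

open MatchDist in
theorem mainTheorem5 (kind : BoundKind) :
    ∃ (P : Program) (c : ℕ),
      ∀ (F₁ F₂ : BiFiltration) (p : ℕ) (ε : ℝ),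
        F₁.InQuadrant → F₂.InQuadrant → 1 ≤ F₁.n + F₂.n → 0 < ε →
        ∃ (N T : ℕ) (s : Store),
          (stateAfter kind F₁ F₂ p ε N).queue = [] ∧
          Exec P (inputStore F₁ F₂ p ε) s T ∧
          RecordsRun s kind F₁ F₂ p ε N ∧
          (T : ℝ) ≤ c * ((F₁.n + F₂.n : ℕ) : ℝ) ^ 3 *
            (max 1 (max (maxX F₁ F₂) (maxY F₁ F₂) / ε)) ^ 2 := by
  -- The preparation has nesting depth one and costs at most `coef initProg` times `n`. There are at
  -- most `86x²` iterations, each with a test of cost 7, and 20 covers the first assignment (10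
  -- steps) and the last test (7 steps).
  refine ⟨mainProgram kind, FProg.coef initProg + 86 * ((bodyProg kind).coef + 7) + 20, ?_⟩
  intro F₁ F₂ p ε h₁ h₂ hn hε
  obtain ⟨N, hN, hk, hNle⟩ := exists_iterations kind p hε h₁ h₂
  have h0 := loopInv_init kind F₁ F₂ p ε h₁
  obtain ⟨s', T', hL, hI, hLT⟩ := exec_loop hε hn hN hk N 0 _ (by omega) h0
  obtain ⟨T, hT, hTle⟩ := FProg.exec_compile initProg rfl hn
    ((inputStore F₁ F₂ p ε).setNat 5 0 0 (F₁.n + F₂.n)) (by simp)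
  have hset := Exec.setNat (inputStore F₁ F₂ p ε) 5 0 0 (.get 0 0 0 + .get 0 0 1)
  refine ⟨N, 10 + (T + T'), s', hN, .seq hset (.seq hT hL), ⟨fun k hkN => ?_, hI.head, hI.rho⟩, ?_⟩
  · obtain ⟨B, rest, hq, hrow, hrep⟩ := hI.record k hkN
    exact ⟨B, rest, hq, hrow.code, hrow.lmin, hrow.lmax, hrow.mmin, hrow.mmax, hrep⟩
  · have hd : FProg.depth initProg = 1 := rfl
    rw [hd, pow_one] at hTle
    set n := F₁.n + F₂.n
    set x := max 1 (max (maxX F₁ F₂) (maxY F₁ F₂) / ε)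
    set a := FProg.coef initProg
    set b := (bodyProg kind).coef
    have hx : 1 ≤ x ^ 2 := one_le_pow₀ (le_max_left _ _)
    have hn3 : n ≤ n ^ 3 := Nat.le_self_pow (by norm_num) n
    have hn1 : 1 ≤ n ^ 3 := hn.trans hn3
    have e1 : 10 + (T + T') ≤ (a + 17) * n ^ 3 + N * ((b + 7) * n ^ 3) := by
      have e2 : a * n ≤ a * n ^ 3 := Nat.mul_le_mul_left a hn3
      have e3 : N * (b * n ^ 3 + 7) ≤ N * ((b + 7) * n ^ 3) :=
        Nat.mul_le_mul_left N (by rw [add_mul]; omega)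
      rw [add_mul]
      omega
    have e4 : ((10 + (T + T') : ℕ) : ℝ) ≤ (a + 17) * (n : ℝ) ^ 3 + N * ((b + 7) * (n : ℝ) ^ 3) := by
      exact_mod_cast e1
    have hn0 : (0 : ℝ) ≤ (n : ℝ) ^ 3 := by positivity
    calc ((10 + (T + T') : ℕ) : ℝ) ≤ (a + 17) * (n : ℝ) ^ 3 + N * ((b + 7) * (n : ℝ) ^ 3) := e4
      _ ≤ (a + 17) * (n : ℝ) ^ 3 * x ^ 2 + 86 * x ^ 2 * ((b + 7) * (n : ℝ) ^ 3) := by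
        refine add_le_add (le_mul_of_one_le_right (by positivity) hx) ?_
        exact mul_le_mul_of_nonneg_right hNle (by positivity)
      _ = (a + 86 * (b + 7) + 17) * ((n : ℝ) ^ 3 * x ^ 2) := by ring
      _ ≤ (a + 86 * (b + 7) + 20) * ((n : ℝ) ^ 3 * x ^ 2) :=
        mul_le_mul_of_nonneg_right (by linarith) (by positivity)
      _ = _ := by push_cast; ring
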